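/- **Setting.** Let $N\ge 1$, $\mathcal H=\ell^2(\mathbb Z,\mathbb C^N)$, $\mathbb T=\mathbb R/2\pi\mathbb Z$. Let $(A_j)_{j\in\mathbb Z}$ be complex $N\times N$ matrices with $\sum_j\|A_j\|<\infty$ and $A_{-j}=A_j^*$, and let $h(p)=\sum_m A_m e^{imp}$. Assume that $h$, seen as a function of $e^{ip}$, extends holomorphically to an annulus $\{1/r<|z|<r\}$ for some $r>1$. Let $\lambda_1,\dots,\lambda_N:\mathbb T\to\mathbb R$ and $W_1,\dots,W_N:\mathbb T\to\mathbb C^N$ be repeated eigenvalues and a corresponding orthonormal basis of eigenvectors of $h(p)$, all of which coincide on $[-\pi,\pi)$ with functions that are $C^\infty$ on $\mathbb R$ (so they are smooth on $(-\pi,\pi)$ and, as $2\pi$-periodic functions, piecewise smooth on $\mathbb R$). Let $\kappa(h)=\bigcup_j\kappa(\lambda_j)$, where $\kappa(\lambda_j)$ consists of the left and right limits of $\lambda_j$ at the points where $\lambda_j$ or $W_j$ is not smooth (as $2\pi$-periodic functions), and of the values $\lambda_j(p)$ at the points $p\in\mathbb R$ where $\lambda_j'(p)=0$. **Conjugate operator.**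 Let $\Delta$ be a nonempty compact interval with $\Delta\cap\kappa(h)=\emptyset$, $I\supset\Delta$ a bounded open interval with $\overline I\cap\kappa(h)=\emptyset$, and $\zeta\in C^\infty(\mathbb R,\mathbb R)$ supported in $\overline I$ with $\zeta=1$ on $\Delta$. Put $F_j(p)=\zeta(\lambda_j(p))\,\lambda_j'(p)/|\lambda_j'(p)|^2$ (and $F_j(p)=0$ where $\zeta(\lambda_j(p))=0$). Let $\mathbf a_j$ be the closure in $L^2(\mathbb T)$ of $iF_j\frac{d}{dp}+\frac i2F_j'$ defined on $C^\infty(\mathbb T)$. With the unitary map $\mathcal U:\mathcal H\to\bigoplus_{j=1}^N L^2(\mathbb T,\frac{dp}{2\pi})$, $(\mathcal U\psi)_j(p)=\langle W_j(p),\widehat\psi(p)\rangle$, $\widehat\psi(p)=\sum_n\psi_ne^{inp}$, set $\mathbb A=\mathcal U^{-1}(\mathbf a_1\oplus\dots\oplus\mathbf a_N)\,\mathcal U$, a self-adjoint operator in $\mathcal H$. A bounded operator $S$ on $\mathcal H$ is *of class $\mathcal C^{1,1}(\mathbb A)$* if $$\int_0^1\big\|e^{-i\mathbb A\varepsilon}Se^{i\mathbb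 A\varepsilon}-2S+e^{i\mathbb A\varepsilon}Se^{-i\mathbb A\varepsilon}\big\|\,\frac{d\varepsilon}{\varepsilon^2}<\infty .$$ **Proposition.** Let $V=(V_{ij})_{i,j\in\mathbb Z}$, with blocks $V_{ij}\in B(\mathbb C^N)$, be a bounded symmetric operator in $\mathcal H$. For $r\ge1$ put $$n_V(r)=\Big(\sup_{r\le|i|\le2r}\sum_{j\in\mathbb Z}\|V_{ij}\|\Big)\Big(\sup_{j\in\mathbb Z}\sum_{r\le|i|\le2r}\|V_{ij}\|\Big),\qquad p_V(r)=\sum_{r\le|i|\le2r}\ \sum_{j\in\mathbb Z}\|V_{ij}\|^2 .$$ If $\int_1^\infty\sqrt{n_V(r)}\,dr<\infty$, then $V$ is of class $\mathcal C^{1,1}(\mathbb A)$. Likewise, if $\int_1^\infty\sqrt{p_V(r)}\,dr<\infty$, then $V$ is of class $\mathcal C^{1,1}(\mathbb A)$. -/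

import Mathlib

open MeasureTheory Filter Topology Set
open scoped ENNReal ContDiff Matrix

noncomputable section

namespace BlockLaurent

/-- `ℂ^N` with its Euclidean norm. -/
abbrev Fib (N : ℕ) : Type := EuclideanSpace ℂ (Fin N)

/-- `ℓ²(ℤ, ℂ^N)`. -/
abbrev Seq (N : ℕ) : Type := lp (fun _ : ℤ => Fib N) 2

instance factTwoPi : Fact (0 < 2 * Real.pi) := ⟨Real.two_pi_pos⟩

/-- The torus `ℝ / 2πℤ`; a function on it is a `2π`-periodic function on `ℝ`. -/
abbrev Torus : Type := AddCircle (2 * Real.pi)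

/-- Normalised Lebesgue measure `dp / 2π` on the torus. -/
abbrev torusMeasure : Measure Torus := AddCircle.haarAddCircle

/-- Scalar `L²` of the torus. -/
abbrev L2T : Type := Lp ℂ 2 torusMeasure

/-! ### The symbol, its eigenvalues and eigenvectors, and the critical set -/

/-- The symbol `h(p) = ∑ₘ Aₘ e^{imp}`. -/
def symbol {N : ℕ} (A : ℤ → Matrix (Fin N) (Fin N) ℂ) (p : Torus) :
    Matrix (Fin N) (Fin N) ℂ :=
  ∑' m : ℤ, (fourier m p : ℂ) • A m

/-- `h`, seen as a function of `e^{ip}`, extends holomorphically to an annulus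
`1/r < |z| < r` with `r > 1`. -/
def HasHolomorphicExtension {N : ℕ} (h : Torus → Matrix (Fin N) (Fin N) ℂ) : Prop :=
  ∃ r : ℝ, 1 < r ∧ ∃ G : ℂ → Matrix (Fin N) (Fin N) ℂ,
    (∀ k l, DifferentiableOn ℂ (fun z => G z k l) {z : ℂ | 1 / r < ‖z‖ ∧ ‖z‖ < r}) ∧
    ∀ p : ℝ, G (Complex.exp (Complex.I * p)) = h (p : Torus)

/-- `lam` and `W` are `2π`-periodic families of repeated eigenvalues of `h` and of corresponding
orthonormal eigenvectors.  They are smooth on `(-π, π)` and piecewise smooth on `ℝ`: on `[-π, π)`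
they coincide with functions that are smooth on all of `ℝ`. -/
structure IsEigenSystem {N : ℕ} (h : Torus → Matrix (Fin N) (Fin N) ℂ)
    (lam : Fin N → Torus → ℝ) (W : Fin N → Torus → Fib N) : Prop where
  eigen : ∀ j p, Matrix.toEuclideanLin (h p) (W j p) = (lam j p : ℂ) • W j p
  orthonormal : ∀ p, Orthonormal ℂ fun j => W j p
  piecewise_lam : ∀ j, ∃ g : ℝ → ℝ, ContDiff ℝ ∞ g ∧
    ∀ x ∈ Ico (-Real.pi) Real.pi, lam j (x : Torus) = g x
  piecewise_W : ∀ j, ∃ g : ℝ → Fib N, ContDiff ℝ ∞ g ∧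
    ∀ x ∈ Ico (-Real.pi) Real.pi, W j (x : Torus) = g x

/-- `p` is a regular point of the periodic eigenpair `(l, w)`: both are smooth at `p`. -/
def RegularAt {N : ℕ} (l : Torus → ℝ) (w : Torus → Fib N) (p : ℝ) : Prop :=
  ContDiffAt ℝ ∞ (fun x : ℝ => l (x : Torus)) p ∧ ContDiffAt ℝ ∞ (fun x : ℝ => w (x : Torus)) p

/-- Values of `l` at the points which are not regular: left and right limits. -/
def singularValues {N : ℕ} (l : Torus → ℝ) (w : Torus → Fib N) : Set ℝ :=
  {c | ∃ p : ℝ, ¬ RegularAt l w p ∧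
    (Tendsto (fun x : ℝ => l (x : Torus)) (𝓝[<] p) (𝓝 c) ∨
      Tendsto (fun x : ℝ => l (x : Torus)) (𝓝[≥] p) (𝓝 c))}

/-- The critical set: singular values and critical values of the eigenvalue functions. -/
def criticalSet {N : ℕ} (lam : Fin N → Torus → ℝ) (W : Fin N → Torus → Fib N) : Set ℝ :=
  ⋃ j, singularValues (lam j) (W j) ∪
    {c | ∃ p : ℝ, HasDerivAt (fun x : ℝ => lam j (x : Torus)) 0 p ∧ c = lam j (p : Torus)}

/-! ### The conjugate operator -/

/-- The vector field `F = ζ(l) l' / |l'|²`. -/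
def vectorField (ζ : ℝ → ℝ) (l : Torus → ℝ) (x : ℝ) : ℝ :=
  ζ (l (x : Torus)) *
    (deriv (fun y : ℝ => l (y : Torus)) x / |deriv (fun y : ℝ => l (y : Torus)) x| ^ 2)

/-- The graph in `L²(𝕋) × L²(𝕋)` of `a = i F d/dp + (i/2) F'` with domain `C^∞(𝕋)`. -/
def coreGraph (F : ℝ → ℝ) : Submodule ℂ (L2T × L2T) where
  carrier := {q | ∃ φ χ : Torus → ℂ,
    ContDiff ℝ ∞ (fun x : ℝ => φ (x : Torus)) ∧
    (∀ x : ℝ, χ (x : Torus) = Complex.I * F x * deriv (fun y : ℝ => φ (y : Torus)) x +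
      Complex.I / 2 * deriv F x * φ (x : Torus)) ∧
    q.1 =ᵐ[torusMeasure] φ ∧ q.2 =ᵐ[torusMeasure] χ}
  zero_mem' := by
    refine ⟨fun _ => 0, fun _ => 0, contDiff_const, fun x => by simp, ?_, ?_⟩
    · exact Lp.coeFn_zero ℂ 2 torusMeasure
    · exact Lp.coeFn_zero ℂ 2 torusMeasure
  add_mem' := by
    rintro ⟨f, g⟩ ⟨f', g'⟩ ⟨φ, χ, h1, h2, h3, h4⟩ ⟨φ', χ', h1', h2', h3', h4'⟩
    refine ⟨φ + φ', χ + χ', h1.add h1', fun x => ?_, ?_, ?_⟩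
    · have e : deriv (fun y : ℝ => (φ + φ') (y : Torus)) x =
          deriv (fun y : ℝ => φ (y : Torus)) x + deriv (fun y : ℝ => φ' (y : Torus)) x :=
        deriv_fun_add (h1.differentiable (by simp) x) (h1'.differentiable (by simp) x)
      rw [e, Pi.add_apply, Pi.add_apply, h2, h2']
      ring
    · exact (Lp.coeFn_add f f').trans (h3.add h3')
    · exact (Lp.coeFn_add g g').trans (h4.add h4')
  smul_mem' := by
    rintro c ⟨f, g⟩ ⟨φ, χ, h1, h2, h3, h4⟩
    refine ⟨c • φ, c • χ, contDiff_const.smul h1, fun x => ?_, ?_, ?_⟩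
    · have e : deriv (fun y : ℝ => (c • φ) (y : Torus)) x =
          c • deriv (fun y : ℝ => φ (y : Torus)) x :=
        deriv_fun_const_smul c (h1.differentiable (by simp) x)
      rw [e, Pi.smul_apply, Pi.smul_apply, h2]
      simp only [smul_eq_mul]
      ring
    · exact (Lp.coeFn_smul c f).trans (h3.const_smul c)
    · exact (Lp.coeFn_smul c g).trans (h4.const_smul c)

/-- The graph of the closure of `a = (i/2) (F d/dp + d/dp F)` on `C^∞(𝕋)`. -/
def bandGraph (F : ℝ → ℝ) : Submodule ℂ (L2T × L2T) := (coreGraph F).topologicalClosure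

/-- The `k`-th coordinate of the Fourier transform `ψ̂(p) = ∑ₙ ψₙ e^{inp}`, in `L²(𝕋)`. -/
def fourierCoord {N : ℕ} (k : Fin N) : Seq N →ₗ[ℂ] L2T :=
  (fourierBasis (T := 2 * Real.pi)).repr.symm.toLinearEquiv.toLinearMap ∘ₗ
    (lp.mapCLM (𝕜 := ℂ) 2 (fun _ : ℤ => (EuclideanSpace.proj k : Fib N →L[ℂ] ℂ)) zero_le_one
      (fun _ => ContinuousLinearMap.opNorm_le_bound _ zero_le_one fun x => by
        simpa using PiLp.norm_apply_le x k)).toLinearMap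

/-- One component `p ↦ ⟨w(p), ψ̂(p)⟩` of the transformation diagonalising the Laurent operator
(the inner product is antilinear in its first argument). -/
def bandComponent {N : ℕ} (w : Torus → Fib N) (ψ : Seq N) (p : Torus) : ℂ :=
  ∑ k : Fin N, (starRingEnd ℂ) (w p k) * (fourierCoord k ψ : Torus → ℂ) p

/-- The graph of `𝒰⁻¹ (a₁ ⊕ ⋯ ⊕ a_N) 𝒰` in `ℓ²(ℤ, ℂ^N)`, where `(𝒰ψ)_j = ⟨W_j, ψ̂⟩` and `a_j` is the
closed operator of the vector field `F_j`. -/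
def conjugateGraph {N : ℕ} (W : Fin N → Torus → Fib N) (F : Fin N → ℝ → ℝ) :
    Submodule ℂ (Seq N × Seq N) where
  carrier := {q | ∀ j, ∃ f g : L2T, f =ᵐ[torusMeasure] bandComponent (W j) q.1 ∧
    g =ᵐ[torusMeasure] bandComponent (W j) q.2 ∧ (f, g) ∈ bandGraph (F j)}
  zero_mem' := by
    intro j
    have e : (0 : L2T) =ᵐ[torusMeasure] bandComponent (W j) 0 := by
      refine Eventually.of_forall fun p => ?_
      simp [bandComponent]
    exact ⟨0, 0, e, e, (bandGraph (F j)).zero_mem⟩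
  add_mem' := by
    have key : ∀ (w : Torus → Fib N) (ψ ψ' : Seq N) (f f' : L2T),
        f =ᵐ[torusMeasure] bandComponent w ψ → f' =ᵐ[torusMeasure] bandComponent w ψ' →
        (f + f' : L2T) =ᵐ[torusMeasure] bandComponent w (ψ + ψ') := by
      intro w ψ ψ' f f' h h'
      have hk : ∀ᵐ p ∂torusMeasure, ∀ k : Fin N, (fourierCoord k (ψ + ψ') : Torus → ℂ) p =
          (fourierCoord k ψ : Torus → ℂ) p + (fourierCoord k ψ' : Torus → ℂ) p := by
        rw [ae_all_iff]
        intro k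
        rw [map_add]
        exact Lp.coeFn_add _ _
      filter_upwards [h, h', hk, Lp.coeFn_add f f'] with p h1 h2 h3 h4
      rw [h4, Pi.add_apply, h1, h2]
      simp only [bandComponent, h3, mul_add, Finset.sum_add_distrib]
    rintro ⟨ψ, φ⟩ ⟨ψ', φ'⟩ h h' j
    obtain ⟨f, g, h1, h2, h3⟩ := h j
    obtain ⟨f', g', h1', h2', h3'⟩ := h' j
    exact ⟨f + f', g + g', key _ _ _ _ _ h1 h1', key _ _ _ _ _ h2 h2',
      (bandGraph (F j)).add_mem h3 h3'⟩
  smul_mem' := by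
    have key : ∀ (c : ℂ) (w : Torus → Fib N) (ψ : Seq N) (f : L2T),
        f =ᵐ[torusMeasure] bandComponent w ψ →
        (c • f : L2T) =ᵐ[torusMeasure] bandComponent w (c • ψ) := by
      intro c w ψ f h
      have hk : ∀ᵐ p ∂torusMeasure, ∀ k : Fin N, (fourierCoord k (c • ψ) : Torus → ℂ) p =
          c * (fourierCoord k ψ : Torus → ℂ) p := by
        rw [ae_all_iff]
        intro k
        rw [map_smul]
        exact Lp.coeFn_smul _ _
      filter_upwards [h, hk, Lp.coeFn_smul c f] with p h1 h3 h4
      rw [h4, Pi.smul_apply, h1]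
      simp only [bandComponent, h3, smul_eq_mul, Finset.mul_sum]
      exact Finset.sum_congr rfl fun k _ => by ring
    rintro c ⟨ψ, φ⟩ h j
    obtain ⟨f, g, h1, h2, h3⟩ := h j
    exact ⟨c • f, c • g, key _ _ _ _ h1, key _ _ _ _ h2, (bandGraph (F j)).smul_mem c h3⟩

/-- The conjugate operator `𝔸 = 𝒰⁻¹ (a₁ ⊕ ⋯ ⊕ a_N) 𝒰` as an unbounded operator, where `a_j` is built
from `F_j = ζ(λ_j) λ_j' / |λ_j'|²`. -/
def conjugateOperator {N : ℕ} (ζ : ℝ → ℝ) (lam : Fin N → Torus → ℝ) (W : Fin N → Torus → Fib N) :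
    Seq N →ₗ.[ℂ] Seq N :=
  (conjugateGraph W fun j => vectorField ζ (lam j)).toLinearPMap

/-! ### Regularity with respect to an unbounded self-adjoint operator -/

section Regularity

variable {E : Type*} [NormedAddCommGroup E] [InnerProductSpace ℂ E]

/-- `U t = e^{itA}`: `U` is a strongly continuous one-parameter group of unitary operators, and its
generator, with its exact domain, is `iA`.  By Stone's theorem there is such a `U`, and then only
one, precisely when `A` is self-adjoint. -/
structure IsUnitaryGroupOf (A : E →ₗ.[ℂ] E) (U : ℝ → E →L[ℂ] E) : Prop where
  zero : U 0 = 1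
  add : ∀ s t, U (s + t) = U s * U t
  isometry : ∀ t ψ, ‖U t ψ‖ = ‖ψ‖
  continuous : ∀ ψ, Continuous fun t => U t ψ
  generator : ∀ ψ φ, (ψ, φ) ∈ A.graph ↔ HasDerivAt (fun t => U t ψ) (Complex.I • φ) 0

/-- `S` is of class `𝒞^{1,1}(A)`:
`∫₀¹ ‖e^{-iAε} S e^{iAε} - 2 S + e^{iAε} S e^{-iAε}‖ dε / ε² < ∞`. -/
def IsOfClassC11 (A : E →ₗ.[ℂ] E) (S : E →L[ℂ] E) : Prop :=
  ∃ U : ℝ → E →L[ℂ] E, IsUnitaryGroupOf A U ∧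
    ∫⁻ ε in Ioo (0 : ℝ) 1,
      ENNReal.ofReal (‖U (-ε) * S * U ε - (2 : ℂ) • S + U ε * S * U (-ε)‖ / ε ^ 2) < ⊤

end Regularity

/-! ### Schur and Hilbert-Schmidt quantities of a block matrix -/

/-- The block `V_{ij} : ℂ^N → ℂ^N` of a bounded operator on `ℓ²(ℤ, ℂ^N)`. -/
def block {N : ℕ} (V : Seq N →L[ℂ] Seq N) (i j : ℤ) : Fib N →L[ℂ] Fib N :=
  (lp.evalCLM ℂ (fun _ : ℤ => Fib N) 2 i) ∘L V ∘L
    (lp.singleContinuousLinearMap ℂ (fun _ : ℤ => Fib N) 2 j)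

/-- The indices `i` with `r ≤ |i| ≤ 2r`. -/
def window (r : ℝ) : Set ℤ := {i | r ≤ |(i : ℝ)| ∧ |(i : ℝ)| ≤ 2 * r}

/-- `n_V(r) = (sup_{r ≤ |i| ≤ 2r} ∑_j ‖V_{ij}‖) (sup_j ∑_{r ≤ |i| ≤ 2r} ‖V_{ij}‖)`. -/
def schurQuantity {N : ℕ} (V : Seq N →L[ℂ] Seq N) (r : ℝ) : ℝ≥0∞ :=
  (⨆ i ∈ window r, ∑' j : ℤ, ‖block V i j‖ₑ) * (⨆ j : ℤ, ∑' i : window r, ‖block V i j‖ₑ)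

/-- `p_V(r) = ∑_{r ≤ |i| ≤ 2r, j} ‖V_{ij}‖²`. -/
def hilbertSchmidtQuantity {N : ℕ} (V : Seq N →L[ℂ] Seq N) (r : ℝ) : ℝ≥0∞ :=
  ∑' i : window r, ∑' j : ℤ, ‖block V i j‖ₑ ^ 2

end BlockLaurent

end

/-! In momentum space `𝔸` is a first order differential operator, so a sequence supported in `|n| ≤
b`, `b ≥ 1`, lies in the domain of `𝔸²`, and `𝔸`, `𝔸²` cost at most constants times `b` and `b²` on
it (`exists_truncL_mem_conjugateGraph`). If `T` lives on such indices on both sides, a Taylor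
expansion of `e^{±iεA}` bounds its second difference by a constant times `min(1, (εb)²) ‖T‖`
(`norm_secondDiff_le_sq`). Integrated against `dε/ε²` this gives a constant times `b ‖T‖`.

Write `V` as the sum of the differences `T_l` of its truncations to balls of radius `(3/2)^l`. It
then suffices that `∑ (3/2)^l ‖T_l‖ < ∞`. Up to a factor 2, `‖T_l‖` is at most the norm of the rows
of `V` in one shell. The Schur test or the Hilbert-Schmidt bound controls these rows by `√n_V(r)` or
`√p_V(r)`, for all `r` in an interval of length proportional to `(3/2)^l`. These intervals are
disjoint, so the integral hypothesis sums the series (`summable_radius_mul_layer`).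

Two points need care. The eigenvectors `W_j` may jump at `±π`, so `⟨W_j, ψ̂⟩` need not belong to the
core `C^∞(𝕋)`. But at a singular point the one-sided limits of `λ_j` are in the critical set, hence
`F_j` vanishes nearby and no boundary term survives integration by parts
(`exists_admissible_extension`). Also, the group `e^{it𝔸}` must exist. In the Fourier basis `a_j`
has the matrix `-(k+n)/2 · F̂_j(k-n)` with rapidly decaying `F̂_j`; a commutator estimate with
slowly varying cut-offs excludes deficiency vectors (`eq_zero_of_symmetric_matrix`), and Stone's
theorem applies. The same self-adjointness turns weak identities into membership in the closed
graph. -/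

noncomputable section
namespace BlockLaurent

/-! ### Symmetric relations, their resolvents and bounded approximations -/

section Stone

variable {E : Type*} [NormedAddCommGroup E] [InnerProductSpace ℂ E]

local notation "⟪" x ", " y "⟫" => inner ℂ x y

/-- A symmetric linear relation. -/
def IsSymmetricGraph (Γ : Submodule ℂ (E × E)) : Prop :=
  ∀ p ∈ Γ, ∀ q ∈ Γ, ⟪p.2, q.1⟫ = ⟪p.1, q.2⟫

/-- The relation `Γ + iμ` is surjective. -/
def HasFullRange (Γ : Submodule ℂ (E × E)) (μ : ℝ) : Prop :=
  ∀ h : E, ∃ p ∈ Γ, p.2 + (Complex.I * μ) • p.1 = h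

/-- `U` is a strongly continuous unitary group with generator `iΓ`. -/
structure IsUnitaryGroupOfGraph (Γ : Submodule ℂ (E × E)) (U : ℝ → E →L[ℂ] E) : Prop where
  zero : U 0 = 1
  add : ∀ s t, U (s + t) = U s * U t
  isometry : ∀ t ψ, ‖U t ψ‖ = ‖ψ‖
  continuous : ∀ ψ, Continuous fun t => U t ψ
  generator : ∀ ψ φ, (ψ, φ) ∈ Γ ↔ HasDerivAt (fun t => U t ψ) (Complex.I • φ) 0

/-- The cross term is the real part of `iμ` times the real number `⟪p.2, p.1⟫`. This identity yields
injectivity of `Γ + iμ`, the resolvent bound `1/|μ|` and the closedness of the range. -/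
theorem IsSymmetricGraph.norm_sq_add {Γ : Submodule ℂ (E × E)} (hs : IsSymmetricGraph Γ)
    {p : E × E} (hp : p ∈ Γ) (μ : ℝ) :
    ‖p.2 + (Complex.I * μ) • p.1‖ ^ 2 = ‖p.2‖ ^ 2 + μ ^ 2 * ‖p.1‖ ^ 2 := by
  have h := hs p hp p hp
  have him : (⟪p.2, p.1⟫).im = 0 := by
    have h2 : (starRingEnd ℂ) ⟪p.2, p.1⟫ = ⟪p.2, p.1⟫ := by rw [inner_conj_symm]; exact h.symm
    exact Complex.conj_eq_iff_im.mp h2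
  rw [norm_add_sq (𝕜 := ℂ), inner_smul_right, norm_smul]
  have : RCLike.re (Complex.I * μ * ⟪p.2, p.1⟫) = 0 := by
    simp [him]
  rw [this]
  simp [mul_pow]

theorem IsSymmetricGraph.norm_fst_le {Γ : Submodule ℂ (E × E)} (hs : IsSymmetricGraph Γ)
    {p : E × E} (hp : p ∈ Γ) (μ : ℝ) :
    |μ| * ‖p.1‖ ≤ ‖p.2 + (Complex.I * μ) • p.1‖ := by
  refine abs_le_of_sq_le_sq' ?_ (norm_nonneg _) |>.2
  rw [hs.norm_sq_add hp, mul_pow, sq_abs]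
  nlinarith [sq_nonneg ‖p.2‖]

/-- Resolvent of a symmetric relation with full range. -/
theorem IsSymmetricGraph.exists_resolvent {Γ : Submodule ℂ (E × E)} (hs : IsSymmetricGraph Γ)
    {μ : ℝ} (hμ : μ ≠ 0) (hr : HasFullRange Γ μ) :
    ∃ R : E →L[ℂ] E, (∀ h, (R h, h - (Complex.I * μ) • R h) ∈ Γ) ∧
      (∀ p ∈ Γ, R (p.2 + (Complex.I * μ) • p.1) = p.1) ∧ ∀ h, ‖R h‖ ≤ |μ|⁻¹ * ‖h‖ := by
  have hμ' : 0 < |μ| := abs_pos.mpr hμ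
  have uniq : ∀ p ∈ Γ, ∀ q ∈ Γ, p.2 + (Complex.I * μ) • p.1 = q.2 + (Complex.I * μ) • q.1 →
      p.1 = q.1 := by
    intro p hp q hq h
    have h1 := hs.norm_fst_le (Γ.sub_mem hp hq) μ
    have h2 : (p - q).2 + (Complex.I * μ) • (p - q).1 = 0 := by
      rw [Prod.fst_sub, Prod.snd_sub, smul_sub]
      rw [← sub_eq_zero] at h
      rw [← h]; abel
    rw [h2, norm_zero] at h1
    have h3 : ‖(p - q).1‖ = 0 := by
      nlinarith [norm_nonneg (p - q).1]
    exact sub_eq_zero.mp (norm_eq_zero.mp h3)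
  choose r hrΓ hre using hr
  have key : ∀ p ∈ Γ, (r (p.2 + (Complex.I * μ) • p.1)).1 = p.1 := fun p hp =>
    uniq _ (hrΓ _) _ hp (hre _)
  let R0 : E →ₗ[ℂ] E :=
    { toFun := fun h => (r h).1
      map_add' := fun x y => by
        refine uniq _ (hrΓ _) _ (Γ.add_mem (hrΓ x) (hrΓ y)) ?_
        rw [hre, Prod.fst_add, Prod.snd_add, smul_add]
        conv_lhs => rw [← hre x, ← hre y]
        abel
      map_smul' := fun c x => by
        refine uniq _ (hrΓ _) _ (Γ.smul_mem c (hrΓ x)) ?_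
        rw [hre, Prod.smul_fst, Prod.smul_snd]
        conv_lhs => rw [← hre x]
        rw [smul_add, smul_comm c] }
  refine ⟨R0.mkContinuous |μ|⁻¹ fun h => ?_, fun h => ?_, key, fun h => ?_⟩
  · have := hs.norm_fst_le (hrΓ h) μ
    rw [hre] at this
    rw [inv_mul_eq_div, le_div_iff₀ hμ', mul_comm]
    exact this
  · have : h - (Complex.I * μ) • (r h).1 = (r h).2 := by
      rw [sub_eq_iff_eq_add, hre h]
    change ((r h).1, h - (Complex.I * μ) • (r h).1) ∈ Γ
    rw [this]
    exact hrΓ h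
  · exact (LinearMap.mkContinuous_norm_le' _ _) |> fun H =>
      (R0.mkContinuous |μ|⁻¹ _).le_of_opNorm_le (H.trans (by simp)) h

theorem _root_.HasDerivAt.apply_const {T : ℝ → E →L[ℂ] E} {T' : E →L[ℂ] E} {t : ℝ}
    (h : HasDerivAt T T' t) (f : E) : HasDerivAt (fun s => T s f) (T' f) t :=
  ((ContinuousLinearMap.apply ℂ E f).restrictScalars ℝ).hasFDerivAt.comp_hasDerivAt t h

/-- The mean value inequality around `0`. -/
theorem norm_sub_le_of_hasDerivAt {f f' : ℝ → E} {C t : ℝ}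
    (hf : ∀ s, HasDerivAt f (f' s) s) (hC : ∀ s, |s| ≤ |t| → ‖f' s‖ ≤ C) :
    ‖f t - f 0‖ ≤ C * |t| := by
  have := (convex_Icc (-|t|) |t|).norm_image_sub_le_of_norm_hasDerivWithin_le (x := 0) (y := t)
    (fun s _ => (hf s).hasDerivWithinAt) (fun s hs => hC s (abs_le.mpr hs))
    (mem_Icc.mpr (by simp)) (abs_le.mp le_rfl)
  simpa using this

/-- A symmetric relation whose two deficiency spaces vanish contains its adjoint. -/
theorem IsSymmetricGraph.mem_of_adjoint {Γ : Submodule ℂ (E × E)} (hs : IsSymmetricGraph Γ)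
    {μ : ℝ} (hr : HasFullRange Γ μ) (hr' : HasFullRange Γ (-μ)) {ψ φ : E}
    (h : ∀ p ∈ Γ, ⟪p.2, ψ⟫ = ⟪p.1, φ⟫) : (ψ, φ) ∈ Γ := by
  obtain ⟨q, hq, he⟩ := hr (φ + (Complex.I * μ) • ψ)
  have h1 : φ - q.2 = -((Complex.I * μ) • (ψ - q.1)) := by
    have : φ = q.2 + (Complex.I * μ) • q.1 - (Complex.I * μ) • ψ := by rw [he]; abel
    rw [this, smul_sub]; abel
  -- `ψ - q.1` is orthogonal to the range of `Γ - iμ`, which is everything; so it is represented in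
  -- that range and tested against itself.
  obtain ⟨p, hp, hpe⟩ := hr' (ψ - q.1)
  have h2 : ⟪p.2, ψ - q.1⟫ = ⟪p.1, φ - q.2⟫ := by
    rw [inner_sub_right, inner_sub_right, h p hp, hs p hp q hq]
  have h3 : ⟪ψ - q.1, ψ - q.1⟫ = 0 := by
    conv_lhs => lhs; rw [← hpe]
    rw [inner_add_left, inner_smul_left, h2, h1, inner_neg_right, inner_smul_right]
    simp
  have h4 : ψ - q.1 = 0 := inner_self_eq_zero.mp h3
  rw [h4, smul_zero, neg_zero] at h1
  have : (ψ, φ) = q := Prod.ext (sub_eq_zero.mp h4) (sub_eq_zero.mp h1)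
  rw [this]
  exact hq

variable [CompleteSpace E]

/-- Commuting bounded self-adjoint approximations of a self-adjoint relation. -/
theorem IsSymmetricGraph.exists_approximants {Γ : Submodule ℂ (E × E)} (hs : IsSymmetricGraph Γ)
    (hd : Dense {u : E | ∃ v, (u, v) ∈ Γ}) {μ₀ : ℝ} (hr : ∀ μ : ℝ, μ₀ ≤ |μ| → HasFullRange Γ μ) :
    ∃ A : ℕ → E →L[ℂ] E, (∀ n, IsSelfAdjoint (A n)) ∧ (∀ m n, Commute (A m) (A n)) ∧
      ∀ p ∈ Γ, (∀ n, ‖A n p.1‖ ≤ ‖p.2‖) ∧ Tendsto (fun n => A n p.1) atTop (𝓝 p.2) := by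
  have hex : ∀ μ : {μ : ℝ // μ ≠ 0 ∧ μ₀ ≤ |μ|}, ∃ R : E →L[ℂ] E,
      (∀ h, (R h, h - (Complex.I * μ) • R h) ∈ Γ) ∧
      (∀ p ∈ Γ, R (p.2 + (Complex.I * μ) • p.1) = p.1) ∧ ∀ h, ‖R h‖ ≤ |μ.1|⁻¹ * ‖h‖ := fun μ =>
    hs.exists_resolvent μ.2.1 (hr μ μ.2.2)
  choose R hR1 hR2 hR3 using hex
  -- The first resolvent identity.
  have hcomm : ∀ μ ν, Commute (R μ) (R ν) := by
    intro μ ν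
    ext h
    change R μ (R ν h) = R ν (R μ h)
    have h1 := hR2 μ _ (hR1 ν h)
    have h2 : R μ h = R ν h + (Complex.I * ν - Complex.I * μ) • R μ (R ν h) := by
      have h3 : h = (h - (Complex.I * ν) • R ν h + (Complex.I * μ) • R ν h) +
        (Complex.I * ν - Complex.I * μ) • R ν h := by rw [sub_smul]; abel
      conv_lhs => rw [h3]
      rw [map_add, map_smul, h1]
    have h4 := hR2 ν _ (hR1 μ (R ν h))
    dsimp only at h4
    rw [← h4, h2]
    congr 1
    rw [sub_smul]
    abel
  let P : ℕ → {μ : ℝ // μ ≠ 0 ∧ μ₀ ≤ |μ|} := fun n => ⟨|μ₀| + 1 + n, by positivity, by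
    rw [abs_of_nonneg (by positivity)]; nlinarith [le_abs_self μ₀, (n.cast_nonneg : (0:ℝ) ≤ n)]⟩
  let M : ℕ → {μ : ℝ // μ ≠ 0 ∧ μ₀ ≤ |μ|} := fun n =>
    ⟨-(P n).1, neg_ne_zero.mpr (P n).2.1, by rw [abs_neg]; exact (P n).2.2⟩
  have hadj : ∀ n g h, ⟪R (P n) g, h⟫ = ⟪g, R (M n) h⟫ := by
    intro n g h
    have h1 := hs _ (hR1 (P n) g) _ (hR1 (M n) h)
    dsimp only at h1
    rw [inner_sub_left, inner_sub_right, inner_smul_left, inner_smul_right] at h1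
    have : (Complex.I * ((M n : ℝ) : ℂ)) = -(Complex.I * ((P n : ℝ) : ℂ)) := by
      simp [M]
    rw [this] at h1
    simp only [map_mul, Complex.conj_I, Complex.conj_ofReal] at h1
    linear_combination -h1
  have hPpos : ∀ n, 0 < (P n).1 := fun n => by simp only [P]; positivity
  have hKn : ∀ n h, ‖(P n).1 • R (P n) h‖ ≤ ‖h‖ ∧ ‖(P n).1 • R (M n) h‖ ≤ ‖h‖ := by
    intro n h
    have h0 := hPpos n
    constructor
    · rw [norm_smul, Real.norm_of_nonneg h0.le]
      have := hR3 (P n) h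
      rw [abs_of_pos h0, inv_mul_eq_div, le_div_iff₀ h0] at this
      linarith
    · rw [norm_smul, Real.norm_of_nonneg h0.le]
      have := hR3 (M n) h
      change _ ≤ |-(P n).1|⁻¹ * _ at this
      rw [abs_neg, abs_of_pos h0, inv_mul_eq_div, le_div_iff₀ h0] at this
      linarith
  -- With `R μ = (A + iμ)⁻¹` and `μ = P n`, this is `μ²/(A² + μ²)`: a contraction that tends
  -- strongly to the identity.
  let B : ℕ → E →L[ℂ] E := fun n =>
    (Complex.I / 2) • ((P n).1 • R (P n) - (P n).1 • R (M n))
  have hBn : ∀ n h, ‖B n h‖ ≤ ‖h‖ := by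
    intro n h
    simp only [B, smul_apply, sub_apply]
    rw [norm_smul]
    have := norm_sub_le ((P n).1 • R (P n) h) ((P n).1 • R (M n) h)
    have h1 := hKn n h
    have : ‖Complex.I / 2‖ = 1 / 2 := by simp
    rw [this]
    linarith
  have hRP : ∀ n, ∀ p ∈ Γ, R (P n) p.2 = p.1 - (Complex.I * (P n).1) • R (P n) p.1 := by
    intro n p hp
    have := hR2 (P n) p hp
    rw [map_add, map_smul] at this
    rw [eq_sub_iff_add_eq, this]
  have hRM : ∀ n, ∀ p ∈ Γ, R (M n) p.2 = p.1 + (Complex.I * (P n).1) • R (M n) p.1 := by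
    intro n p hp
    have := hR2 (M n) p hp
    rw [map_add, map_smul] at this
    have h2 : (Complex.I * ((M n : ℝ) : ℂ)) = -(Complex.I * ((P n : ℝ) : ℂ)) := by
      simp [M]
    rw [h2] at this
    conv_rhs => lhs; rw [← this]
    rw [neg_smul]
    abel
  have hB : ∀ h, Tendsto (fun n => B n h) atTop (𝓝 h) := by
    have hdom : ∀ p ∈ Γ, ∀ n, ‖B n p.1 - p.1‖ ≤ (P n).1⁻¹ * ‖p.2‖ := by
      intro p hp n
      have e : B n p.1 - p.1 = -((1 / 2 : ℂ) • (R (P n) p.2 + R (M n) p.2)) := by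
        rw [hRP n p hp, hRM n p hp]
        simp only [B, smul_apply, sub_apply]
        rw [← Complex.coe_smul, ← Complex.coe_smul]
        module
      rw [e, norm_neg, norm_smul]
      have h0 := hPpos n
      have h1 := hR3 (P n) p.2
      have h2 := hR3 (M n) p.2
      change _ ≤ |-(P n).1|⁻¹ * _ at h2
      rw [abs_neg, abs_of_pos h0] at h2
      rw [abs_of_pos h0] at h1
      have := norm_add_le (R (P n) p.2) (R (M n) p.2)
      norm_num
      linarith
    intro h
    rw [Metric.tendsto_atTop]
    intro ε hε
    obtain ⟨u, hu, v, huv⟩ := Metric.dense_iff.mp hd h (ε / 3) (by positivity)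
    rw [Metric.mem_ball, dist_eq_norm] at hu
    have hP : Tendsto (fun n => (P n).1⁻¹ * ‖v‖) atTop (𝓝 0) := by
      have h1 : Tendsto (fun n => (P n).1) atTop atTop :=
        tendsto_atTop_add_const_left _ _ tendsto_natCast_atTop_atTop
      simpa using (tendsto_inv_atTop_zero.comp h1).mul_const ‖v‖
    obtain ⟨n₀, hn₀⟩ := (hP.eventually (gt_mem_nhds (show 0 < ε / 3 by positivity))).exists_forall_of_atTop
    refine ⟨n₀, fun n hn => ?_⟩
    have h1 := hn₀ n hn
    have h2 := hdom _ huv n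
    have h3 := hBn n (h - u)
    rw [dist_eq_norm]
    have e : B n h - h = B n (h - u) + (B n u - u) + (u - h) := by rw [map_sub]; abel
    rw [e]
    have h4 := norm_add₃_le (a := B n (h - u)) (b := B n u - u) (c := u - h)
    rw [norm_sub_rev h u] at h3
    dsimp only at h2
    linarith
  -- This operator is `μ² A/(A² + μ²)`, which equals `B n` applied after `A` on the domain; both the
  -- bound and the convergence are read off from `B n`.
  refine ⟨fun n => ((P n).1 ^ 2 / 2 : ℝ) • (R (P n) + R (M n)), fun n => ?_, fun m n => ?_, ?_⟩
  · refine IsSelfAdjoint.smul (IsSelfAdjoint.all _) ?_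
    rw [ContinuousLinearMap.isSelfAdjoint_iff_isSymmetric]
    intro g h
    have h1 := hadj n g h
    have h2 : ⟪R (M n) g, h⟫ = ⟪g, R (P n) h⟫ := by
      rw [← inner_conj_symm, ← hadj, inner_conj_symm]
    simp only [ContinuousLinearMap.coe_coe, add_apply, inner_add_left,
      inner_add_right, h1, h2]
    ring
  · refine Commute.smul_left (Commute.smul_right ?_ _) _
    exact ((hcomm _ _).add_right (hcomm _ _)).add_left ((hcomm _ _).add_right (hcomm _ _))
  · intro p hp
    have e : ∀ n, ((((P n).1 ^ 2 / 2 : ℝ) • (R (P n) + R (M n))) p.1) = B n p.2 := by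
      intro n
      simp only [B, smul_apply, sub_apply,
        add_apply, hRP n p hp, hRM n p hp]
      rw [← Complex.coe_smul, ← Complex.coe_smul, ← Complex.coe_smul]
      push_cast
      match_scalars <;> ring_nf <;> simp [Complex.I_sq] <;> ring
    simp only [e]
    exact ⟨fun n => hBn n p.2, hB p.2⟩

end Stone

/-! ### Stone's theorem by exponentials of bounded operators -/

section Stone

variable {E : Type*} [NormedAddCommGroup E] [InnerProductSpace ℂ E] [CompleteSpace E]

local notation "⟪" x ", " y "⟫" => inner ℂ x y

/-- The unitary group of a bounded self-adjoint operator. -/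
def boundedGroup (A : E →L[ℂ] E) (t : ℝ) : E →L[ℂ] E := NormedSpace.exp (t • (Complex.I • A))

theorem boundedGroup_zero (A : E →L[ℂ] E) : boundedGroup A 0 = 1 := by
  simp [boundedGroup]

theorem boundedGroup_add (A : E →L[ℂ] E) (s t : ℝ) :
    boundedGroup A (s + t) = boundedGroup A s * boundedGroup A t := by
  let +nondep : NormedAlgebra ℚ (E →L[ℂ] E) := .restrictScalars ℚ ℂ (E →L[ℂ] E)
  rw [boundedGroup, add_smul, NormedSpace.exp_add_of_commute]
  · rfl
  · exact ((Commute.refl _).smul_left _).smul_right _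

theorem boundedGroup_norm {A : E →L[ℂ] E} (hA : IsSelfAdjoint A) (t : ℝ) (f : E) :
    ‖boundedGroup A t f‖ = ‖f‖ := by
  have h1 : star (boundedGroup A t) = boundedGroup A (-t) := by
    rw [boundedGroup, boundedGroup, NormedSpace.star_exp, star_smul, star_smul, hA.star_eq]
    simp
  have h2 : star (boundedGroup A t) * boundedGroup A t = 1 := by
    rw [h1, ← boundedGroup_add, neg_add_cancel, boundedGroup_zero]
  have h3 : ⟪boundedGroup A t f, boundedGroup A t f⟫ = ⟪f, f⟫ := by
    rw [← ContinuousLinearMap.adjoint_inner_right, ← ContinuousLinearMap.star_eq_adjoint,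
      ← mul_apply_eq_comp, h2, one_apply_eq_self]
  rw [inner_self_eq_norm_sq_to_K, inner_self_eq_norm_sq_to_K] at h3
  have h4 : ‖boundedGroup A t f‖ ^ 2 = ‖f‖ ^ 2 := by exact_mod_cast h3
  exact (sq_eq_sq₀ (norm_nonneg _) (norm_nonneg _)).mp h4

theorem boundedGroup_hasDerivAt (A : E →L[ℂ] E) (t : ℝ) :
    HasDerivAt (boundedGroup A) (boundedGroup A t * (Complex.I • A)) t :=
  hasDerivAt_exp_smul_const (𝕂 := ℝ) (Complex.I • A) t

theorem boundedGroup_commute {A B : E →L[ℂ] E} (h : Commute A B) (s : ℝ) :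
    Commute (boundedGroup A s) B := by
  refine Commute.exp_left ?_
  exact (h.smul_left _).smul_left _

theorem boundedGroup_hasDerivAt_apply (A : E →L[ℂ] E) (f : E) (t : ℝ) :
    HasDerivAt (fun s => boundedGroup A s f) (boundedGroup A t (Complex.I • A f)) t := by
  exact (boundedGroup_hasDerivAt A t).apply_const f

/-- Duhamel: differentiate `e^{-iBs} e^{iAs} f`. Since `A` and `B` commute, `A - B` falls directly
on `f`, so only `‖A f - B f‖` enters and strong convergence of the generators suffices. -/
theorem boundedGroup_sub_le {A B : E →L[ℂ] E} (hA : IsSelfAdjoint A) (hB : IsSelfAdjoint B)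
    (h : Commute A B) (t : ℝ) (f : E) :
    ‖boundedGroup A t f - boundedGroup B t f‖ ≤ ‖A f - B f‖ * |t| := by
  have hd : ∀ s, HasDerivAt (fun s => (boundedGroup B (-s) * boundedGroup A s) f)
      (boundedGroup B (-s) (boundedGroup A s (Complex.I • (A f - B f)))) s := by
    intro s
    have h1 := (boundedGroup_hasDerivAt B (-s)).scomp s (hasDerivAt_neg s)
    have h2 := (h1.mul (boundedGroup_hasDerivAt A s)).apply_const f
    convert! h2 using 1
    have h3 : B (boundedGroup A s f) = boundedGroup A s (B f) := by
      have := boundedGroup_commute h s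
      exact (congrArg (fun T : E →L[ℂ] E => T f) this.eq).symm
    simp [h3]
    try module
  have := norm_sub_le_of_hasDerivAt (t := t) (C := ‖A f - B f‖) hd fun s _ => by
    rw [boundedGroup_norm hB, boundedGroup_norm hA, norm_smul]; simp
  rw [neg_zero, boundedGroup_zero, boundedGroup_zero] at this
  have e : boundedGroup A t f - boundedGroup B t f =
      boundedGroup B t ((boundedGroup B (-t) * boundedGroup A t) f - (1 * 1 : E →L[ℂ] E) f) := by
    rw [map_sub, ← mul_apply_eq_comp, ← mul_assoc, ← boundedGroup_add, add_neg_cancel,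
      boundedGroup_zero]
    simp
  rw [e, boundedGroup_norm hB]
  exact this

theorem boundedGroup_sub_self_le {A : E →L[ℂ] E} (hA : IsSelfAdjoint A) (t : ℝ) (f : E) :
    ‖boundedGroup A t f - f‖ ≤ ‖A f‖ * |t| := by
  have := norm_sub_le_of_hasDerivAt (t := t) (C := ‖A f‖) (boundedGroup_hasDerivAt_apply A f)
    fun s _ => by rw [boundedGroup_norm hA, norm_smul]; simp
  simpa [boundedGroup_zero] using this

theorem boundedGroup_taylor {A : E →L[ℂ] E} (t : ℝ) (f : E) {C : ℝ}
    (hC : ∀ s, |s| ≤ |t| → ‖boundedGroup A s (A f) - A f‖ ≤ C) :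
    ‖boundedGroup A t f - f - t • (Complex.I • A f)‖ ≤ C * |t| := by
  have hd : ∀ s, HasDerivAt (fun s => boundedGroup A s f - s • (Complex.I • A f))
      (boundedGroup A s (Complex.I • A f) - (1 : ℝ) • (Complex.I • A f)) s := fun s =>
    (boundedGroup_hasDerivAt_apply A f s).sub ((hasDerivAt_id s).smul_const _)
  have := norm_sub_le_of_hasDerivAt (t := t) (C := C) hd fun s hs => by
    rw [one_smul, map_smul, ← smul_sub, norm_smul, Complex.norm_I, one_mul]
    exact hC s hs
  simp only [boundedGroup_zero, zero_smul, sub_zero] at this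
  rwa [sub_right_comm] at this

/-- **Stone's theorem**: a densely defined symmetric relation with full range of `Γ + iμ`, for all
large `|μ|`, generates a unitary group. -/
theorem IsSymmetricGraph.exists_unitaryGroup {Γ : Submodule ℂ (E × E)} (hs : IsSymmetricGraph Γ)
    (hd : Dense {u : E | ∃ v, (u, v) ∈ Γ}) {μ₀ : ℝ} (hr : ∀ μ : ℝ, μ₀ ≤ |μ| → HasFullRange Γ μ) :
    ∃ U : ℝ → E →L[ℂ] E, IsUnitaryGroupOfGraph Γ U := by
  obtain ⟨A, hsa, hcomm, hA⟩ := hs.exists_approximants hd hr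
  have happrox : ∀ (f : E) (η : ℝ), 0 < η → ∃ p ∈ Γ, ‖f - p.1‖ < η := by
    intro f η hη
    obtain ⟨u, hu, v, huv⟩ := Metric.dense_iff.mp hd f η hη
    exact ⟨(u, v), huv, by rwa [norm_sub_rev, ← dist_eq_norm]⟩
  have hcauchy : ∀ t f, CauchySeq fun n => boundedGroup (A n) t f := by
    intro t f
    rw [Metric.cauchySeq_iff']
    intro ε hε
    obtain ⟨p, hp, hpf⟩ := happrox f (ε / 3) (by positivity)
    have hc := (hA p hp).2.cauchySeq
    rw [Metric.cauchySeq_iff'] at hc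
    obtain ⟨n₀, hn₀⟩ := hc (ε / (3 * (|t| + 1))) (by positivity)
    refine ⟨n₀, fun n hn => ?_⟩
    have h1 := hn₀ n hn
    rw [dist_eq_norm] at h1 ⊢
    -- On the domain the generators converge; the isometry property carries the Cauchy property to
    -- all of `E` by density.
    have h2 := boundedGroup_sub_le (hsa n) (hsa n₀) (hcomm n n₀) t p.1
    have h3 : ‖A n p.1 - A n₀ p.1‖ * |t| ≤ ε / 3 := by
      have : ε / (3 * (|t| + 1)) * |t| ≤ ε / 3 := by
        rw [div_mul_eq_mul_div, div_le_div_iff₀ (by positivity) (by positivity)]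
        nlinarith [abs_nonneg t]
      exact (mul_le_mul_of_nonneg_right h1.le (abs_nonneg t)).trans this
    have e : boundedGroup (A n) t f - boundedGroup (A n₀) t f =
        boundedGroup (A n) t (f - p.1) + (boundedGroup (A n) t p.1 - boundedGroup (A n₀) t p.1)
          + -(boundedGroup (A n₀) t (f - p.1)) := by
      rw [map_sub, map_sub]; abel
    rw [e]
    refine (norm_add₃_le).trans_lt ?_
    rw [norm_neg, boundedGroup_norm (hsa n), boundedGroup_norm (hsa n₀)]
    linarith
  choose L hL using fun t f => cauchySeq_tendsto_of_complete (hcauchy t f)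
  let U : ℝ → E →L[ℂ] E := fun t =>
    { toFun := L t
      map_add' := fun x y => tendsto_nhds_unique (hL t (x + y))
        (by simpa only [map_add] using (hL t x).add (hL t y))
      map_smul' := fun c x => tendsto_nhds_unique (hL t (c • x))
        (by simpa only [map_smul, RingHom.id_apply] using (hL t x).const_smul c)
      cont := by
        refine AddMonoidHomClass.continuous_of_bound (AddMonoidHom.mk' (L t) fun x y =>
          tendsto_nhds_unique (hL t (x + y))
            (by simpa only [map_add] using (hL t x).add (hL t y))) 1 fun x => ?_
        rw [one_mul]
        refine le_of_tendsto (hL t x).norm (Eventually.of_forall fun n => ?_)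
        rw [boundedGroup_norm (hsa n)] }
  have hU : ∀ t f, Tendsto (fun n => boundedGroup (A n) t f) atTop (𝓝 (U t f)) := hL
  have hiso : ∀ t f, ‖U t f‖ = ‖f‖ := fun t f =>
    tendsto_nhds_unique (hU t f).norm (by simp only [boundedGroup_norm (hsa _)]; exact tendsto_const_nhds)
  have hzero : U 0 = 1 := by
    ext f
    refine tendsto_nhds_unique (hU 0 f) ?_
    simp only [boundedGroup_zero]
    exact tendsto_const_nhds
  have hadd : ∀ s t, U (s + t) = U s * U t := by
    intro s t
    ext f
    refine tendsto_nhds_unique (hU (s + t) f) ?_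
    have h1 : Tendsto (fun n => boundedGroup (A n) s (boundedGroup (A n) t f - U t f)) atTop
        (𝓝 0) := by
      rw [tendsto_zero_iff_norm_tendsto_zero]
      simp only [boundedGroup_norm (hsa _)]
      rw [← tendsto_zero_iff_norm_tendsto_zero]
      exact tendsto_sub_nhds_zero_iff.mpr (hU t f)
    have h2 := h1.add (hU s (U t f))
    rw [zero_add] at h2
    refine h2.congr fun n => ?_
    rw [map_sub, sub_add_cancel, boundedGroup_add]
    rfl
  have hlip : ∀ p ∈ Γ, ∀ t, ‖U t p.1 - p.1‖ ≤ ‖p.2‖ * |t| := by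
    intro p hp t
    refine le_of_tendsto ((hU t p.1).sub_const p.1).norm (Eventually.of_forall fun n => ?_)
    exact (boundedGroup_sub_self_le (hsa n) t p.1).trans
      (mul_le_mul_of_nonneg_right ((hA p hp).1 n) (abs_nonneg t))
  have hcont0 : ∀ f, Tendsto (fun t => U t f) (𝓝 0) (𝓝 f) := by
    intro f
    rw [Metric.tendsto_nhds_nhds]
    intro ε hε
    obtain ⟨p, hp, hpf⟩ := happrox f (ε / 3) (by positivity)
    refine ⟨ε / (3 * (‖p.2‖ + 1)), by positivity, fun t ht => ?_⟩
    rw [Real.dist_eq, sub_zero] at ht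
    rw [dist_eq_norm]
    have h1 : ‖p.2‖ * |t| ≤ ε / 3 := by
      have : ‖p.2‖ * (ε / (3 * (‖p.2‖ + 1))) ≤ ε / 3 := by
        rw [mul_div_assoc', div_le_div_iff₀ (by positivity) (by positivity)]
        nlinarith [norm_nonneg p.2]
      exact (mul_le_mul_of_nonneg_left ht.le (norm_nonneg _)).trans this
    have e : U t f - f = U t (f - p.1) + (U t p.1 - p.1) + (p.1 - f) := by rw [map_sub]; abel
    rw [e]
    refine (norm_add₃_le).trans_lt ?_
    rw [hiso, norm_sub_rev p.1 f]
    have := hlip p hp t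
    linarith
  have hderiv : ∀ p ∈ Γ, HasDerivAt (fun t => U t p.1) (Complex.I • p.2) 0 := by
    intro p hp
    rw [hasDerivAt_iff_isLittleO_nhds_zero, Asymptotics.isLittleO_iff]
    intro c hc
    -- The Taylor remainder involves `U s p.2 - p.2`, and `p.2` need not lie in the domain; it is
    -- replaced by a nearby domain vector `q.1`, for which a Lipschitz bound holds.
    obtain ⟨q, hq, hqf⟩ := happrox p.2 (c / 4) (by positivity)
    have hball : ∀ᶠ t : ℝ in 𝓝 0, |t| < c / (2 * (‖q.2‖ + 1)) := by
      have := Metric.ball_mem_nhds (0 : ℝ) (show 0 < c / (2 * (‖q.2‖ + 1)) by positivity)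
      filter_upwards [this] with t ht
      simpa using ht
    filter_upwards [hball] with t ht
    rw [zero_add, hzero, one_apply_eq_self]
    have hlim : Tendsto (fun n => ‖boundedGroup (A n) t p.1 - p.1 - t • (Complex.I • A n p.1)‖)
        atTop (𝓝 ‖U t p.1 - p.1 - t • (Complex.I • p.2)‖) :=
      (((hU t p.1).sub_const p.1).sub (((hA p hp).2.const_smul Complex.I).const_smul t)).norm
    have hlim2 : Tendsto (fun n => (2 * ‖A n p.1 - p.2‖ + 2 * (c / 4) + ‖q.2‖ * |t|) * |t|)
        atTop (𝓝 ((2 * 0 + 2 * (c / 4) + ‖q.2‖ * |t|) * |t|)) := by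
      have := tendsto_zero_iff_norm_tendsto_zero.mp (tendsto_sub_nhds_zero_iff.mpr (hA p hp).2)
      exact (((this.const_mul 2).add_const _).add_const _).mul_const _
    have hle : ‖U t p.1 - p.1 - t • (Complex.I • p.2)‖ ≤
        (2 * 0 + 2 * (c / 4) + ‖q.2‖ * |t|) * |t| := by
      refine le_of_tendsto_of_tendsto' hlim hlim2 fun n => ?_
      refine boundedGroup_taylor t p.1 fun s hs => ?_
      have e : boundedGroup (A n) s (A n p.1) - A n p.1 =
          boundedGroup (A n) s ((A n p.1 - p.2) + (p.2 - q.1)) +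
            (boundedGroup (A n) s q.1 - q.1) + -((A n p.1 - p.2) + (p.2 - q.1)) := by
        simp only [map_add, map_sub]; abel
      rw [e]
      refine (norm_add₃_le).trans ?_
      rw [norm_neg, boundedGroup_norm (hsa n)]
      have h1 := norm_add_le (A n p.1 - p.2) (p.2 - q.1)
      have h2 := boundedGroup_sub_self_le (hsa n) s q.1
      have h3 : ‖A n q.1‖ * |s| ≤ ‖q.2‖ * |t| :=
        mul_le_mul ((hA q hq).1 n) hs (abs_nonneg _) (norm_nonneg _)
      linarith
    refine hle.trans ?_
    rw [Real.norm_eq_abs]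
    refine mul_le_mul_of_nonneg_right ?_ (abs_nonneg t)
    have : ‖q.2‖ * (c / (2 * (‖q.2‖ + 1))) ≤ c / 2 := by
      rw [mul_div_assoc', div_le_div_iff₀ (by positivity) (by positivity)]
      nlinarith [norm_nonneg q.2]
    have := mul_le_mul_of_nonneg_left ht.le (norm_nonneg q.2)
    linarith
  refine ⟨U, hzero, hadd, hiso, fun f => ?_, fun ψ φ => ⟨fun h => hderiv _ h, fun h => ?_⟩⟩
  · rw [continuous_iff_continuousAt]
    intro t
    have h1 : Tendsto (fun s => U (s - t) (U t f)) (𝓝 t) (𝓝 (U t f)) :=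
      (hcont0 (U t f)).comp (by simpa using (continuous_sub_right t).tendsto t)
    refine h1.congr fun s => ?_
    rw [← mul_apply_eq_comp, ← hadd, sub_add_cancel]
  · have hadj : ∀ t f g, ⟪U t f, g⟫ = ⟪f, U (-t) g⟫ := by
      intro t f g
      have h1 : g = U t (U (-t) g) := by
        rw [← mul_apply_eq_comp, ← hadd, add_neg_cancel, hzero]; rfl
      conv_lhs => rw [h1]
      exact (LinearMap.norm_map_iff_inner_map_map (U t)).mp (hiso t) f (U (-t) g)
    -- Differentiating `⟪U t p.1, ψ⟫ = ⟪p.1, U (-t) ψ⟫` at `0` on both sides gives the adjoint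
    -- relation for `(ψ, φ)`, so the generator has no larger domain than `Γ`.
    refine hs.mem_of_adjoint (μ := |μ₀|) (hr _ (by rw [abs_abs]; exact le_abs_self _))
      (hr _ (by rw [abs_neg, abs_abs]; exact le_abs_self _)) fun p hp => ?_
    have h1 : HasDerivAt (fun t => ⟪U t p.1, ψ⟫) (⟪p.1, -(Complex.I • φ)⟫) 0 := by
      simp only [hadj]
      have h2 : HasDerivAt (fun t => U (-t) ψ) (-(Complex.I • φ)) 0 := by
        have h' : HasDerivAt (fun t => U t ψ) (Complex.I • φ) (-0) := by rwa [neg_zero]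
        have := h'.scomp (0 : ℝ) (hasDerivAt_neg (0 : ℝ))
        rwa [neg_one_smul] at this
      simpa using (hasDerivAt_const (0 : ℝ) p.1).inner ℂ h2
    have h3 : HasDerivAt (fun t => ⟪U t p.1, ψ⟫) (⟪Complex.I • p.2, ψ⟫) 0 := by
      simpa only [inner_zero_right, zero_add] using (hderiv p hp).inner ℂ (hasDerivAt_const (0 : ℝ) ψ)
    have h4 := h1.unique h3
    rw [inner_neg_right, inner_smul_right, inner_smul_left, Complex.conj_I] at h4
    have := mul_left_cancel₀ (neg_ne_zero.mpr Complex.I_ne_zero) (show -Complex.I * ⟪p.2, ψ⟫ =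
      -Complex.I * ⟪p.1, φ⟫ by rw [← h4]; ring)
    exact this

end Stone

/-! ### Essential self-adjointness of first order operators in matrix form -/

section Deficiency

variable {E : Type*} [NormedAddCommGroup E] [InnerProductSpace ℂ E]

local notation "⟪" x ", " y "⟫" => inner ℂ x y

theorem IsSymmetricGraph.topologicalClosure {Γ : Submodule ℂ (E × E)} (hs : IsSymmetricGraph Γ) :
    IsSymmetricGraph Γ.topologicalClosure := by
  have h1 : ∀ p ∈ Γ, ∀ q ∈ Γ.topologicalClosure, ⟪p.2, q.1⟫ = ⟪p.1, q.2⟫ := by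
    intro p hp q hq
    have hc : IsClosed {q : E × E | ⟪p.2, q.1⟫ = ⟪p.1, q.2⟫} :=
      isClosed_eq (by fun_prop) (by fun_prop)
    exact closure_minimal (fun q hq => hs p hp q hq) hc hq
  intro p hp q hq
  have hc : IsClosed {p : E × E | ⟪p.2, q.1⟫ = ⟪p.1, q.2⟫} :=
    isClosed_eq (by fun_prop) (by fun_prop)
  exact closure_minimal (fun p hp => h1 p hp q hq) hc hp

theorem isSymmetricGraph_span {ι : Type*} {e s : ι → E} (h : ∀ i j, ⟪s i, e j⟫ = ⟪e i, s j⟫) :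
    IsSymmetricGraph (Submodule.span ℂ (Set.range fun i => (e i, s i))) := by
  intro p hp q hq
  induction hp using Submodule.span_induction with
  | mem p hp =>
    obtain ⟨i, rfl⟩ := hp
    induction hq using Submodule.span_induction with
    | mem q hq => obtain ⟨j, rfl⟩ := hq; exact h i j
    | zero => simp
    | add x y _ _ hx hy => simp only [Prod.fst_add, Prod.snd_add, inner_add_right, hx, hy]
    | smul c x _ hx => simp only [Prod.smul_fst, Prod.smul_snd, inner_smul_right, hx]
  | zero => simp
  | add x y _ _ hx hy => simp only [Prod.fst_add, Prod.snd_add, inner_add_left, hx, hy]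
  | smul c x _ hx => simp only [Prod.smul_fst, Prod.smul_snd, inner_smul_left, hx]

/-- On the complete space `Γ` the map `p ↦ p.2 + iμ p.1` is bounded below, so its range is closed; a
closed subspace with trivial orthogonal complement is everything. -/
theorem IsSymmetricGraph.hasFullRange [CompleteSpace E] {Γ : Submodule ℂ (E × E)}
    (hs : IsSymmetricGraph Γ) (hc : IsClosed (Γ : Set (E × E))) {μ : ℝ} (hμ : μ ≠ 0)
    (h : ∀ w, (∀ p ∈ Γ, ⟪p.2 + (Complex.I * μ) • p.1, w⟫ = 0) → w = 0) : HasFullRange Γ μ := by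
  let T : Γ →L[ℂ] E :=
    (ContinuousLinearMap.snd ℂ E E + (Complex.I * μ) • ContinuousLinearMap.fst ℂ E E).comp Γ.subtypeL
  have hT : ∀ p : Γ, T p = p.1.2 + (Complex.I * μ) • p.1.1 := fun p => rfl
  have : CompleteSpace Γ := hc.completeSpace_coe
  have hμ' : 0 < |μ| := abs_pos.mpr hμ
  have hanti : AntilipschitzWith ⟨max 1 |μ|⁻¹, by positivity⟩ T := by
    refine T.antilipschitz_of_bound fun p => ?_
    change ‖p.1‖ ≤ max 1 |μ|⁻¹ * ‖T p‖
    rw [hT, Prod.norm_def, max_le_iff]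
    have h1 := hs.norm_fst_le p.2 μ
    have h2 : ‖p.1.2‖ ≤ ‖p.1.2 + (Complex.I * μ) • p.1.1‖ := by
      refine abs_le_of_sq_le_sq' ?_ (norm_nonneg _) |>.2
      rw [hs.norm_sq_add p.2]
      nlinarith [mul_nonneg (sq_nonneg μ) (sq_nonneg ‖p.1.1‖)]
    constructor
    · calc ‖p.1.1‖ = |μ|⁻¹ * (|μ| * ‖p.1.1‖) := by field_simp
        _ ≤ max 1 |μ|⁻¹ * _ := mul_le_mul (le_max_right _ _) h1 (by positivity) (by positivity)
    · calc ‖p.1.2‖ = 1 * ‖p.1.2‖ := by ring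
        _ ≤ max 1 |μ|⁻¹ * _ := mul_le_mul (le_max_left _ _) h2 (by positivity) (by positivity)
  have hcl : IsClosed (T.range : Set E) := by
    have := hanti.isClosed_range T.uniformContinuous
    exact this
  have : CompleteSpace T.range := hcl.completeSpace_coe
  have htop : T.range = ⊤ := by
    rw [← Submodule.orthogonal_eq_bot_iff, Submodule.eq_bot_iff]
    intro w hw
    refine h w fun p hp => ?_
    exact (Submodule.mem_orthogonal _ _).mp hw (T ⟨p, hp⟩) ⟨⟨p, hp⟩, rfl⟩
  intro w
  obtain ⟨p, hp⟩ : w ∈ T.range := htop ▸ Submodule.mem_top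
  exact ⟨p.1, p.2, hp⟩

/-- Young's inequality for a convolution kernel: bound `‖x n‖ ‖x k‖` by half the sum of the squares
and sum each square along the difference `n - k`. -/
theorem summable_convolution_form {c : ℤ → ℝ} (hc : Summable c) (hc0 : ∀ d, 0 ≤ c d) {x : ℤ → ℂ}
    (hx : Summable fun n => ‖x n‖ ^ 2) :
    Summable (fun p : ℤ × ℤ => c (p.1 - p.2) * (‖x p.1‖ * ‖x p.2‖)) ∧
      ∑' p : ℤ × ℤ, c (p.1 - p.2) * (‖x p.1‖ * ‖x p.2‖) ≤ (∑' d, c d) * ∑' n, ‖x n‖ ^ 2 := by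
  let e₁ : ℤ × ℤ ≃ ℤ × ℤ :=
    ⟨fun p => (p.1 - p.2, p.1), fun p => (p.2, p.2 - p.1), fun p => by simp, fun p => by simp⟩
  let e₂ : ℤ × ℤ ≃ ℤ × ℤ :=
    ⟨fun p => (p.1 - p.2, p.2), fun p => (p.1 + p.2, p.2), fun p => by simp, fun p => by simp⟩
  have hm := hc.mul_of_nonneg hx hc0 fun n => sq_nonneg ‖x n‖
  have hv : ∑' p : ℤ × ℤ, c p.1 * ‖x p.2‖ ^ 2 = (∑' d, c d) * ∑' n, ‖x n‖ ^ 2 :=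
    (hc.tsum_mul_tsum hx hm).symm
  have h1 : HasSum (fun p : ℤ × ℤ => c (p.1 - p.2) * ‖x p.1‖ ^ 2)
      ((∑' d, c d) * ∑' n, ‖x n‖ ^ 2) := hv ▸ (e₁.hasSum_iff.mpr hm.hasSum)
  have h2 : HasSum (fun p : ℤ × ℤ => c (p.1 - p.2) * ‖x p.2‖ ^ 2)
      ((∑' d, c d) * ∑' n, ‖x n‖ ^ 2) := hv ▸ (e₂.hasSum_iff.mpr hm.hasSum)
  have h3 := (h1.add h2).mul_left (1 / 2)
  have hle : ∀ p : ℤ × ℤ, c (p.1 - p.2) * (‖x p.1‖ * ‖x p.2‖) ≤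
      1 / 2 * (c (p.1 - p.2) * ‖x p.1‖ ^ 2 + c (p.1 - p.2) * ‖x p.2‖ ^ 2) := by
    intro p
    nlinarith [mul_nonneg (hc0 (p.1 - p.2)) (sq_nonneg (‖x p.1‖ - ‖x p.2‖))]
  have hs : Summable (fun p : ℤ × ℤ => c (p.1 - p.2) * (‖x p.1‖ * ‖x p.2‖)) :=
    Summable.of_nonneg_of_le (fun p => mul_nonneg (hc0 _) (by positivity)) hle h3.summable
  refine ⟨hs, (hs.tsum_le_tsum hle h3.summable).trans ?_⟩
  rw [h3.tsum_eq]
  linarith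

/-- The tent function of width `M`. -/
def tent (M : ℝ) (n : ℤ) : ℝ := max 0 (1 - |(n : ℝ)| / M)

theorem tent_nonneg (M : ℝ) (n : ℤ) : 0 ≤ tent M n := le_max_left _ _

theorem tent_le_one {M : ℝ} (hM : 0 < M) (n : ℤ) : tent M n ≤ 1 :=
  max_le zero_le_one (by have : 0 ≤ |(n : ℝ)| / M := by positivity
                         linarith)

theorem tent_eq_zero {M : ℝ} (hM : 0 < M) {n : ℤ} (h : M ≤ |(n : ℝ)|) : tent M n = 0 := by
  rw [tent, max_eq_left]
  have := (one_le_div hM).mpr h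
  linarith

theorem abs_tent_sub_le {M : ℝ} (hM : 0 < M) (n k : ℤ) :
    |tent M n - tent M k| ≤ |((n - k : ℤ) : ℝ)| / M := by
  refine (abs_max_sub_max_le_max _ _ _ _).trans (max_le (by simp; positivity) ?_)
  have : 1 - |(n : ℝ)| / M - (1 - |(k : ℝ)| / M) = (|(k : ℝ)| - |(n : ℝ)|) / M := by ring
  rw [this, abs_div, abs_of_pos hM]
  refine div_le_div_of_nonneg_right ?_ hM.le
  refine (abs_abs_sub_abs_le (k : ℝ) (n : ℝ)).trans ?_
  rw [abs_sub_comm]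
  push_cast
  exact le_rfl

/-- The commutator of the cut-off with a first order weight is bounded uniformly in `M`. If one
index lies inside `|·| < M`, the weight is at most `M + |n-k|/2` and the Lipschitz constant `1/M`
compensates it; otherwise both tents vanish. -/
theorem abs_tent_sub_mul_le {M : ℝ} (hM : 1 ≤ M) (n k : ℤ) :
    |tent M n - tent M k| * (|(n : ℝ) + k| / 2) ≤ 2 * (1 + ((n - k : ℤ) : ℝ) ^ 2) := by
  have hM0 : 0 < M := by linarith
  by_cases h : M ≤ |(n : ℝ)| ∧ M ≤ |(k : ℝ)|
  · rw [tent_eq_zero hM0 h.1, tent_eq_zero hM0 h.2]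
    simp; positivity
  have h1 := abs_tent_sub_le hM0 n k
  set d : ℝ := |((n - k : ℤ) : ℝ)| with hd
  have hd0 : 0 ≤ d := abs_nonneg _
  have h2 : |(n : ℝ) + k| ≤ 2 * M + d := by
    rw [hd]; push_cast
    rw [not_and_or, not_le, not_le] at h
    rcases h with h | h
    · have : (n : ℝ) + k = 2 * n - (n - k) := by ring
      rw [this]
      refine (abs_sub _ _).trans ?_
      rw [abs_mul, abs_two]; linarith
    · have : (n : ℝ) + k = 2 * k + (n - k) := by ring
      rw [this]
      refine (abs_add_le _ _).trans ?_
      rw [abs_mul, abs_two]; linarith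
  calc |tent M n - tent M k| * (|(n : ℝ) + k| / 2) ≤ d / M * ((2 * M + d) / 2) := by gcongr
    _ = d + d ^ 2 / 2 / M := by field_simp
    _ ≤ d + d ^ 2 / 2 := by
      have := div_le_self (show 0 ≤ d ^ 2 / 2 by positivity) hM
      linarith
    _ ≤ 2 * (1 + d ^ 2) := by nlinarith [sq_nonneg (d - 1)]
    _ = _ := by rw [hd, sq_abs]

/-- A first order difference operator with rapidly decaying symmetric coefficients has no
square summable eigenvector with a large imaginary eigenvalue. -/
theorem eq_zero_of_symmetric_matrix {f : ℤ → ℂ} (hf : ∀ m, f (-m) = (starRingEnd ℂ) (f m))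
    (hsum : Summable fun m : ℤ => (1 + (m : ℝ) ^ 2) * ‖f m‖) {x : ℤ → ℂ}
    (hx : Summable fun n => ‖x n‖ ^ 2) {μ : ℝ}
    (hμ : ∑' m : ℤ, (1 + (m : ℝ) ^ 2) * ‖f m‖ < |μ|)
    (h : ∀ n : ℤ, HasSum (fun k : ℤ => (-((n : ℂ) + k) / 2 * f (n - k)) * x k) (Complex.I * μ * x n)) :
    x = 0 := by
  set C := ∑' m : ℤ, (1 + (m : ℝ) ^ 2) * ‖f m‖ with hC
  let a : ℤ → ℤ → ℂ := fun n k => -((n : ℂ) + k) / 2 * f (n - k)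
  let G : ℤ → ℤ → ℂ := fun n k => (starRingEnd ℂ) (x n) * (a n k * x k)
  have ha : ∀ n k, ‖a n k‖ = |(n : ℝ) + k| / 2 * ‖f (n - k)‖ := by
    intro n k
    have : ‖(n : ℂ) + k‖ = |(n : ℝ) + k| := by
      rw [← Real.norm_eq_abs, ← Complex.norm_real]; push_cast; rfl
    simp only [a, norm_mul, norm_div, norm_neg, this]
    norm_num
  have hG : ∀ n k, ‖G n k‖ = (|(n : ℝ) + k| / 2 * ‖f (n - k)‖) * (‖x n‖ * ‖x k‖) := by
    intro n k
    simp only [G, norm_mul, ha, RCLike.norm_conj]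
    ring
  have hGc : ∀ n k, (starRingEnd ℂ) (G n k) = G k n := by
    intro n k
    have : (starRingEnd ℂ) (f (n - k)) = f (k - n) := by rw [← hf, neg_sub]
    simp only [G, a, map_mul, map_div₀, map_neg, map_add, map_intCast, this, Complex.conj_conj,
      map_ofNat]
    ring
  have hkey : ∀ M : ℕ, 1 ≤ M → ∀ S : Finset ℤ,
      |μ| * ∑ n ∈ S, tent M n * ‖x n‖ ^ 2 ≤ C * ∑' n, ‖x n‖ ^ 2 := by
    intro M hM S
    have hM1 : (1 : ℝ) ≤ M := by exact_mod_cast hM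
    have hM0 : (0 : ℝ) < M := by linarith
    -- Without the cut-off the growing weight `n + k` could spoil absolute summability. With it `|n|
    -- < M`, so `|n + k| ≤ 2M + |n - k|`; the resulting bound depends on `M` but is used only to
    -- rearrange the sum.
    have hH : Summable fun p : ℤ × ℤ => (tent M p.1 : ℂ) * G p.1 p.2 := by
      have hc := hsum.mul_left ((M : ℝ) + 1)
      refine Summable.of_norm_bounded (summable_convolution_form hc (fun d => by positivity) hx).1
        fun p => ?_
      rw [norm_mul, hG, ← mul_assoc]
      refine mul_le_mul_of_nonneg_right ?_ (by positivity)
      rw [← mul_assoc, ← mul_assoc]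
      refine mul_le_mul_of_nonneg_right ?_ (by positivity)
      rw [Complex.norm_real, Real.norm_of_nonneg (tent_nonneg _ _)]
      by_cases hp : (M : ℝ) ≤ |(p.1 : ℝ)|
      · rw [tent_eq_zero hM0 hp, zero_mul]; positivity
      · have h1 : |(p.1 : ℝ) + p.2| ≤ 2 * M + |((p.1 - p.2 : ℤ) : ℝ)| := by
          have : (p.1 : ℝ) + p.2 = 2 * p.1 - ((p.1 - p.2 : ℤ) : ℝ) := by push_cast; ring
          rw [this]
          refine (abs_sub _ _).trans ?_
          rw [abs_mul, abs_two]; linarith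
        refine (mul_le_mul_of_nonneg_right (tent_le_one hM0 _) (by positivity)).trans ?_
        rw [← sq_abs ((p.1 - p.2 : ℤ) : ℝ)]
        nlinarith [sq_nonneg (|((p.1 - p.2 : ℤ) : ℝ)| - 1), abs_nonneg ((p.1 - p.2 : ℤ) : ℝ),
          mul_nonneg hM0.le (sq_nonneg (|((p.1 - p.2 : ℤ) : ℝ)|))]
    have hrow : ∀ n, HasSum (fun k => (tent M n : ℂ) * G n k)
        (Complex.I * μ * ((tent M n * ‖x n‖ ^ 2 : ℝ) : ℂ)) := by
      intro n
      have h1 := ((h n).mul_left ((starRingEnd ℂ) (x n))).mul_left (tent M n : ℂ)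
      refine (congrArg (HasSum _) ?_).mp h1
      have : (starRingEnd ℂ) (x n) * x n = ((‖x n‖ ^ 2 : ℝ) : ℂ) := by
        rw [mul_comm, Complex.mul_conj, Complex.normSq_eq_norm_sq]
      push_cast at this ⊢
      linear_combination (Complex.I * μ * tent M n) * this
    have hX : HasSum (fun n => Complex.I * μ * ((tent M n * ‖x n‖ ^ 2 : ℝ) : ℂ))
        (∑' p : ℤ × ℤ, (tent M p.1 : ℂ) * G p.1 p.2) := hH.hasSum.prod_fiberwise hrow
    have hJ : Summable fun n => tent M n * ‖x n‖ ^ 2 :=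
      Summable.of_nonneg_of_le (fun n => mul_nonneg (tent_nonneg _ _) (sq_nonneg _))
        (fun n => mul_le_of_le_one_left (sq_nonneg _) (tent_le_one hM0 n)) hx
    have hX' : ∑' p : ℤ × ℤ, (tent M p.1 : ℂ) * G p.1 p.2 =
        Complex.I * μ * ((∑' n, tent M n * ‖x n‖ ^ 2 : ℝ) : ℂ) := by
      rw [← hX.tsum_eq, tsum_mul_left, Complex.ofReal_tsum]
    have hconj : HasSum (fun p : ℤ × ℤ => (tent M p.2 : ℂ) * G p.1 p.2)
        ((starRingEnd ℂ) (∑' p : ℤ × ℤ, (tent M p.1 : ℂ) * G p.1 p.2)) := by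
      have h1 := (Complex.hasSum_conj'.mpr hH.hasSum)
      have h2 := (Equiv.prodComm ℤ ℤ).hasSum_iff.mpr h1
      convert! h2 using 2 with p
      simp [hGc]
    have hdiff := hH.hasSum.sub hconj
    -- As `G` is Hermitian, the difference is the sum of `(tent M n - tent M k) G n k`, which is
    -- bounded uniformly in `M`. By the eigenvalue equation it also equals `2iμ ∑ tent M n ‖x n‖²`.
    have hbd : ‖(∑' p : ℤ × ℤ, (tent M p.1 : ℂ) * G p.1 p.2) -
        (starRingEnd ℂ) (∑' p : ℤ × ℤ, (tent M p.1 : ℂ) * G p.1 p.2)‖ ≤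
          (2 * C) * ∑' n, ‖x n‖ ^ 2 := by
      have hc := hsum.mul_left 2
      have h1 := summable_convolution_form hc (fun d => by positivity) hx
      rw [tsum_mul_left] at h1
      rw [← hdiff.tsum_eq]
      refine (tsum_of_norm_bounded h1.1.hasSum fun p => ?_).trans h1.2
      rw [← sub_mul, norm_mul, hG, ← mul_assoc]
      refine mul_le_mul_of_nonneg_right ?_ (by positivity)
      rw [← mul_assoc, ← mul_assoc]
      refine mul_le_mul_of_nonneg_right ?_ (by positivity)
      rw [← Complex.ofReal_sub, Complex.norm_real, Real.norm_eq_abs]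
      exact abs_tent_sub_mul_le hM1 p.1 p.2
    rw [hX'] at hbd
    have e : Complex.I * μ * ((∑' n, tent M n * ‖x n‖ ^ 2 : ℝ) : ℂ) - (starRingEnd ℂ)
        (Complex.I * μ * ((∑' n, tent M n * ‖x n‖ ^ 2 : ℝ) : ℂ)) =
        2 * Complex.I * μ * ((∑' n, tent M n * ‖x n‖ ^ 2 : ℝ) : ℂ) := by
      simp only [map_mul, Complex.conj_I, Complex.conj_ofReal]; ring
    have hpos : 0 ≤ ∑' n, tent M n * ‖x n‖ ^ 2 :=
      tsum_nonneg fun n => mul_nonneg (tent_nonneg _ _) (sq_nonneg _)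
    rw [e, norm_mul, norm_mul, norm_mul, Complex.norm_real, Complex.norm_real, Complex.norm_I,
      Real.norm_of_nonneg hpos, Real.norm_eq_abs] at hbd
    have hS := hJ.sum_le_tsum S fun n _ => mul_nonneg (tent_nonneg _ _) (sq_nonneg _)
    have := mul_le_mul_of_nonneg_left hS (abs_nonneg μ)
    norm_num at hbd
    linarith
  have htent : ∀ n : ℤ, Tendsto (fun M : ℕ => tent M n) atTop (𝓝 1) := by
    intro n
    have h1 : Tendsto (fun M : ℕ => |(n : ℝ)| / M) atTop (𝓝 0) :=
      tendsto_const_div_atTop_nhds_zero_nat _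
    have h2 := (tendsto_const_nhds (x := (0 : ℝ))).max ((tendsto_const_nhds (x := (1 : ℝ))).sub h1)
    simpa [tent] using h2
  have hS : ∀ S : Finset ℤ, |μ| * ∑ n ∈ S, ‖x n‖ ^ 2 ≤ C * ∑' n, ‖x n‖ ^ 2 := by
    intro S
    have h1 : Tendsto (fun M : ℕ => |μ| * ∑ n ∈ S, tent M n * ‖x n‖ ^ 2) atTop
        (𝓝 (|μ| * ∑ n ∈ S, 1 * ‖x n‖ ^ 2)) :=
      (tendsto_finsetSum S fun n _ => (htent n).mul_const _).const_mul _
    simp only [one_mul] at h1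
    exact le_of_tendsto h1 (eventually_atTop.mpr ⟨1, fun M hM => hkey M hM S⟩)
  have hfin : |μ| * ∑' n, ‖x n‖ ^ 2 ≤ C * ∑' n, ‖x n‖ ^ 2 :=
    le_of_tendsto (hx.hasSum.const_mul |μ|) (Eventually.of_forall hS)
  have h0 : 0 ≤ ∑' n, ‖x n‖ ^ 2 := tsum_nonneg fun n => sq_nonneg _
  -- Here `C < |μ|` contradicts a positive norm.
  have hz : ∑' n, ‖x n‖ ^ 2 = 0 := by nlinarith
  funext n
  have := hx.le_tsum n fun k _ => sq_nonneg ‖x k‖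
  rw [hz] at this
  have h2 : ‖x n‖ = 0 := by nlinarith [norm_nonneg (x n)]
  exact norm_eq_zero.mp h2

variable [CompleteSpace E]

/-- Essential self-adjointness on a basis of a first order operator with rapidly decaying symmetric
coefficients: its closure generates a unitary group and equals its adjoint. -/
theorem exists_unitaryGroup_of_basis (e : HilbertBasis ℤ ℂ E) {s : ℤ → E} {f : ℤ → ℂ}
    (hf : ∀ m, f (-m) = (starRingEnd ℂ) (f m))
    (hsum : Summable fun m : ℤ => (1 + (m : ℝ) ^ 2) * ‖f m‖)
    (hs : ∀ k n : ℤ, ⟪e k, s n⟫ = -((k : ℂ) + n) / 2 * f (k - n)) :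
    (∃ U, IsUnitaryGroupOfGraph
      (Submodule.span ℂ (Set.range fun n => (e n, s n))).topologicalClosure U) ∧
    ∀ u v, (∀ n, ⟪s n, u⟫ = ⟪e n, v⟫) →
      (u, v) ∈ (Submodule.span ℂ (Set.range fun n => (e n, s n))).topologicalClosure := by
  set Γ := (Submodule.span ℂ (Set.range fun n => (e n, s n))).topologicalClosure with hΓ
  have hs' : ∀ n k : ℤ, ⟪s n, e k⟫ = -((n : ℂ) + k) / 2 * f (n - k) := by
    intro n k
    rw [← inner_conj_symm, hs]
    simp only [map_mul, map_div₀, map_neg, map_add, map_intCast, ← hf, map_ofNat, neg_sub]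
    ring
  have hsym : IsSymmetricGraph Γ :=
    (isSymmetricGraph_span fun n k => by rw [hs', hs]).topologicalClosure
  have hmem : ∀ n, (e n, s n) ∈ Γ := fun n =>
    Submodule.le_topologicalClosure _ (Submodule.subset_span ⟨n, rfl⟩)
  have hrange : ∀ μ : ℝ, (∑' m : ℤ, (1 + (m : ℝ) ^ 2) * ‖f m‖) + 1 ≤ |μ| → HasFullRange Γ μ := by
    intro μ hμ
    have h0 : 0 ≤ ∑' m : ℤ, (1 + (m : ℝ) ^ 2) * ‖f m‖ := tsum_nonneg fun m => by positivity
    refine hsym.hasFullRange (Submodule.isClosed_topologicalClosure _)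
      (abs_pos.mp (by linarith)) fun w hw => ?_
    have hx : Summable fun n => ‖⟪e n, w⟫‖ ^ 2 := e.orthonormal.inner_products_summable w
    -- Orthogonality to the range, tested on `(e n, s n)`, is the eigenvalue equation for the
    -- coefficients of `w`.
    have := eq_zero_of_symmetric_matrix hf hsum hx (μ := μ) (by linarith) fun n => by
      have h1 := e.hasSum_inner_mul_inner (s n) w
      simp only [hs'] at h1
      refine (congrArg (HasSum _) ?_).mp h1
      have h2 := hw _ (hmem n)
      rw [inner_add_left, inner_smul_left, map_mul, Complex.conj_I, Complex.conj_ofReal] at h2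
      linear_combination h2
    rw [← e.repr.map_eq_zero_iff]
    ext n
    rw [e.repr_apply_apply]
    exact congrFun this n
  constructor
  · refine hsym.exists_unitaryGroup ?_ hrange
    have h1 : Dense ((Submodule.span ℂ (Set.range e) : Submodule ℂ E) : Set E) := by
      rw [Submodule.dense_iff_topologicalClosure_eq_top]
      exact e.dense_span
    refine h1.mono fun u hu => ?_
    have h2 : Submodule.span ℂ (Set.range e) ≤ Γ.map (LinearMap.fst ℂ E E) := by
      rw [Submodule.span_le]
      rintro _ ⟨n, rfl⟩
      exact ⟨_, hmem n, rfl⟩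
    obtain ⟨p, hp, rfl⟩ := h2 hu
    exact ⟨p.2, hp⟩
  · intro u v huv
    refine hsym.mem_of_adjoint (hrange (∑' m : ℤ, (1 + (m : ℝ) ^ 2) * ‖f m‖ + 1) (le_abs_self _))
      (hrange _ (by rw [abs_neg]; exact le_abs_self _)) fun p hp => ?_
    have hc : IsClosed {p : E × E | ⟪p.2, u⟫ = ⟪p.1, v⟫} :=
      isClosed_eq (by fun_prop) (by fun_prop)
    refine closure_minimal (fun p hp => ?_) hc hp
    change ⟪p.2, u⟫ = ⟪p.1, v⟫
    induction hp using Submodule.span_induction with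
    | mem p hp => obtain ⟨n, rfl⟩ := hp; exact huv n
    | zero => simp
    | add x y _ _ hx hy => simp only [Prod.fst_add, Prod.snd_add, inner_add_left, hx, hy]
    | smul c x _ hx => simp only [Prod.smul_fst, Prod.smul_snd, inner_smul_left, hx]

end Deficiency

/-! ### Multiplication operators on `L²(𝕋)` -/

section Multiplication

local notation "⟪" x ", " y "⟫" => inner ℂ x y

/-- Multiplication by an essentially bounded function on `L²(𝕋)` (`0` for other functions). -/
def mulL (w : Torus → ℂ) : L2T →L[ℂ] L2T :=
  open Classical in
  if h : MemLp w ∞ torusMeasure then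
    (ContinuousLinearMap.mul ℂ ℂ).holderL torusMeasure ∞ 2 2 (h.toLp w) else 0

theorem coeFn_mulL {w : Torus → ℂ} (h : MemLp w ∞ torusMeasure) (f : L2T) :
    mulL w f =ᵐ[torusMeasure] fun p => w p * f p := by
  rw [mulL, dif_pos h]
  have h1 := (ContinuousLinearMap.mul ℂ ℂ).coeFn_holder (r := 2) (h.toLp w) f
  refine h1.trans ?_
  filter_upwards [h.coeFn_toLp] with p hp
  rw [hp]; rfl

theorem mulL_mul {w w' : Torus → ℂ} (h : MemLp w ∞ torusMeasure) (h' : MemLp w' ∞ torusMeasure)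
    (f : L2T) : mulL w (mulL w' f) = mulL (fun p => w p * w' p) f := by
  refine Lp.ext ?_
  filter_upwards [coeFn_mulL h (mulL w' f), coeFn_mulL h' f, coeFn_mulL (h'.mul (r := ∞) h) f]
    with p h1 h2 h3
  rw [h1, h2]
  exact (h3.trans (mul_assoc _ _ _)).symm

theorem sum_mulL {ι : Type*} [Fintype ι] {w : ι → Torus → ℂ}
    (h : ∀ i, MemLp (w i) ∞ torusMeasure) (f : L2T) :
    ∑ i, mulL (w i) f = mulL (fun p => ∑ i, w i p) f := by
  refine Lp.ext ?_
  have h1 : ∀ᵐ p ∂torusMeasure, ∀ i, mulL (w i) f p = w i p * f p :=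
    ae_all_iff.mpr fun i => coeFn_mulL (h i) f
  filter_upwards [h1, coeFn_mulL (memLp_finsetSum Finset.univ fun i _ => h i) f,
    Lp.coeFn_finsetSum Finset.univ fun i => mulL (w i) f] with p h1 h2 h3
  rw [h3, h2]
  simp only [Finset.sum_apply, h1, Finset.sum_mul]

theorem mulL_const (c : ℂ) (f : L2T) : mulL (fun _ => c) f = c • f := by
  refine Lp.ext ?_
  filter_upwards [coeFn_mulL (memLp_const c) f, Lp.coeFn_smul c f] with p h1 h2
  rw [h1, h2]; rfl

theorem inner_mulL_left {w : Torus → ℂ} (h : MemLp w ∞ torusMeasure) (f g : L2T) :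
    ⟪mulL w f, g⟫ = ⟪f, mulL (fun p => (starRingEnd ℂ) (w p)) g⟫ := by
  rw [L2.inner_def, L2.inner_def]
  refine integral_congr_ae ?_
  filter_upwards [coeFn_mulL h f, coeFn_mulL h.star g] with p h1 h2
  have h2' : mulL (fun p => (starRingEnd ℂ) (w p)) g p = (starRingEnd ℂ) (w p) * g p := h2
  rw [h1, h2']
  simp only [RCLike.inner_apply, map_mul]
  ring

end Multiplication

/-! ### Functions on the torus given on `[-π, π)`, and their Fourier coefficients -/

section Lift

local notation "⟪" x ", " y "⟫" => inner ℂ x y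

/-- The function on the torus which coincides with `η` on `[-π, π)`. -/
def circleLift {B : Type*} (η : ℝ → B) : Torus → B := AddCircle.liftIco (2 * Real.pi) (-Real.pi) η

theorem neg_pi_add_two_pi : -Real.pi + 2 * Real.pi = Real.pi := by ring

theorem exists_coe_eq (p : Torus) : ∃ x ∈ Ico (-Real.pi) Real.pi, (x : Torus) = p := by
  have h := AddCircle.coe_image_Ico_eq (2 * Real.pi) (-Real.pi)
  obtain ⟨x, hx, e⟩ := h.symm ▸ mem_univ p
  exact ⟨x, by rwa [neg_pi_add_two_pi] at hx, e⟩

theorem circleLift_coe {B : Type*} (η : ℝ → B) {x : ℝ} (hx : x ∈ Ico (-Real.pi) Real.pi) :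
    circleLift η (x : Torus) = η x :=
  AddCircle.liftIco_coe_apply (by rwa [neg_pi_add_two_pi])

theorem eq_circleLift {B : Type*} {u : Torus → B} {η : ℝ → B}
    (h : ∀ x ∈ Ico (-Real.pi) Real.pi, u (x : Torus) = η x) : u = circleLift η := by
  funext p
  obtain ⟨x, hx, rfl⟩ := exists_coe_eq p
  rw [h x hx, circleLift_coe η hx]

theorem memLp_circleLift {η : ℝ → ℂ} (h : Continuous η) : MemLp (circleLift η) ∞ torusMeasure := by
  obtain ⟨C, hC⟩ := (isCompact_Icc (a := -Real.pi) (b := Real.pi)).exists_bound_of_continuousOn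
    h.continuousOn
  have hm : Measurable (circleLift η) :=
    h.measurable.comp (measurable_subtype_coe.comp
      (AddCircle.measurableEquivIco (2 * Real.pi) (-Real.pi)).measurable)
  refine memLp_top_of_bound hm.aestronglyMeasurable C (Eventually.of_forall fun p => ?_)
  obtain ⟨x, hx, rfl⟩ := exists_coe_eq p
  rw [circleLift_coe η hx]
  exact hC x (Ico_subset_Icc_self hx)

theorem integral_circleLift (η : ℝ → ℂ) :
    ∫ p, circleLift η p ∂torusMeasure = (2 * Real.pi)⁻¹ • ∫ x in (-Real.pi)..Real.pi, η x := by
  rw [AddCircle.integral_haarAddCircle, ← AddCircle.intervalIntegral_preimage (2 * Real.pi)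
    (-Real.pi), neg_pi_add_two_pi]
  congr 1
  refine intervalIntegral.integral_congr_ae ?_
  filter_upwards [Measure.ae_ne volume Real.pi] with x hx hx'
  rw [uIoc_of_le (by linarith [Real.pi_pos])] at hx'
  exact circleLift_coe η ⟨hx'.1.le, lt_of_le_of_ne hx'.2 hx⟩

theorem inner_eq_integral {f g : L2T} {α β : ℝ → ℂ} (hf : f =ᵐ[torusMeasure] circleLift α)
    (hg : g =ᵐ[torusMeasure] circleLift β) :
    ⟪f, g⟫ = (2 * Real.pi)⁻¹ • ∫ x in (-Real.pi)..Real.pi, (starRingEnd ℂ) (α x) * β x := by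
  rw [L2.inner_def, ← integral_circleLift]
  refine integral_congr_ae ?_
  filter_upwards [hf, hg] with p h1 h2
  rw [h1, h2, RCLike.inner_apply, mul_comm]
  rfl

/-- The basis function `e^{inx}`. -/
def expI (n : ℤ) (x : ℝ) : ℂ := Complex.exp (Complex.I * n * x)

theorem fourier_coe_eq_expI (n : ℤ) (x : ℝ) : (fourier n (x : Torus) : ℂ) = expI n x := by
  rw [fourier_coe_apply, expI]
  congr 1
  have : (Real.pi : ℂ) ≠ 0 := by exact_mod_cast Real.pi_ne_zero
  push_cast
  field_simp

theorem hasDerivAt_expI (n : ℤ) (x : ℝ) : HasDerivAt (expI n) (Complex.I * n * expI n x) x := by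
  have h1 : HasDerivAt (fun z : ℂ => Complex.exp (Complex.I * n * z))
      (Complex.exp (Complex.I * n * x) * (Complex.I * n * 1)) (x : ℂ) :=
    ((hasDerivAt_id (x : ℂ)).const_mul (Complex.I * n)).cexp
  have h2 := h1.comp_ofReal
  convert! h2 using 1
  rw [expI]; ring

theorem contDiff_expI (n : ℤ) : ContDiff ℝ ∞ (expI n) := by
  unfold expI
  exact Complex.contDiff_exp.comp (contDiff_const.mul Complex.ofRealCLM.contDiff)

theorem continuous_expI (n : ℤ) : Continuous (expI n) := (contDiff_expI n).continuous

theorem conj_expI (n : ℤ) (x : ℝ) : (starRingEnd ℂ) (expI n x) = expI (-n) x := by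
  rw [expI, expI, ← Complex.exp_conj]
  simp

theorem expI_mul (m n : ℤ) (x : ℝ) : expI m x * expI n x = expI (m + n) x := by
  rw [expI, expI, expI, ← Complex.exp_add]
  congr 1
  push_cast; ring

theorem expI_periodic (n : ℤ) : Function.Periodic (expI n) (2 * Real.pi) := by
  intro x
  rw [← fourier_coe_eq_expI, ← fourier_coe_eq_expI, AddCircle.coe_add_period]

/-- The Fourier basis of `L²(𝕋)`. -/
abbrev basisT : HilbertBasis ℤ ℂ L2T := fourierBasis (T := 2 * Real.pi)

theorem coeFn_basisT (n : ℤ) : basisT n =ᵐ[torusMeasure] circleLift (expI n) := by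
  rw [coe_fourierBasis]
  refine (coeFn_fourierLp 2 n).trans (Eventually.of_forall fun p => ?_)
  exact congrFun (eq_circleLift fun x _ => fourier_coe_eq_expI n x) p

theorem coeFn_mulL_basisT {η : ℝ → ℂ} (h : Continuous η) (n : ℤ) :
    mulL (circleLift η) (basisT n) =ᵐ[torusMeasure] circleLift fun x => η x * expI n x := by
  filter_upwards [coeFn_mulL (memLp_circleLift h) (basisT n), coeFn_basisT n] with p h1 h2
  rw [h1, h2]; rfl

/-- Fourier coefficients of a function on `[-π, π]`. -/
def coefI (g : ℝ → ℂ) (m : ℤ) : ℂ :=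
  (2 * Real.pi)⁻¹ • ∫ x in (-Real.pi)..Real.pi, expI (-m) x * g x

theorem coefI_deriv {g : ℝ → ℂ} (hg : ContDiff ℝ ∞ g) (hp : Function.Periodic g (2 * Real.pi))
    (m : ℤ) : coefI (deriv g) m = Complex.I * m * coefI g m := by
  have hd : ∀ x, HasDerivAt (fun x => expI (-m) x * g x)
      (expI (-m) x * deriv g x - Complex.I * m * (expI (-m) x * g x)) x := by
    intro x
    have := (hasDerivAt_expI (-m) x).mul ((hg.differentiable (by simp)) x).hasDerivAt
    convert! this using 1
    push_cast; ring
  have hc : Continuous (deriv g) := hg.continuous_deriv (by simp)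
  have c1 : Continuous fun x => expI (-m) x * deriv g x := (continuous_expI _).mul hc
  have c2 : Continuous fun x => Complex.I * m * (expI (-m) x * g x) :=
    continuous_const.mul ((continuous_expI _).mul hg.continuous)
  have h1 := intervalIntegral.integral_eq_sub_of_hasDerivAt (a := -Real.pi) (b := Real.pi)
    (fun x _ => hd x) ((c1.sub c2).intervalIntegrable _ _)
  have h2 : expI (-m) Real.pi * g Real.pi - expI (-m) (-Real.pi) * g (-Real.pi) = 0 := by
    have e1 := hp (-Real.pi)
    have e2 := expI_periodic (-m) (-Real.pi)
    rw [neg_pi_add_two_pi] at e1 e2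
    rw [e1, e2, sub_self]
  rw [h2, intervalIntegral.integral_sub (c1.intervalIntegrable _ _) (c2.intervalIntegrable _ _),
    intervalIntegral.integral_const_mul, sub_eq_zero] at h1
  rw [coefI, coefI, h1, mul_smul_comm]

theorem norm_coefI_le {g : ℝ → ℂ} (hg : Continuous g) : ∃ C, ∀ m, ‖coefI g m‖ ≤ C := by
  obtain ⟨C, hC⟩ := (isCompact_Icc (a := -Real.pi) (b := Real.pi)).exists_bound_of_continuousOn
    hg.continuousOn
  refine ⟨‖(2 * Real.pi)⁻¹‖ * (C * |Real.pi - -Real.pi|), fun m => ?_⟩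
  rw [coefI, norm_smul]
  refine mul_le_mul_of_nonneg_left ?_ (norm_nonneg _)
  refine intervalIntegral.norm_integral_le_of_norm_le_const fun x hx => ?_
  rw [uIoc_of_le (by linarith [Real.pi_pos])] at hx
  have : ‖expI (-m) x‖ = 1 := by
    rw [expI, show Complex.I * ((-m : ℤ) : ℂ) * x = ((-m * x : ℝ) : ℂ) * Complex.I by
      push_cast; ring, Complex.norm_exp_ofReal_mul_I]
  rw [norm_mul, this, one_mul]
  exact hC x (Ioc_subset_Icc_self hx)

theorem periodic_deriv {g : ℝ → ℂ} {T : ℝ} (hp : Function.Periodic g T) :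
    Function.Periodic (deriv g) T := by
  intro x
  rw [← deriv_comp_add_const]
  congr 1
  funext y
  exact hp y

/-- Four integrations by parts give decay `m⁻⁴`, which against the weight `1 + m²` leaves a summable
`m⁻²`. -/
theorem summable_coefI {g : ℝ → ℂ} (hg : ContDiff ℝ ∞ g) (hp : Function.Periodic g (2 * Real.pi)) :
    Summable fun m : ℤ => (1 + (m : ℝ) ^ 2) * ‖coefI g m‖ := by
  have hd : ∀ k : ℕ, ContDiff ℝ ∞ (deriv^[k] g) ∧ Function.Periodic (deriv^[k] g) (2 * Real.pi) ∧
      ∀ m : ℤ, coefI (deriv^[k] g) m = (Complex.I * m) ^ k * coefI g m := by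
    intro k
    induction k with
    | zero => exact ⟨hg, hp, fun m => by simp⟩
    | succ k ih =>
      rw [Function.iterate_succ_apply']
      refine ⟨?_, periodic_deriv ih.2.1, fun m => ?_⟩
      · exact (contDiff_infty_iff_deriv.mp ih.1).2
      · rw [coefI_deriv ih.1 ih.2.1, ih.2.2]; ring
  obtain ⟨C₄, hC₄⟩ := norm_coefI_le (hd 4).1.continuous
  have hb : ∀ m : ℤ, (m : ℝ) ^ 4 * ‖coefI g m‖ ≤ C₄ := by
    intro m
    have := hC₄ m
    rw [(hd 4).2.2, norm_mul, norm_pow, norm_mul, Complex.norm_I, one_mul, Complex.norm_intCast]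
      at this
    rwa [show (|(m : ℝ)|) ^ 4 = (m : ℝ) ^ 4 from by rw [← abs_pow, abs_of_nonneg (by positivity)]]
      at this
  have hs : Summable fun m : ℤ => (2 * C₄) * (1 / (m : ℝ) ^ 2) :=
    (Real.summable_one_div_int_pow.mpr one_lt_two).mul_left _
  -- The comparison series takes the value `1/0 = 0` at `m = 0`, so that index is excluded.
  -- Elsewhere `1 + m² ≤ 2m²`, whence the factor 2.
  refine Summable.of_norm_bounded_eventually hs ?_
  rw [eventually_cofinite]
  refine (finite_singleton (0 : ℤ)).subset fun m hm => ?_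
  by_contra hm0
  apply hm
  have hm1 : (1 : ℝ) ≤ (m : ℝ) ^ 2 := by
    have : (1 : ℤ) ≤ m ^ 2 := by
      have : 0 < m ^ 2 := by 
        have : m ≠ 0 := hm0
        positivity
      omega
    exact_mod_cast this
  rw [Real.norm_of_nonneg (by positivity), mul_one_div, le_div_iff₀ (by linarith)]
  have := hb m
  have h2 : (m : ℝ) ^ 2 ≤ (m : ℝ) ^ 4 := by nlinarith
  nlinarith [norm_nonneg (coefI g m), mul_le_mul_of_nonneg_right h2 (norm_nonneg (coefI g m))]

end Lift

/-! ### The band operators `a_j`: self-adjointness and domain -/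

section BandOperator

local notation "⟪" x ", " y "⟫" => inner ℂ x y

/-- The zeroth order coefficient of `a ∘ η`, where `a = iF d/dx + (i/2) F'`. -/
def zerothCoef (F : ℝ → ℝ) (η : ℝ → ℂ) (x : ℝ) : ℂ :=
  Complex.I * F x * deriv η x + Complex.I / 2 * deriv F x * η x

/-- The first order coefficient of `a ∘ η`. -/
def firstCoef (F : ℝ → ℝ) (η : ℝ → ℂ) (x : ℝ) : ℂ := Complex.I * F x * η x

/-- The functions, smooth on `[-π, π]`, whose jump at `±π` is not seen by `F`. -/
structure Admissible (F : ℝ → ℝ) (η : ℝ → ℂ) : Prop where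
  contDiff : ContDiff ℝ ∞ η
  boundary : F Real.pi = 0 ∨ Function.Periodic η (2 * Real.pi)

/-- The image of `e^{inx}` under `a`. -/
def bandImage (F : ℝ → ℝ) (n : ℤ) : L2T := mulL (circleLift fun x =>
  -(n : ℂ) * F x + Complex.I / 2 * deriv F x) (basisT n)

theorem contDiff_deriv {𝕜 : Type*} [RCLike 𝕜] {g : ℝ → 𝕜} (hg : ContDiff ℝ ∞ g) :
    ContDiff ℝ ∞ (deriv g) :=
  (contDiff_infty_iff_deriv.mp hg).2

theorem contDiff_ofReal_comp {F : ℝ → ℝ} (hF : ContDiff ℝ ∞ F) :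
    ContDiff ℝ ∞ fun x => (F x : ℂ) :=
  Complex.ofRealCLM.contDiff.comp hF

theorem contDiff_zerothCoef {F : ℝ → ℝ} (hF : ContDiff ℝ ∞ F) {η : ℝ → ℂ} (h : ContDiff ℝ ∞ η) :
    ContDiff ℝ ∞ (zerothCoef F η) :=
  ((contDiff_const.mul (contDiff_ofReal_comp hF)).mul (contDiff_deriv h)).add
    ((contDiff_const.mul (contDiff_ofReal_comp (contDiff_deriv hF))).mul h)

theorem contDiff_firstCoef {F : ℝ → ℝ} (hF : ContDiff ℝ ∞ F) {η : ℝ → ℂ} (h : ContDiff ℝ ∞ η) :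
    ContDiff ℝ ∞ (firstCoef F η) :=
  (contDiff_const.mul (contDiff_ofReal_comp hF)).mul h

theorem periodic_deriv_real {g : ℝ → ℝ} {T : ℝ} (hp : Function.Periodic g T) :
    Function.Periodic (deriv g) T := by
  intro x
  rw [← deriv_comp_add_const]
  congr 1
  funext y
  exact hp y

variable {F : ℝ → ℝ}

/-- Stability of the admissible class under both coefficients of `a ∘ η` is what allows `a` to be
applied twice. -/
theorem Admissible.zerothCoef (hF : ContDiff ℝ ∞ F) (hFp : Function.Periodic F (2 * Real.pi))
    {η : ℝ → ℂ} (h : Admissible F η) :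
    Admissible F (zerothCoef F η) :=
  ⟨contDiff_zerothCoef hF h.contDiff, h.boundary.imp_right fun hp x => by
    rw [BlockLaurent.zerothCoef, hFp, hp, periodic_deriv hp, periodic_deriv_real hFp]; rfl⟩

theorem Admissible.firstCoef (hF : ContDiff ℝ ∞ F) (hFp : Function.Periodic F (2 * Real.pi))
    {η : ℝ → ℂ} (h : Admissible F η) :
    Admissible F (firstCoef F η) :=
  ⟨contDiff_firstCoef hF h.contDiff, h.boundary.imp_right fun hp x => by
    rw [BlockLaurent.firstCoef, hFp, hp]; rfl⟩

theorem coeFn_bandImage (hF : ContDiff ℝ ∞ F) (n : ℤ) : bandImage F n =ᵐ[torusMeasure] circleLift fun x =>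
    (-(n : ℂ) * F x + Complex.I / 2 * deriv F x) * expI n x :=
  coeFn_mulL_basisT ((continuous_const.mul (contDiff_ofReal_comp hF).continuous).add
    (continuous_const.mul (contDiff_ofReal_comp (contDiff_deriv hF)).continuous)) n

/-- Integration by parts. -/
theorem inner_bandImage_eq (hF : ContDiff ℝ ∞ F) (hFp : Function.Periodic F (2 * Real.pi))
    {η : ℝ → ℂ} (hη : ContDiff ℝ ∞ η)
    (hb : F Real.pi = 0 ∨ η Real.pi = η (-Real.pi)) {u v : L2T}
    (hu : u =ᵐ[torusMeasure] circleLift η) (hv : v =ᵐ[torusMeasure] circleLift (zerothCoef F η))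
    (n : ℤ) : ⟪bandImage F n, u⟫ = ⟪basisT n, v⟫ := by
  rw [inner_eq_integral (coeFn_bandImage hF n) hu, inner_eq_integral (coeFn_basisT n) hv]
  congr 1
  have hFc := contDiff_ofReal_comp hF
  have hF'c := contDiff_ofReal_comp (contDiff_deriv hF)
  have c1 : Continuous fun x => (starRingEnd ℂ) ((-(n : ℂ) * F x + Complex.I / 2 * deriv F x) *
      expI n x) * η x := by
    have := ((continuous_const.mul hFc.continuous).add
      (continuous_const.mul hF'c.continuous) : Continuous fun x : ℝ =>
        (-(n : ℂ) * F x + Complex.I / 2 * deriv F x))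
    exact (Complex.continuous_conj.comp (this.mul (continuous_expI n))).mul hη.continuous
  have c2 : Continuous fun x => (starRingEnd ℂ) (expI n x) * zerothCoef F η x :=
    (Complex.continuous_conj.comp (continuous_expI n)).mul (contDiff_zerothCoef hF hη).continuous
  have hd : ∀ x, HasDerivAt (fun x => -Complex.I * ((F x : ℂ) * expI (-n) x * η x))
      ((starRingEnd ℂ) ((-(n : ℂ) * F x + Complex.I / 2 * deriv F x) * expI n x) * η x -
        (starRingEnd ℂ) (expI n x) * zerothCoef F η x) x := by
    intro x
    have h1 : HasDerivAt (fun x => (F x : ℂ)) ((deriv F x : ℝ) : ℂ) x :=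
      (hF.differentiable (by simp) x).hasDerivAt.ofReal_comp
    have h2 := (hη.differentiable (by simp) x).hasDerivAt
    have h3 := ((h1.mul (hasDerivAt_expI (-n) x)).mul h2).const_mul (-Complex.I)
    convert! h3 using 1
    simp only [map_mul, map_add, map_neg, map_div₀, conj_expI, Complex.conj_ofReal, Complex.conj_I,
      map_intCast, map_ofNat, zerothCoef, Pi.mul_apply]
    push_cast
    linear_combination (-(n : ℂ) * F x * expI (-n) x * η x) * Complex.I_sq
  have h1 := intervalIntegral.integral_eq_sub_of_hasDerivAt (a := -Real.pi) (b := Real.pi)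
    (fun x _ => hd x) ((c1.sub c2).intervalIntegrable _ _)
  rw [intervalIntegral.integral_sub (c1.intervalIntegrable _ _) (c2.intervalIntegrable _ _)] at h1
  rw [← sub_eq_zero, h1]
  have e1 := hFp (-Real.pi)
  have e2 := expI_periodic (-n) (-Real.pi)
  rw [neg_pi_add_two_pi] at e1 e2
  rcases hb with hb | hb
  · rw [← e1, hb]; simp
  · rw [← e1, ← e2, hb, sub_self]

/-- The Fourier coefficient of `F'` is `i(k-n)` times that of `F`; the term `(i/2) F'` therefore
turns the factor `-n` into the symmetric `-(k+n)/2`. -/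
theorem inner_basisT_bandImage (hF : ContDiff ℝ ∞ F) (hFp : Function.Periodic F (2 * Real.pi))
    (k n : ℤ) : ⟪basisT k, bandImage F n⟫ =
      -((k : ℂ) + n) / 2 * coefI (fun x => (F x : ℂ)) (k - n) := by
  have hFc := contDiff_ofReal_comp hF
  have hF'c := contDiff_ofReal_comp (contDiff_deriv hF)
  have hd := coefI_deriv hFc (fun x => congrArg Complex.ofReal (hFp x)) (k - n)
  have hde : deriv (fun x => (F x : ℂ)) = fun x => ((deriv F x : ℝ) : ℂ) := by
    funext x
    exact (hF.differentiable (by simp) x).hasDerivAt.ofReal_comp.deriv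
  rw [hde] at hd
  rw [inner_eq_integral (coeFn_basisT k) (coeFn_bandImage hF n)]
  have e : ∀ x : ℝ, (starRingEnd ℂ) (expI k x) * ((-(n : ℂ) * F x + Complex.I / 2 * deriv F x) *
      expI n x) = -(n : ℂ) * (expI (-(k - n)) x * F x) +
        Complex.I / 2 * (expI (-(k - n)) x * deriv F x) := by
    intro x
    rw [conj_expI, show -(k - n) = -k + n by ring, ← expI_mul]
    ring
  simp only [e]
  have c1 : Continuous fun x : ℝ => -(n : ℂ) * (expI (-(k - n)) x * F x) :=
    continuous_const.mul ((continuous_expI _).mul hFc.continuous)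
  have c2 : Continuous fun x : ℝ => Complex.I / 2 * (expI (-(k - n)) x * deriv F x) :=
    continuous_const.mul ((continuous_expI _).mul hF'c.continuous)
  rw [intervalIntegral.integral_add (c1.intervalIntegrable _ _) (c2.intervalIntegrable _ _),
    intervalIntegral.integral_const_mul, intervalIntegral.integral_const_mul, smul_add,
    ← mul_smul_comm, ← mul_smul_comm]
  change -(n : ℂ) * coefI (fun x => (F x : ℂ)) (k - n) +
    Complex.I / 2 * coefI (fun x => ((deriv F x : ℝ) : ℂ)) (k - n) = _
  rw [hd]
  push_cast
  linear_combination (((k : ℂ) - n) / 2 * coefI (fun x => (F x : ℂ)) (k - n)) * Complex.I_sq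

theorem coefI_neg_ofReal (m : ℤ) :
    coefI (fun x => (F x : ℂ)) (-m) = (starRingEnd ℂ) (coefI (fun x => (F x : ℂ)) m) := by
  have h : ∀ z : ℂ, (starRingEnd ℂ) ((2 * Real.pi)⁻¹ • z) =
      (2 * Real.pi)⁻¹ • (starRingEnd ℂ) z := fun z => by
    rw [Complex.real_smul, Complex.real_smul, map_mul, Complex.conj_ofReal]
  rw [coefI, coefI, h, intervalIntegral.integral_of_le (by linarith [Real.pi_pos]),
    intervalIntegral.integral_of_le (by linarith [Real.pi_pos]), ← integral_conj]
  simp [conj_expI]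

/-- The exponentials already form a core: the closure of `a` on them contains its adjoint, and by
integration by parts every smooth periodic function satisfies the adjoint relation. The second
conclusion is the resulting weak criterion for membership in the domain. -/
theorem bandGraph_eq_and_exists_unitaryGroup (hF : ContDiff ℝ ∞ F)
    (hFp : Function.Periodic F (2 * Real.pi)) :
    (∃ U, IsUnitaryGroupOfGraph (bandGraph F) U) ∧
      ∀ u v, (∀ n, ⟪bandImage F n, u⟫ = ⟪basisT n, v⟫) → (u, v) ∈ bandGraph F := by
  have key := exists_unitaryGroup_of_basis basisT (s := bandImage F)
    (f := coefI fun x => (F x : ℂ)) coefI_neg_ofReal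
    (summable_coefI (contDiff_ofReal_comp hF) fun x => congrArg Complex.ofReal (hFp x))
    (inner_basisT_bandImage hF hFp)
  have hEq : bandGraph F = (Submodule.span ℂ
      (Set.range fun n => (basisT n, bandImage F n))).topologicalClosure := by
    refine le_antisymm ?_ ?_
    · refine Submodule.topologicalClosure_minimal _ ?_ (Submodule.isClosed_topologicalClosure _)
      rintro ⟨u, v⟩ ⟨φ, χ, hφ, hχ, hu, hv⟩
      refine key.2 u v fun n => inner_bandImage_eq hF hFp hφ (Or.inr ?_) ?_ ?_ n
      · have := AddCircle.coe_add_period (2 * Real.pi) (-Real.pi)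
        rw [neg_pi_add_two_pi] at this
        exact congrArg φ this
      · rwa [← eq_circleLift (u := φ) fun x _ => rfl]
      · rwa [← eq_circleLift (u := χ) (η := zerothCoef F _) fun x _ => hχ x]
    · refine Submodule.topologicalClosure_mono ?_
      rw [Submodule.span_le]
      rintro _ ⟨n, rfl⟩
      refine ⟨fourier n, circleLift fun x =>
        (-(n : ℂ) * F x + Complex.I / 2 * deriv F x) * expI n x, ?_, fun x => ?_, ?_,
        coeFn_bandImage hF n⟩
      · simp only [fourier_coe_eq_expI]
        exact contDiff_expI n
      · simp only [fourier_coe_eq_expI]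
        rw [(hasDerivAt_expI n x).deriv]
        obtain ⟨y, hy, e⟩ := exists_coe_eq (x : Torus)
        have hper : ∀ {B : Type} (g : ℝ → B), Function.Periodic g (2 * Real.pi) → g y = g x := by
          intro B g hg
          have : hg.lift (y : Torus) = hg.lift (x : Torus) := by rw [e]
          exact this
        rw [← e, circleLift_coe _ hy, hper F hFp, hper (deriv F) (periodic_deriv_real hFp),
          hper _ (expI_periodic n)]
        linear_combination (-(n : ℂ) * F x * expI n x) * Complex.I_sq
      · rw [coe_fourierBasis]
        exact coeFn_fourierLp 2 n
  rw [hEq]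
  exact key

/-- The trigonometric polynomial with coefficients `c` on `S`. -/
def trigPoly (S : Finset ℤ) (c : ℤ → ℂ) : L2T := ∑ n ∈ S, c n • basisT n

theorem norm_trigPoly_sq (S : Finset ℤ) (c : ℤ → ℂ) :
    ‖trigPoly S c‖ ^ 2 = ∑ n ∈ S, ‖c n‖ ^ 2 := by
  have h := (fourierBasis (T := 2 * Real.pi)).orthonormal.inner_sum c c S
  have h2 : ((‖trigPoly S c‖ ^ 2 : ℝ) : ℂ) = ((∑ n ∈ S, ‖c n‖ ^ 2 : ℝ) : ℂ) := by
    have h3 := inner_self_eq_norm_sq_to_K (𝕜 := ℂ) (trigPoly S c)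
    push_cast
    rw [← Complex.coe_algebraMap] at *
    refine h3.symm.trans (h.trans ?_)
    refine Finset.sum_congr rfl fun n _ => ?_
    rw [mul_comm, Complex.mul_conj, Complex.normSq_eq_norm_sq]
    simp
  exact_mod_cast h2

/-- Coefficients of the derivative. -/
def derivCoef (c : ℤ → ℂ) (n : ℤ) : ℂ := Complex.I * n * c n

theorem norm_trigPoly_derivCoef_le {S : Finset ℤ} {b : ℝ} (hb : 0 ≤ b)
    (hS : ∀ n ∈ S, |(n : ℝ)| ≤ b) (c : ℤ → ℂ) :
    ‖trigPoly S (derivCoef c)‖ ≤ b * ‖trigPoly S c‖ := by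
  refine abs_le_of_sq_le_sq' ?_ (by positivity) |>.2
  rw [mul_pow, norm_trigPoly_sq, norm_trigPoly_sq, Finset.mul_sum]
  refine Finset.sum_le_sum fun n hn => ?_
  rw [derivCoef, norm_mul, norm_mul, Complex.norm_I, one_mul, Complex.norm_intCast, mul_pow]
  gcongr
  exact hS n hn

/-- A product of `η` and a trigonometric polynomial may jump at `±π` and so fall outside the core.
The boundary term in the integration by parts still vanishes, so the weak criterion applies. -/
theorem Admissible.mem_bandGraph (hF : ContDiff ℝ ∞ F) (hFp : Function.Periodic F (2 * Real.pi))
    {η : ℝ → ℂ} (h : Admissible F η) (S : Finset ℤ) (c : ℤ → ℂ) :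
    (mulL (circleLift η) (trigPoly S c),
      mulL (circleLift (BlockLaurent.zerothCoef F η)) (trigPoly S c) +
        mulL (circleLift (BlockLaurent.firstCoef F η)) (trigPoly S (derivCoef c))) ∈
      bandGraph F := by
  have hbasis : ∀ n, (mulL (circleLift η) (basisT n),
      mulL (circleLift (BlockLaurent.zerothCoef F η)) (basisT n) +
        (Complex.I * n) • mulL (circleLift (BlockLaurent.firstCoef F η)) (basisT n)) ∈
        bandGraph F := by
    intro n
    refine (bandGraph_eq_and_exists_unitaryGroup hF hFp).2 _ _ fun m => ?_
    have hηe : ContDiff ℝ ∞ fun x => η x * expI n x := h.contDiff.mul (contDiff_expI n)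
    refine inner_bandImage_eq hF hFp hηe ?_ (coeFn_mulL_basisT h.contDiff.continuous n) ?_ m
    · refine h.boundary.imp_right fun hp => ?_
      have e1 := hp (-Real.pi)
      have e2 := expI_periodic n (-Real.pi)
      rw [neg_pi_add_two_pi] at e1 e2
      rw [e1, e2]
    · filter_upwards [coeFn_mulL_basisT (contDiff_zerothCoef hF h.contDiff).continuous n,
        coeFn_mulL_basisT (contDiff_firstCoef hF h.contDiff).continuous n,
        Lp.coeFn_add (mulL (circleLift (BlockLaurent.zerothCoef F η)) (basisT n))
          ((Complex.I * n) • mulL (circleLift (BlockLaurent.firstCoef F η)) (basisT n)),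
        Lp.coeFn_smul (Complex.I * n : ℂ)
          (mulL (circleLift (BlockLaurent.firstCoef F η)) (basisT n))] with p h1 h2 h3 h4
      rw [h3, Pi.add_apply, h4, Pi.smul_apply, h1, h2]
      obtain ⟨x, hx, rfl⟩ := exists_coe_eq p
      rw [circleLift_coe _ hx, circleLift_coe _ hx, circleLift_coe _ hx]
      have hd : deriv (fun x => η x * expI n x) x =
          deriv η x * expI n x + η x * (Complex.I * n * expI n x) :=
        ((h.contDiff.differentiable (by simp) x).hasDerivAt.mul (hasDerivAt_expI n x)).deriv
      simp only [BlockLaurent.zerothCoef, BlockLaurent.firstCoef, hd, smul_eq_mul]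
      ring
  have hsum := (bandGraph F).sum_mem fun n (_ : n ∈ S) => (bandGraph F).smul_mem (c n) (hbasis n)
  convert hsum using 1
  refine Prod.ext ?_ ?_
  · simp [trigPoly, Prod.fst_sum]
  · simp only [trigPoly, map_sum, map_smul, Prod.snd_sum, Prod.smul_snd, smul_add,
      Finset.sum_add_distrib, derivCoef, smul_smul]
    congr 1
    exact Finset.sum_congr rfl fun n _ => congrArg (· • _) (mul_comm _ _)

end BandOperator

/-! ### The diagonalising transformation and the group of `𝔸` -/

section Diagonalisation

local notation "⟪" x ", " y "⟫" => inner ℂ x y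

variable {N : ℕ}

/-- `fourierCoord k` as a bounded operator. -/
def coordL (k : Fin N) : Seq N →L[ℂ] L2T :=
  (fourierBasis (T := 2 * Real.pi)).repr.symm.toContinuousLinearEquiv.toContinuousLinearMap ∘L
    (lp.mapCLM (𝕜 := ℂ) 2 (fun _ : ℤ => (EuclideanSpace.proj k : Fib N →L[ℂ] ℂ)) zero_le_one
      (fun _ => ContinuousLinearMap.opNorm_le_bound _ zero_le_one fun x => by
        simpa using PiLp.norm_apply_le x k))

theorem repr_coordL (k : Fin N) (ψ : Seq N) (n : ℤ) : basisT.repr (coordL k ψ) n = ψ n k := by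
  simp [coordL]

/-- The adjoint of `coordL k`. -/
def coordAdj (k : Fin N) : L2T →L[ℂ] Seq N := ContinuousLinearMap.adjoint (coordL k)

theorem coordAdj_apply (k l : Fin N) (f : L2T) (n : ℤ) :
    coordAdj k f n l = if l = k then basisT.repr f n else 0 := by
  have h1 : ⟪lp.single 2 n (EuclideanSpace.single l (1 : ℂ)), coordAdj k f⟫ = coordAdj k f n l := by
    rw [lp.inner_single_left]
    simp [EuclideanSpace.inner_single_left]
  rw [← h1, coordAdj, ContinuousLinearMap.adjoint_inner_right, ← basisT.repr.inner_map_map]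
  have h2 : basisT.repr (coordL k (lp.single 2 n (EuclideanSpace.single l (1 : ℂ)))) =
      lp.single 2 n (if l = k then (1 : ℂ) else 0) := by
    ext m
    rw [repr_coordL]
    by_cases hm : m = n
    · subst hm
      simp [eq_comm]
    · rw [lp.single_apply_ne _ _ _ hm, lp.single_apply_ne _ _ _ hm]; rfl
  rw [h2, lp.inner_single_left]
  split_ifs <;> simp

theorem coordL_coordAdj (k l : Fin N) (f : L2T) :
    coordL k (coordAdj l f) = if k = l then f else 0 := by
  apply basisT.repr.injective
  ext n
  rw [repr_coordL, coordAdj_apply]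
  split_ifs <;> simp

theorem sum_coordAdj_coordL (ψ : Seq N) : ∑ k, coordAdj k (coordL k ψ) = ψ := by
  ext n l
  rw [lp.coeFn_sum, Finset.sum_apply]
  simp [coordAdj_apply, repr_coordL]

/-- `ψ ↦ ⟨w, ψ̂⟩` -/
def bandL (w : Torus → Fib N) : Seq N →L[ℂ] L2T :=
  ∑ k, mulL (fun p => (starRingEnd ℂ) (w p k)) ∘L coordL k

/-- The adjoint of `bandL w`. -/
def bandAdj (w : Torus → Fib N) : L2T →L[ℂ] Seq N :=
  ∑ k, coordAdj k ∘L mulL (fun p => w p k)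

theorem bandL_apply (w : Torus → Fib N) (ψ : Seq N) :
    bandL w ψ = ∑ k, mulL (fun p => (starRingEnd ℂ) (w p k)) (coordL k ψ) := by
  simp [bandL]

theorem bandAdj_apply (w : Torus → Fib N) (f : L2T) :
    bandAdj w f = ∑ k, coordAdj k (mulL (fun p => w p k) f) := by
  simp [bandAdj]

/-- Essential boundedness of the components of a vector field. -/
def EssBounded (w : Torus → Fib N) : Prop := ∀ k, MemLp (fun p => w p k) ∞ torusMeasure

theorem EssBounded.conj {w : Torus → Fib N} (h : EssBounded w) (k : Fin N) :
    MemLp (fun p => (starRingEnd ℂ) (w p k)) ∞ torusMeasure := (h k).star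

theorem coeFn_bandL {w : Torus → Fib N} (h : EssBounded w) (ψ : Seq N) :
    bandL w ψ =ᵐ[torusMeasure] bandComponent w ψ := by
  rw [bandL_apply]
  have h1 : ∀ᵐ p ∂torusMeasure, ∀ k, mulL (fun p => (starRingEnd ℂ) (w p k)) (coordL k ψ) p =
      (starRingEnd ℂ) (w p k) * coordL k ψ p := ae_all_iff.mpr fun k => coeFn_mulL (h.conj k) _
  filter_upwards [h1, Lp.coeFn_finsetSum Finset.univ fun k =>
    mulL (fun p => (starRingEnd ℂ) (w p k)) (coordL k ψ)] with p h1 h2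
  rw [h2, Finset.sum_apply]
  exact Finset.sum_congr rfl fun k _ => h1 k

theorem inner_bandAdj {w : Torus → Fib N} (h : EssBounded w) (f : L2T) (ψ : Seq N) :
    ⟪bandAdj w f, ψ⟫ = ⟪f, bandL w ψ⟫ := by
  rw [bandAdj_apply, bandL_apply, sum_inner, inner_sum]
  refine Finset.sum_congr rfl fun k _ => ?_
  rw [coordAdj, ContinuousLinearMap.adjoint_inner_left, inner_mulL_left (h k)]

variable {W : Fin N → Torus → Fib N}

/-- Pointwise orthonormality of the `W j p`. Together with the completeness relation
`sum_bandAdj_bandL` it expresses the unitarity of `𝒰`. -/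
theorem bandL_bandAdj (hW : ∀ j, EssBounded (W j)) (ho : ∀ p, Orthonormal ℂ fun j => W j p)
    (i j : Fin N) (f : L2T) : bandL (W i) (bandAdj (W j) f) = if i = j then f else 0 := by
  have h1 : ∀ k, coordL k (bandAdj (W j) f) = mulL (fun p => W j p k) f := by
    intro k
    rw [bandAdj_apply, map_sum]
    simp [coordL_coordAdj]
  simp only [bandL_apply, h1, mulL_mul ((hW i).conj _) (hW j _)]
  rw [sum_mulL (w := fun k p => (starRingEnd ℂ) (W i p k) * W j p k)
    fun k => (hW j k).mul (r := ∞) ((hW i).conj k)]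
  have h2 : (fun p => ∑ k, (starRingEnd ℂ) (W i p k) * W j p k) =
      fun _ => if i = j then (1 : ℂ) else 0 := by
    funext p
    rw [← orthonormal_iff_ite.mp (ho p) i j, PiLp.inner_apply]
    exact Finset.sum_congr rfl fun k _ => by rw [RCLike.inner_apply, mul_comm]
  rw [h2, mulL_const]
  split_ifs <;> simp

/-- `N` orthonormal vectors of `ℂ^N` form a basis, so the projections onto the `W j p` add up to the
identity at each `p`. -/
theorem sum_bandAdj_bandL (hW : ∀ j, EssBounded (W j)) (ho : ∀ p, Orthonormal ℂ fun j => W j p)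
    (ψ : Seq N) : ∑ j, bandAdj (W j) (bandL (W j) ψ) = ψ := by
  have h1 : ∀ p (k l : Fin N), ∑ j, W j p k * (starRingEnd ℂ) (W j p l) = if k = l then 1 else 0 := by
    intro p k l
    let b : OrthonormalBasis (Fin N) ℂ (Fib N) := OrthonormalBasis.mk (ho p) (by
      rw [(ho p).linearIndependent.span_eq_top_of_card_eq_finrank' (by simp)])
    have hb : ∀ j, b j = W j p := fun j => by simp [b]
    have h2 := b.sum_inner_mul_inner (EuclideanSpace.single k (1 : ℂ))
      (EuclideanSpace.single l (1 : ℂ))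
    simp only [hb] at h2
    simp only [EuclideanSpace.inner_single_left, EuclideanSpace.inner_single_right] at h2
    simpa [PiLp.single_apply, @eq_comm _ l k] using h2
  have h2 : ∀ j, bandAdj (W j) (bandL (W j) ψ) = ∑ k, ∑ l,
      coordAdj k (mulL (fun p => W j p k * (starRingEnd ℂ) (W j p l)) (coordL l ψ)) := by
    intro j
    rw [bandAdj_apply]
    refine Finset.sum_congr rfl fun k _ => ?_
    rw [bandL_apply, map_sum, map_sum]
    exact Finset.sum_congr rfl fun l _ => by rw [mulL_mul (hW j k) ((hW j).conj l)]
  simp only [h2]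
  rw [Finset.sum_comm]
  conv_rhs => rw [← sum_coordAdj_coordL ψ]
  refine Finset.sum_congr rfl fun k _ => ?_
  rw [Finset.sum_comm]
  have h3 : ∀ l, ∑ j, coordAdj k (mulL (fun p => W j p k * (starRingEnd ℂ) (W j p l)) (coordL l ψ)) =
      if k = l then coordAdj k (coordL l ψ) else 0 := by
    intro l
    rw [← map_sum, sum_mulL (w := fun j p => W j p k * (starRingEnd ℂ) (W j p l))
      fun j => ((hW j).conj l).mul (r := ∞) (hW j k)]
    simp only [h1]
    rw [mulL_const]
    split_ifs <;> simp
  simp only [h3]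
  simp

theorem mem_conjugateGraph_iff (hW : ∀ j, EssBounded (W j)) {F : Fin N → ℝ → ℝ} {ψ φ : Seq N} :
    (ψ, φ) ∈ conjugateGraph W F ↔ ∀ j, (bandL (W j) ψ, bandL (W j) φ) ∈ bandGraph (F j) := by
  refine forall_congr' fun j => ⟨?_, fun h => ?_⟩
  · rintro ⟨f, g, hf, hg, h⟩
    rwa [← Lp.ext (hf.trans (coeFn_bandL (hW j) ψ).symm),
      ← Lp.ext (hg.trans (coeFn_bandL (hW j) φ).symm)]
  · exact ⟨_, _, coeFn_bandL (hW j) ψ, coeFn_bandL (hW j) φ, h⟩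

theorem norm_sq_eq_sum_bandL (hW : ∀ j, EssBounded (W j)) (ho : ∀ p, Orthonormal ℂ fun j => W j p)
    (ψ : Seq N) : ‖ψ‖ ^ 2 = ∑ j, ‖bandL (W j) ψ‖ ^ 2 := by
  have h1 : ⟪ψ, ψ⟫ = ∑ j, ⟪bandL (W j) ψ, bandL (W j) ψ⟫ := by
    conv_lhs => lhs; rw [← sum_bandAdj_bandL hW ho ψ]
    rw [sum_inner]
    exact Finset.sum_congr rfl fun j _ => inner_bandAdj (hW j) _ _
  simp only [inner_self_eq_norm_sq_to_K] at h1
  exact_mod_cast h1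

/-- A direct sum of unitary groups, transported by the diagonalising transformation. -/
theorem exists_unitaryGroup_conjugateGraph (hW : ∀ j, EssBounded (W j))
    (ho : ∀ p, Orthonormal ℂ fun j => W j p) {F : Fin N → ℝ → ℝ}
    (hF : ∀ j, ∃ U, IsUnitaryGroupOfGraph (bandGraph (F j)) U) :
    ∃ U, IsUnitaryGroupOfGraph (conjugateGraph W F) U := by
  choose T hT using hF
  let U : ℝ → Seq N →L[ℂ] Seq N := fun t => ∑ j, bandAdj (W j) ∘L T j t ∘L bandL (W j)
  have hU : ∀ t ψ, U t ψ = ∑ j, bandAdj (W j) (T j t (bandL (W j) ψ)) := fun t ψ => by simp [U]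
  have hband : ∀ t j ψ, bandL (W j) (U t ψ) = T j t (bandL (W j) ψ) := by
    intro t j ψ
    rw [hU, map_sum]
    simp [bandL_bandAdj hW ho]
  have hinj : ∀ ψ φ : Seq N, (∀ j, bandL (W j) ψ = bandL (W j) φ) → ψ = φ := by
    intro ψ φ h
    rw [← sum_bandAdj_bandL hW ho ψ, ← sum_bandAdj_bandL hW ho φ]
    simp only [h]
  refine ⟨U, ?_, ?_, ?_, ?_, ?_⟩
  · ext1 ψ
    refine hinj _ _ fun j => ?_
    rw [hband, (hT j).zero]; rfl
  · intro s t
    ext1 ψ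
    refine hinj _ _ fun j => ?_
    rw [mul_apply_eq_comp, hband, hband, hband, (hT j).add]; rfl
  · intro t ψ
    refine (sq_eq_sq₀ (norm_nonneg _) (norm_nonneg _)).mp ?_
    rw [norm_sq_eq_sum_bandL hW ho, norm_sq_eq_sum_bandL hW ho ψ]
    simp only [hband, (hT _).isometry]
  · intro ψ
    simp only [hU]
    exact continuous_finsetSum _ fun j _ => (bandAdj (W j)).continuous.comp ((hT j).continuous _)
  · intro ψ φ
    rw [mem_conjugateGraph_iff hW]
    constructor
    · intro h
      have h1 := HasDerivAt.fun_sum (u := Finset.univ) fun j _ =>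
        ((bandAdj (W j)).restrictScalars ℝ).hasFDerivAt.comp_hasDerivAt (0 : ℝ)
          (((hT j).generator _ _).mp (h j))
      have e : Complex.I • φ = ∑ j, bandAdj (W j) (Complex.I • bandL (W j) φ) := by
        conv_lhs => rw [← sum_bandAdj_bandL hW ho φ]
        simp [Finset.smul_sum]
      simp only [hU, e]
      exact h1
    · intro h j
      rw [(hT j).generator]
      have h1 := ((bandL (W j)).restrictScalars ℝ).hasFDerivAt.comp_hasDerivAt (0 : ℝ) h
      have e : (bandL (W j)) (Complex.I • φ) = Complex.I • bandL (W j) φ := map_smul _ _ _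
      rw [← e]
      refine h1.congr_of_eventuallyEq (Eventually.of_forall fun t => ?_)
      exact (hband t j ψ).symm

end Diagonalisation

/-! ### Finitely supported sequences and the domain of `𝔸²` -/

section Truncation

local notation "⟪" x ", " y "⟫" => inner ℂ x y

variable {N : ℕ}

/-- The projection of `ℓ²(ℤ, ℂ^N)` onto the sequences supported in `S`. -/
def truncL (S : Finset ℤ) : Seq N →L[ℂ] Seq N :=
  ∑ n ∈ S, lp.singleContinuousLinearMap ℂ (fun _ : ℤ => Fib N) 2 n ∘L
    lp.evalCLM ℂ (fun _ : ℤ => Fib N) 2 n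

theorem truncL_eq_sum (S : Finset ℤ) (ψ : Seq N) : truncL S ψ = ∑ n ∈ S, lp.single 2 n (ψ n) := by
  simp [truncL, lp.evalCLM]

theorem truncL_apply (S : Finset ℤ) (ψ : Seq N) (n : ℤ) :
    truncL S ψ n = if n ∈ S then ψ n else 0 := by
  rw [truncL_eq_sum, lp.coeFn_sum, Finset.sum_apply]
  simp only [lp.single_apply, Pi.single_apply, Finset.sum_ite_eq]

theorem norm_truncL_apply_le (S : Finset ℤ) (ψ : Seq N) : ‖truncL S ψ‖ ≤ ‖ψ‖ := by
  have h2 : (0 : ℝ) < (2 : ℝ≥0∞).toReal := by simp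
  have h1 := lp.norm_sum_single h2 (fun n => ψ n) S
  rw [← truncL_eq_sum] at h1
  have h3 := lp.sum_rpow_le_norm_rpow h2 ψ S
  rw [← h1] at h3
  exact (Real.rpow_le_rpow_iff (norm_nonneg _) (norm_nonneg _) h2).mp h3

theorem norm_truncL_le (S : Finset ℤ) : ‖(truncL S : Seq N →L[ℂ] Seq N)‖ ≤ 1 :=
  ContinuousLinearMap.opNorm_le_bound _ zero_le_one fun ψ => by
    rw [one_mul]; exact norm_truncL_apply_le S ψ

theorem truncL_isSymmetric (S : Finset ℤ) (ψ φ : Seq N) :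
    ⟪truncL S ψ, φ⟫ = ⟪ψ, truncL S φ⟫ := by
  rw [lp.inner_eq_tsum, lp.inner_eq_tsum]
  congr 1
  funext n
  rw [truncL_apply, truncL_apply]
  split_ifs <;> simp

theorem truncL_truncL (S T : Finset ℤ) (ψ : Seq N) : truncL S (truncL T ψ) = truncL (S ∩ T) ψ := by
  ext1
  funext n
  simp only [truncL_apply, Finset.mem_inter]
  split_ifs <;> simp_all

theorem coordL_truncL (S : Finset ℤ) (k : Fin N) (ψ : Seq N) :
    coordL k (truncL S ψ) = trigPoly S fun n => ψ n k := by
  rw [truncL_eq_sum, map_sum, trigPoly]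
  refine Finset.sum_congr rfl fun n _ => ?_
  apply basisT.repr.injective
  ext m
  rw [repr_coordL, map_smul, HilbertBasis.repr_self]
  by_cases h : m = n
  · subst h; simp
  · rw [lp.single_apply_ne _ _ _ h]
    simp [h]

/-- Sequences supported in `[-b, b]` are in the domain of the square of the conjugate operator. -/
theorem exists_truncL_mem_conjugateGraph {W : Fin N → Torus → Fib N}
    (ho : ∀ p, Orthonormal ℂ fun j => W j p) {F : Fin N → ℝ → ℝ} (hF : ∀ j, ContDiff ℝ ∞ (F j))
    (hFp : ∀ j, Function.Periodic (F j) (2 * Real.pi)) {g : Fin N → ℝ → Fib N}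
    (hg : ∀ j, ∀ x ∈ Ico (-Real.pi) Real.pi, W j (x : Torus) = g j x)
    (hadm : ∀ j k, Admissible (F j) fun x => (starRingEnd ℂ) (g j x k))
    (hW : ∀ j, EssBounded (W j)) :
    ∃ C : ℝ, 0 ≤ C ∧ ∀ b : ℝ, 1 ≤ b → ∀ S : Finset ℤ, (∀ n ∈ S, |(n : ℝ)| ≤ b) → ∀ ψ : Seq N,
      ∃ φ χ, (truncL S ψ, φ) ∈ conjugateGraph W F ∧ (φ, χ) ∈ conjugateGraph W F ∧
        ‖φ‖ ≤ C * b * ‖ψ‖ ∧ ‖χ‖ ≤ C * b ^ 2 * ‖ψ‖ := by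
  let η : Fin N → Fin N → ℝ → ℂ := fun j k x => (starRingEnd ℂ) (g j x k)
  have hηW : ∀ j k, (fun p => (starRingEnd ℂ) (W j p k)) = circleLift (η j k) := fun j k =>
    eq_circleLift fun x hx => by rw [hg j x hx]
  let M : (ℝ → ℂ) → L2T →L[ℂ] L2T := fun η => mulL (circleLift η)
  let D : Fin N → Fin N → ℝ := fun j k =>
    ‖M (zerothCoef (F j) (η j k))‖ + ‖M (firstCoef (F j) (η j k))‖ +
    (‖M (zerothCoef (F j) (zerothCoef (F j) (η j k)))‖ +
      ‖M (firstCoef (F j) (zerothCoef (F j) (η j k)))‖ +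
      ‖M (zerothCoef (F j) (firstCoef (F j) (η j k)))‖ +
      ‖M (firstCoef (F j) (firstCoef (F j) (η j k)))‖)
  let C : ℝ := ∑ j, ‖bandAdj (W j)‖ * ∑ k, D j k * ‖coordL (N := N) k‖
  have hbA : ∀ v : Fin N → L2T, ∀ c : ℝ, (∀ j, ‖v j‖ ≤ (∑ k, D j k * ‖coordL (N := N) k‖) * c) →
      ‖∑ j, bandAdj (W j) (v j)‖ ≤ C * c := by
    intro v c hv
    refine (norm_sum_le _ _).trans ?_
    simp only [C]
    rw [Finset.sum_mul]
    refine Finset.sum_le_sum fun j _ => ((bandAdj (W j)).le_opNorm _).trans ?_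
    rw [mul_assoc]
    exact mul_le_mul_of_nonneg_left (hv j) (norm_nonneg _)
  refine ⟨C, by positivity, fun b hb S hS ψ => ?_⟩
  have hb0 : 0 ≤ b := by linarith
  let c : Fin N → ℤ → ℂ := fun k n => ψ n k
  have hP0 : ∀ k, ‖trigPoly S (c k)‖ ≤ ‖coordL (N := N) k‖ * ‖ψ‖ := by
    intro k
    rw [← coordL_truncL S k ψ]
    exact ((coordL k).le_opNorm _).trans
      (mul_le_mul_of_nonneg_left (norm_truncL_apply_le S ψ) (norm_nonneg _))
  have hP1 : ∀ k, ‖trigPoly S (derivCoef (c k))‖ ≤ b * (‖coordL (N := N) k‖ * ‖ψ‖) := fun k =>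
    (norm_trigPoly_derivCoef_le hb0 hS _).trans (mul_le_mul_of_nonneg_left (hP0 k) hb0)
  have hP2 : ∀ k, ‖trigPoly S (derivCoef (derivCoef (c k)))‖ ≤
      b * (b * (‖coordL (N := N) k‖ * ‖ψ‖)) := fun k =>
    (norm_trigPoly_derivCoef_le hb0 hS _).trans (mul_le_mul_of_nonneg_left (hP1 k) hb0)
  -- `v j` is `a_j` applied to the `j`-th component of `𝒰 (truncL S ψ)`, and `w j` below is `a_j (v
  -- j)`. Each application puts at most one more derivative on the trigonometric polynomial, at the
  -- price of a factor `b`.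
  let v : Fin N → L2T := fun j => ∑ k, (M (zerothCoef (F j) (η j k)) (trigPoly S (c k)) +
    M (firstCoef (F j) (η j k)) (trigPoly S (derivCoef (c k))))
  let w : Fin N → L2T := fun j => ∑ k,
    ((M (zerothCoef (F j) (zerothCoef (F j) (η j k))) (trigPoly S (c k)) +
      M (firstCoef (F j) (zerothCoef (F j) (η j k))) (trigPoly S (derivCoef (c k)))) +
    (M (zerothCoef (F j) (firstCoef (F j) (η j k))) (trigPoly S (derivCoef (c k))) +
      M (firstCoef (F j) (firstCoef (F j) (η j k))) (trigPoly S (derivCoef (derivCoef (c k))))))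
  have hband : ∀ (v : Fin N → L2T) j, bandL (W j) (∑ i, bandAdj (W i) (v i)) = v j := by
    intro v j
    rw [map_sum]
    simp [bandL_bandAdj hW ho]
  refine ⟨∑ j, bandAdj (W j) (v j), ∑ j, bandAdj (W j) (w j), ?_, ?_, ?_, ?_⟩
  · rw [mem_conjugateGraph_iff hW]
    intro j
    rw [hband, bandL_apply]
    have := (bandGraph (F j)).sum_mem fun k (_ : k ∈ Finset.univ) =>
      (hadm j k).mem_bandGraph (hF j) (hFp j) S (c k)
    convert this using 1
    refine Prod.ext ?_ ?_
    · simp only [Prod.fst_sum, hηW, coordL_truncL]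
      rfl
    · rw [Prod.snd_sum]
  · rw [mem_conjugateGraph_iff hW]
    intro j
    rw [hband, hband]
    have := (bandGraph (F j)).sum_mem fun k (_ : k ∈ Finset.univ) => (bandGraph (F j)).add_mem
      (((hadm j k).zerothCoef (hF j) (hFp j)).mem_bandGraph (hF j) (hFp j) S (c k))
      (((hadm j k).firstCoef (hF j) (hFp j)).mem_bandGraph (hF j) (hFp j) S (derivCoef (c k)))
    convert this using 1
    refine Prod.ext ?_ ?_
    · rw [Prod.fst_sum]; rfl
    · rw [Prod.snd_sum]; rfl
  · rw [mul_assoc]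
    refine hbA v _ fun j => ?_
    refine (norm_sum_le _ _).trans ?_
    rw [Finset.sum_mul]
    refine Finset.sum_le_sum fun k _ => (norm_add_le _ _).trans ?_
    set q := ‖coordL (N := N) k‖ * ‖ψ‖ with hq
    have hq0 : 0 ≤ q := by positivity
    have hq1 : q ≤ b * q := by nlinarith
    calc _ ≤ ‖M (zerothCoef (F j) (η j k))‖ * (b * q) + ‖M (firstCoef (F j) (η j k))‖ * (b * q) :=
          add_le_add ((M _).le_opNorm_of_le ((hP0 k).trans hq1)) ((M _).le_opNorm_of_le (hP1 k))
      _ ≤ D j k * (b * q) := by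
          rw [← add_mul]
          refine mul_le_mul_of_nonneg_right ?_ (by positivity)
          simp only [D]
          exact le_add_of_nonneg_right (by positivity)
      _ = _ := by rw [hq]; ring
  · rw [mul_assoc]
    refine hbA w _ fun j => ?_
    refine (norm_sum_le _ _).trans ?_
    rw [Finset.sum_mul]
    refine Finset.sum_le_sum fun k _ => (norm_add_le _ _).trans ?_
    set q := ‖coordL (N := N) k‖ * ‖ψ‖ with hq
    have hq0 : 0 ≤ q := by positivity
    have hq1 : q ≤ b * q := by nlinarith
    have hq2 : b * q ≤ b * (b * q) := mul_le_mul_of_nonneg_left hq1 hb0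
    calc _ ≤ (‖M (zerothCoef (F j) (zerothCoef (F j) (η j k)))‖ * (b * (b * q)) +
          ‖M (firstCoef (F j) (zerothCoef (F j) (η j k)))‖ * (b * (b * q))) +
          (‖M (zerothCoef (F j) (firstCoef (F j) (η j k)))‖ * (b * (b * q)) +
          ‖M (firstCoef (F j) (firstCoef (F j) (η j k)))‖ * (b * (b * q))) :=
          add_le_add
            ((norm_add_le _ _).trans (add_le_add
              ((M _).le_opNorm_of_le ((hP0 k).trans (hq1.trans hq2)))
              ((M _).le_opNorm_of_le ((hP1 k).trans hq2))))
            ((norm_add_le _ _).trans (add_le_add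
              ((M _).le_opNorm_of_le ((hP1 k).trans hq2)) ((M _).le_opNorm_of_le (hP2 k))))
      _ ≤ D j k * (b * (b * q)) := by
          rw [← add_mul, ← add_mul, ← add_mul]
          refine mul_le_mul_of_nonneg_right ?_ (by positivity)
          simp only [D]
          rw [← add_assoc (‖_‖ + ‖_‖) ‖_‖ ‖_‖]
          exact le_add_of_nonneg_left (by positivity)
      _ = _ := by rw [hq]; ring

end Truncation

/-! ### Second differences of localised operators -/

section SecondDifference

variable {E : Type*} [NormedAddCommGroup E] [InnerProductSpace ℂ E]

local notation "⟪" x ", " y "⟫" => inner ℂ x y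

/-- `e^{-iAε} S e^{iAε} - 2 S + e^{iAε} S e^{-iAε}` -/
def secondDiff (U : ℝ → E →L[ℂ] E) (S : E →L[ℂ] E) (ε : ℝ) : E →L[ℂ] E :=
  U (-ε) * S * U ε - (2 : ℂ) • S + U ε * S * U (-ε)

variable {Γ : Submodule ℂ (E × E)} {U : ℝ → E →L[ℂ] E}

theorem IsUnitaryGroupOfGraph.hasDerivAt (hU : IsUnitaryGroupOfGraph Γ U) {u v : E}
    (h : (u, v) ∈ Γ) (t : ℝ) : HasDerivAt (fun s => U s u) (U t (Complex.I • v)) t := by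
  have h1 := (hU.generator u v).mp h
  have h2 : HasDerivAt (fun s => U s u) (Complex.I • v) (t - t) := by rwa [sub_self]
  have h3 := ((U t).restrictScalars ℝ).hasFDerivAt.comp_hasDerivAt t
    (h2.comp_sub_const t t)
  refine h3.congr_of_eventuallyEq (Eventually.of_forall fun s => ?_)
  change U s u = U t (U (s - t) u)
  rw [← mul_apply_eq_comp, ← hU.add, add_sub_cancel]

theorem IsUnitaryGroupOfGraph.norm_apply_sub_le (hU : IsUnitaryGroupOfGraph Γ U) {u v : E}
    (h : (u, v) ∈ Γ) (t : ℝ) : ‖U t u - u‖ ≤ ‖v‖ * |t| := by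
  have := norm_sub_le_of_hasDerivAt (t := t) (C := ‖v‖) (hU.hasDerivAt h) fun s _ => by
    rw [hU.isometry, norm_smul]; simp
  rwa [hU.zero] at this

/-- The derivative of the left side is `U s (iv) - iv`, itself at most `|s| ‖w‖` because `v` is
again in the domain. -/
theorem IsUnitaryGroupOfGraph.taylor (hU : IsUnitaryGroupOfGraph Γ U) {u v w : E}
    (h : (u, v) ∈ Γ) (h' : (v, w) ∈ Γ) (t : ℝ) :
    ‖U t u - u - t • (Complex.I • v)‖ ≤ t ^ 2 * ‖w‖ := by
  have hd : ∀ s, HasDerivAt (fun s => U s u - s • (Complex.I • v))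
      (U s (Complex.I • v) - (1 : ℝ) • (Complex.I • v)) s := fun s =>
    (hU.hasDerivAt h s).sub ((hasDerivAt_id s).smul_const _)
  have := norm_sub_le_of_hasDerivAt (t := t) (C := ‖w‖ * |t|) hd fun s hs => by
    rw [one_smul, map_smul, ← smul_sub, norm_smul, Complex.norm_I, one_mul]
    exact (hU.norm_apply_sub_le h' s).trans (mul_le_mul_of_nonneg_left hs (norm_nonneg _))
  simp only [hU.zero, zero_smul, sub_zero] at this
  rw [sub_right_comm] at this
  refine this.trans (le_of_eq ?_)
  rw [mul_assoc, ← sq, sq_abs, mul_comm]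

theorem IsUnitaryGroupOfGraph.unique (hU : IsUnitaryGroupOfGraph Γ U) {u v v' : E}
    (h : (u, v) ∈ Γ) (h' : (u, v') ∈ Γ) : v = v' :=
  smul_right_injective E Complex.I_ne_zero
    (((hU.generator u v).mp h).unique ((hU.generator u v').mp h'))

theorem IsUnitaryGroupOfGraph.norm_le (hU : IsUnitaryGroupOfGraph Γ U) (t : ℝ) : ‖U t‖ ≤ 1 :=
  ContinuousLinearMap.opNorm_le_bound _ zero_le_one fun ψ => by rw [hU.isometry, one_mul]

theorem IsUnitaryGroupOfGraph.norm_secondDiff_le (hU : IsUnitaryGroupOfGraph Γ U) (S : E →L[ℂ] E)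
    (ε : ℝ) : ‖secondDiff U S ε‖ ≤ 4 * ‖S‖ := by
  have h1 : ∀ s t, ‖U s * S * U t‖ ≤ ‖S‖ := fun s t => by
    refine (norm_mul_le _ _).trans ((mul_le_of_le_one_right (norm_nonneg _) (hU.norm_le t)).trans ?_)
    exact (norm_mul_le _ _).trans (mul_le_of_le_one_left (norm_nonneg _) (hU.norm_le s))
  refine (norm_add_le _ _).trans ?_
  have h2 := norm_sub_le (U (-ε) * S * U ε) ((2 : ℂ) • S)
  rw [norm_smul, Complex.norm_ofNat] at h2
  have h3 := h1 (-ε) ε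
  have h4 := h1 ε (-ε)
  linarith

variable [CompleteSpace E]

theorem IsUnitaryGroupOfGraph.adjoint (hU : IsUnitaryGroupOfGraph Γ U) (t : ℝ) :
    star (U t) = U (-t) := by
  rw [ContinuousLinearMap.star_eq_adjoint]
  refine ((ContinuousLinearMap.eq_adjoint_iff _ _).mpr fun x y => ?_).symm
  have h1 : x = U t (U (-t) x) := by
    rw [← mul_apply_eq_comp, ← hU.add, add_neg_cancel, hU.zero]; rfl
  conv_rhs => rw [h1]
  exact ((LinearMap.norm_map_iff_inner_map_map (U t)).mp (hU.isometry t) _ y).symm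

/-- The second difference of an operator localised in the domain of `A²`. -/
theorem IsUnitaryGroupOfGraph.norm_secondDiff_le_sq (hU : IsUnitaryGroupOfGraph Γ U)
    {Q S : E →L[ℂ] E} (hQ : IsSelfAdjoint Q) (hQ1 : ‖Q‖ ≤ 1) (hS : Q * S * Q = S) {K₁ K₂ : ℝ}
    (hK₁ : 0 ≤ K₁) (hK₂ : 0 ≤ K₂)
    (hdom : ∀ ψ, ∃ φ χ, (Q ψ, φ) ∈ Γ ∧ (φ, χ) ∈ Γ ∧ ‖φ‖ ≤ K₁ * ‖ψ‖ ∧ ‖χ‖ ≤ K₂ * ‖ψ‖) (ε : ℝ) :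
    ‖secondDiff U S ε‖ ≤ ε ^ 2 * (2 * K₁ ^ 2 + 2 * K₂ * (2 + |ε| * K₁)) * ‖S‖ := by
  choose b d hb hd hbn hdn using hdom
  -- `Γ` is single valued, so the chosen image of `Q ψ` depends linearly on `ψ`; thus `B` is the
  -- bounded operator `iAQ`.
  let B₀ : E →ₗ[ℂ] E :=
    { toFun := b
      map_add' := fun x y => hU.unique (hb (x + y)) (by
        rw [map_add]; exact Γ.add_mem (hb x) (hb y))
      map_smul' := fun c x => hU.unique (hb (c • x)) (by
        rw [map_smul]; exact Γ.smul_mem c (hb x)) }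
  let B : E →L[ℂ] E := Complex.I • B₀.mkContinuous K₁ hbn
  have hB : ‖B‖ ≤ K₁ := by
    rw [norm_smul, Complex.norm_I, one_mul]
    exact LinearMap.mkContinuous_norm_le _ hK₁ _
  -- `Y t` is the first order Taylor polynomial of `U t * Q`, and `R t` its remainder of size `t²`.
  let Y : ℝ → E →L[ℂ] E := fun t => Q + (t : ℂ) • B
  let R : ℝ → E →L[ℂ] E := fun t => U t * Q - Y t
  have hR : ∀ t, ‖R t‖ ≤ t ^ 2 * K₂ := fun t => by
    refine ContinuousLinearMap.opNorm_le_bound _ (by positivity) fun ψ => ?_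
    have e : R t ψ = U t (Q ψ) - Q ψ - t • (Complex.I • b ψ) := by
      rw [sub_sub, ← Complex.coe_smul]; rfl
    rw [e, mul_assoc]
    exact (hU.taylor (hb ψ) (hd ψ) t).trans (mul_le_mul_of_nonneg_left (hdn ψ) (sq_nonneg t))
  have hY : ∀ t, ‖Y t‖ ≤ 1 + |t| * K₁ := fun t => by
    refine (norm_add_le _ _).trans (add_le_add hQ1 ?_)
    rw [norm_smul, Complex.norm_real, Real.norm_eq_abs]
    exact mul_le_mul_of_nonneg_left hB (abs_nonneg t)
  have hX : ∀ t, ‖U t * Q‖ ≤ 1 := fun t =>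
    (norm_mul_le _ _).trans (mul_le_one₀ (hU.norm_le t) (norm_nonneg _) hQ1)
  have hconj : ∀ t, U t * S * U (-t) = (U t * Q) * S * star (U t * Q) := by
    intro t
    rw [star_mul, hU.adjoint, hQ.star_eq]
    conv_lhs => rw [← hS]
    simp only [mul_assoc]
  have hexp : ∀ t, (U t * Q) * S * star (U t * Q) =
      Y t * S * star (Y t) + (R t * S * star (U t * Q) + Y t * S * star (R t)) := by
    intro t
    simp only [R, star_sub]
    noncomm_ring
  -- The terms linear in `ε` cancel between `ε` and `-ε`, and the constant terms cancel because `Q S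
  -- Q = S`.
  have hYY : Y (-ε) * S * star (Y (-ε)) + Y ε * S * star (Y ε) - (2 : ℂ) • S =
      (2 * (ε : ℂ) ^ 2) • (B * S * star B) := by
    simp only [Y, star_add, star_smul, hQ.star_eq, Complex.ofReal_neg, Complex.star_def,
      Complex.conj_ofReal, map_neg]
    have hS2 : (2 : ℂ) • S = (2 : ℂ) • (Q * S * Q) := by rw [hS]
    rw [hS2]
    simp only [add_mul, mul_add, smul_mul_assoc, mul_smul_comm, neg_smul, neg_mul, mul_neg]
    module
  have herr : ∀ t, ‖R t * S * star (U t * Q) + Y t * S * star (R t)‖ ≤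
      t ^ 2 * K₂ * (2 + |t| * K₁) * ‖S‖ := by
    intro t
    refine (norm_add_le _ _).trans ?_
    have h1 : ‖R t * S * star (U t * Q)‖ ≤ (t ^ 2 * K₂) * ‖S‖ * 1 := by
      refine (norm_mul_le _ _).trans (mul_le_mul ?_ ?_ (norm_nonneg _) (by positivity))
      · exact (norm_mul_le _ _).trans (mul_le_mul_of_nonneg_right (hR t) (norm_nonneg _))
      · rw [norm_star]; exact hX t
    have h2 : ‖Y t * S * star (R t)‖ ≤ ((1 + |t| * K₁) * ‖S‖) * (t ^ 2 * K₂) := by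
      refine (norm_mul_le _ _).trans (mul_le_mul ?_ ?_ (norm_nonneg _) (by positivity))
      · exact (norm_mul_le _ _).trans (mul_le_mul_of_nonneg_right (hY t) (norm_nonneg _))
      · rw [norm_star]; exact hR t
    linarith
  have e : secondDiff U S ε = (2 * (ε : ℂ) ^ 2) • (B * S * star B) +
      (R (-ε) * S * star (U (-ε) * Q) + Y (-ε) * S * star (R (-ε))) +
      (R ε * S * star (U ε * Q) + Y ε * S * star (R ε)) := by
    have h1 := hconj (-ε)
    rw [neg_neg] at h1
    rw [secondDiff, h1, hconj ε, hexp, hexp, ← hYY]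
    abel
  have hmain : ‖(2 * (ε : ℂ) ^ 2) • (B * S * star B)‖ ≤ 2 * ε ^ 2 * (K₁ * ‖S‖ * K₁) := by
    rw [norm_smul]
    have : ‖(2 * (ε : ℂ) ^ 2)‖ = 2 * ε ^ 2 := by
      rw [norm_mul, norm_pow, Complex.norm_real, Real.norm_eq_abs, sq_abs]; simp
    rw [this]
    refine mul_le_mul_of_nonneg_left ?_ (by positivity)
    refine (norm_mul_le _ _).trans (mul_le_mul ?_ ?_ (norm_nonneg _) (by positivity))
    · exact (norm_mul_le _ _).trans (mul_le_mul_of_nonneg_right hB (norm_nonneg _))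
    · rw [norm_star]; exact hB
  rw [e]
  refine norm_add₃_le.trans ?_
  have h1 := herr ε
  have h2 := herr (-ε)
  rw [neg_sq, abs_neg] at h2
  linarith

end SecondDifference

/-! ### Schur and Hilbert-Schmidt bounds for rows in a window -/

section Schur

theorem tsum_mul_sq_le {ι : Type*} (f g : ι → ℝ≥0∞) :
    (∑' i, f i * g i) ^ 2 ≤ (∑' i, f i ^ 2) * ∑' i, g i ^ 2 := by
  let _ : MeasurableSpace ι := ⊤
  have h := ENNReal.lintegral_mul_le_Lp_mul_Lq (μ := Measure.count) Real.HolderConjugate.two_two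
    (f := f) (g := g) (measurable_from_top.aemeasurable) (measurable_from_top.aemeasurable)
  simp only [lintegral_count, Pi.mul_apply, ENNReal.rpow_two] at h
  have h2 := pow_le_pow_left₀ zero_le h 2
  rw [mul_pow, ← ENNReal.rpow_two, ← ENNReal.rpow_two (x := (∑' i, f i ^ 2) ^ (1 / 2 : ℝ)),
    ← ENNReal.rpow_two (x := (∑' i, g i ^ 2) ^ (1 / 2 : ℝ)), ← ENNReal.rpow_mul,
    ← ENNReal.rpow_mul] at h2
  norm_num at h2
  exact h2

/-- Cauchy-Schwarz after splitting `a = √a · √a`. -/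
theorem tsum_mul_sq_le_schur {ι : Type*} (a x : ι → ℝ≥0∞) :
    (∑' i, a i * x i) ^ 2 ≤ (∑' i, a i) * ∑' i, a i * x i ^ 2 := by
  have hs : ∀ i, (a i ^ (1 / 2 : ℝ)) ^ 2 = a i := fun i => by
    rw [← ENNReal.rpow_two, ← ENNReal.rpow_mul]; norm_num
  have h := tsum_mul_sq_le (fun i => a i ^ (1 / 2 : ℝ)) fun i => a i ^ (1 / 2 : ℝ) * x i
  simp only [mul_pow, hs, ← mul_assoc, ← sq] at h
  exact h

theorem sum_le_tsum_subtype {ι : Type*} {S : Finset ι} {s : Set ι} (h : ∀ i ∈ S, i ∈ s)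
    (f : ι → ℝ≥0∞) : ∑ i ∈ S, f i ≤ ∑' i : s, f i := by
  rw [tsum_subtype s f]
  refine le_trans (le_of_eq ?_) (ENNReal.sum_le_tsum S)
  exact Finset.sum_congr rfl fun i hi => (indicator_of_mem (h i hi) f).symm

variable {N : ℕ}

theorem enorm_sq_eq_tsum (ψ : Seq N) : ‖ψ‖ₑ ^ 2 = ∑' i, ‖ψ i‖ₑ ^ 2 := by
  have h := lp.hasSum_norm (p := 2) (by simp) ψ
  simp only [ENNReal.toReal_ofNat, Real.rpow_two] at h
  have e : ∀ {G : Type} [NormedAddCommGroup G] (x : G), ENNReal.ofReal (‖x‖ ^ 2) = ‖x‖ₑ ^ 2 :=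
    fun x => by rw [ENNReal.ofReal_pow (norm_nonneg _), ofReal_norm]
  rw [← e, ← h.tsum_eq, ENNReal.ofReal_tsum_of_nonneg (fun i => sq_nonneg _) h.summable]
  simp only [e]

theorem enorm_apply_le_tsum_block (V : Seq N →L[ℂ] Seq N) (ψ : Seq N) (i : ℤ) :
    ‖V ψ i‖ₑ ≤ ∑' j, ‖block V i j‖ₑ * ‖ψ j‖ₑ := by
  have h1 := lp.hasSum_single (p := 2) (by simp) ψ
  have h2 := ((lp.evalCLM ℂ (fun _ : ℤ => Fib N) 2 i) ∘L V).hasSum h1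
  have h3 : V ψ i = ∑' j, block V i j (ψ j) := h2.tsum_eq.symm
  rw [h3]
  exact (enorm_tsum_le_tsum_enorm).trans
    (ENNReal.tsum_le_tsum fun j => (block V i j).le_opENorm (ψ j))

theorem enorm_le_of_sq_le {V : Seq N →L[ℂ] Seq N} {c : ℝ≥0∞}
    (h : ∀ ψ, ‖V ψ‖ₑ ^ 2 ≤ c * ‖ψ‖ₑ ^ 2) : ‖V‖ₑ ≤ c ^ (1 / 2 : ℝ) := by
  by_cases hc : c = ⊤
  · rw [hc, ENNReal.top_rpow_of_pos (by norm_num)]; exact le_top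
  have hc' : c ^ (1 / 2 : ℝ) ≠ ⊤ := by simp [hc]
  rw [← ofReal_norm, ENNReal.ofReal_le_iff_le_toReal hc']
  refine ContinuousLinearMap.opNorm_le_bound _ ENNReal.toReal_nonneg fun ψ => ?_
  have h1 : ‖V ψ‖ₑ ≤ c ^ (1 / 2 : ℝ) * ‖ψ‖ₑ := by
    have h2 := ENNReal.rpow_le_rpow (h ψ) (show (0 : ℝ) ≤ 1 / 2 by norm_num)
    rw [ENNReal.mul_rpow_of_nonneg _ _ (by norm_num), ← ENNReal.rpow_two, ← ENNReal.rpow_two,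
      ← ENNReal.rpow_mul, ← ENNReal.rpow_mul] at h2
    norm_num at h2 ⊢
    exact h2
  have h3 := ENNReal.toReal_mono (ENNReal.mul_ne_top hc' enorm_ne_top) h1
  rwa [ENNReal.toReal_mul, toReal_enorm, toReal_enorm] at h3

theorem enorm_truncL_sq (S : Finset ℤ) (ψ : Seq N) :
    ‖truncL S ψ‖ₑ ^ 2 = ∑ i ∈ S, ‖ψ i‖ₑ ^ 2 := by
  rw [enorm_sq_eq_tsum, tsum_eq_sum (s := S)]
  · exact Finset.sum_congr rfl fun i hi => by rw [truncL_apply, if_pos hi]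
  · intro i hi
    rw [truncL_apply, if_neg hi]; simp

/-- The Schur test. -/
theorem enorm_truncL_mul_le_schur (V : Seq N →L[ℂ] Seq N) {S : Finset ℤ} {r : ℝ}
    (hS : ∀ i ∈ S, i ∈ window r) :
    ‖truncL S * V‖ₑ ≤ (schurQuantity V r) ^ (1 / 2 : ℝ) := by
  refine enorm_le_of_sq_le fun ψ => ?_
  rw [mul_apply_eq_comp, enorm_truncL_sq, schurQuantity]
  set R := ⨆ i ∈ window r, ∑' j : ℤ, ‖block V i j‖ₑ
  set C := ⨆ j : ℤ, ∑' i : window r, ‖block V i j‖ₑ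
  calc ∑ i ∈ S, ‖V ψ i‖ₑ ^ 2
      ≤ ∑ i ∈ S, R * ∑' j, ‖block V i j‖ₑ * ‖ψ j‖ₑ ^ 2 := by
        refine Finset.sum_le_sum fun i hi => ?_
        refine (pow_le_pow_left₀ zero_le (enorm_apply_le_tsum_block V ψ i) 2).trans ?_
        refine (tsum_mul_sq_le_schur _ _).trans ?_
        refine mul_le_mul_left ?_ _
        exact le_iSup₂ (f := fun i (_ : i ∈ window r) => ∑' j : ℤ, ‖block V i j‖ₑ) i (hS i hi)
    _ = R * ∑' j, (∑ i ∈ S, ‖block V i j‖ₑ) * ‖ψ j‖ₑ ^ 2 := by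
        rw [← Finset.mul_sum, ← Summable.tsum_finsetSum fun i _ => ENNReal.summable]
        simp only [Finset.sum_mul]
    _ ≤ R * ∑' j, C * ‖ψ j‖ₑ ^ 2 := by
        gcongr with j
        exact (sum_le_tsum_subtype hS fun i => ‖block V i j‖ₑ).trans
          (le_iSup (fun j : ℤ => ∑' i : window r, ‖block V i j‖ₑ) j)
    _ = R * C * ‖ψ‖ₑ ^ 2 := by rw [ENNReal.tsum_mul_left, enorm_sq_eq_tsum, mul_assoc]

/-- The Hilbert-Schmidt bound. -/
theorem enorm_truncL_mul_le_hilbertSchmidt (V : Seq N →L[ℂ] Seq N) {S : Finset ℤ} {r : ℝ}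
    (hS : ∀ i ∈ S, i ∈ window r) :
    ‖truncL S * V‖ₑ ≤ (hilbertSchmidtQuantity V r) ^ (1 / 2 : ℝ) := by
  refine enorm_le_of_sq_le fun ψ => ?_
  rw [mul_apply_eq_comp, enorm_truncL_sq, hilbertSchmidtQuantity]
  calc ∑ i ∈ S, ‖V ψ i‖ₑ ^ 2
      ≤ ∑ i ∈ S, (∑' j, ‖block V i j‖ₑ ^ 2) * ‖ψ‖ₑ ^ 2 := by
        refine Finset.sum_le_sum fun i hi => ?_
        refine (pow_le_pow_left₀ zero_le (enorm_apply_le_tsum_block V ψ i) 2).trans ?_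
        rw [enorm_sq_eq_tsum ψ]
        exact tsum_mul_sq_le _ _
    _ ≤ _ := by
        rw [← Finset.sum_mul]
        gcongr
        exact sum_le_tsum_subtype hS fun i => ∑' j, ‖block V i j‖ₑ ^ 2

end Schur

/-! ### Integrating the second difference of a series -/

section Integral

variable {E : Type*} [NormedAddCommGroup E] [InnerProductSpace ℂ E]

/-- The second difference as a bounded linear map. -/
def secondDiffL (U : ℝ → E →L[ℂ] E) (ε : ℝ) : (E →L[ℂ] E) →L[ℂ] (E →L[ℂ] E) :=
  (ContinuousLinearMap.mul ℂ (E →L[ℂ] E)).flip (U ε) ∘L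
      ContinuousLinearMap.mul ℂ (E →L[ℂ] E) (U (-ε)) -
    (2 : ℂ) • ContinuousLinearMap.id ℂ (E →L[ℂ] E) +
  (ContinuousLinearMap.mul ℂ (E →L[ℂ] E)).flip (U (-ε)) ∘L
      ContinuousLinearMap.mul ℂ (E →L[ℂ] E) (U ε)

theorem lintegral_cauchy_kernel_le {β : ℝ} (hβ : 0 < β) {c : ℝ} (hc : 0 ≤ c) :
    ∫⁻ ε : ℝ, ENNReal.ofReal (c * (β ^ 2 * (1 + (β * ε) ^ 2)⁻¹)) ≤
      ENNReal.ofReal (c * (β * Real.pi)) := by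
  have hi : Integrable fun ε : ℝ => c * (β ^ 2 * (1 + (β * ε) ^ 2)⁻¹) :=
    ((integrable_inv_one_add_sq.comp_mul_left' hβ.ne').const_mul _).const_mul _
  rw [← ofReal_integral_eq_lintegral_ofReal hi (Eventually.of_forall fun ε => by positivity)]
  refine ENNReal.ofReal_le_ofReal (le_of_eq ?_)
  rw [integral_const_mul, integral_const_mul,
    Measure.integral_comp_mul_left (fun x : ℝ => (1 + x ^ 2)⁻¹) β, integral_univ_inv_one_add_sq,
    abs_of_pos (inv_pos.mpr hβ), smul_eq_mul]
  field_simp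

/-- Since `min(1, x²) ≤ 2x²/(1 + x²)`, the two bounds merge into one smooth kernel in `x = β l ε`.
Divided by `ε²`, it integrates over the line to a multiple of `β l`. -/
theorem lintegral_secondDiff_lt_top {U : ℝ → E →L[ℂ] E} {V : E →L[ℂ] E} {T : ℕ → E →L[ℂ] E}
    (hV : HasSum T V) {β : ℕ → ℝ} (hβ : ∀ l, 0 < β l) (hsum : Summable fun l => β l * ‖T l‖)
    {D : ℝ} (hD : 0 ≤ D) (h1 : ∀ l ε, ‖secondDiff U (T l) ε‖ ≤ D * ‖T l‖)
    (h2 : ∀ l ε, |ε| * β l ≤ 1 → ‖secondDiff U (T l) ε‖ ≤ D * (ε * β l) ^ 2 * ‖T l‖) :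
    ∫⁻ ε in Ioo (0 : ℝ) 1, ENNReal.ofReal (‖secondDiff U V ε‖ / ε ^ 2) < ⊤ := by
  have hpt : ∀ ε ∈ Ioo (0 : ℝ) 1, ENNReal.ofReal (‖secondDiff U V ε‖ / ε ^ 2) ≤
      ∑' l, ENNReal.ofReal ((2 * D * ‖T l‖) * (β l ^ 2 * (1 + (β l * ε) ^ 2)⁻¹)) := by
    intro ε hε
    have hε2 : 0 < ε ^ 2 := by have := hε.1; positivity
    have h3 := (secondDiffL U ε).hasSum hV
    have h4 : secondDiff U V ε = ∑' l, secondDiff U (T l) ε := h3.tsum_eq.symm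
    rw [ENNReal.ofReal_div_of_pos hε2, ofReal_norm, h4]
    refine (ENNReal.div_le_div_right (enorm_tsum_le_tsum_enorm
      (f := fun l => secondDiff U (T l) ε)) _).trans ?_
    rw [div_eq_mul_inv, ← ENNReal.tsum_mul_right]
    refine ENNReal.tsum_le_tsum fun l => ?_
    rw [← div_eq_mul_inv, ← ofReal_norm, ← ENNReal.ofReal_div_of_pos hε2]
    refine ENNReal.ofReal_le_ofReal ?_
    rw [div_le_iff₀ hε2]
    have hpos : 0 < 1 + (β l * ε) ^ 2 := by positivity
    have e : (2 * D * ‖T l‖) * (β l ^ 2 * (1 + (β l * ε) ^ 2)⁻¹) * ε ^ 2 =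
        D * ‖T l‖ * (2 * (β l * ε) ^ 2 / (1 + (β l * ε) ^ 2)) := by
      field_simp
    rw [e]
    have hDT : 0 ≤ D * ‖T l‖ := by positivity
    by_cases hle : |ε| * β l ≤ 1
    · refine (h2 l ε hle).trans ?_
      have hsq : (β l * ε) ^ 2 ≤ 1 := by
        rw [abs_of_pos hε.1] at hle
        have : 0 ≤ β l * ε := mul_nonneg (hβ l).le hε.1.le
        nlinarith
      rw [show D * (ε * β l) ^ 2 * ‖T l‖ = D * ‖T l‖ * (β l * ε) ^ 2 by ring]
      refine mul_le_mul_of_nonneg_left ?_ hDT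
      rw [le_div_iff₀ hpos]
      nlinarith [sq_nonneg (β l * ε)]
    · refine (h1 l ε).trans (le_mul_of_one_le_right hDT ?_)
      rw [one_le_div hpos]
      rw [abs_of_pos hε.1, not_le] at hle
      nlinarith
  have hfin : ∑' l, ENNReal.ofReal ((2 * D * ‖T l‖) * (β l * Real.pi)) < ⊤ := by
    have hs : Summable fun l => (2 * D * ‖T l‖) * (β l * Real.pi) := by
      refine (hsum.mul_left (2 * D * Real.pi)).congr fun l => ?_
      ring
    rw [← ENNReal.ofReal_tsum_of_nonneg (fun l => by have := (hβ l).le; have := Real.pi_pos.le; positivity) hs]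
    exact ENNReal.ofReal_lt_top
  refine lt_of_le_of_lt ?_ hfin
  calc ∫⁻ ε in Ioo (0 : ℝ) 1, ENNReal.ofReal (‖secondDiff U V ε‖ / ε ^ 2)
      ≤ ∫⁻ ε in Ioo (0 : ℝ) 1,
          ∑' l, ENNReal.ofReal ((2 * D * ‖T l‖) * (β l ^ 2 * (1 + (β l * ε) ^ 2)⁻¹)) :=
        setLIntegral_mono' measurableSet_Ioo hpt
    _ ≤ ∫⁻ ε : ℝ, ∑' l, ENNReal.ofReal ((2 * D * ‖T l‖) * (β l ^ 2 * (1 + (β l * ε) ^ 2)⁻¹)) :=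
        setLIntegral_le_lintegral _ _
    _ = ∑' l, ∫⁻ ε : ℝ,
          ENNReal.ofReal ((2 * D * ‖T l‖) * (β l ^ 2 * (1 + (β l * ε) ^ 2)⁻¹)) :=
        lintegral_tsum fun l => by fun_prop
    _ ≤ _ := ENNReal.tsum_le_tsum fun l => lintegral_cauchy_kernel_le (hβ l) (by positivity)

end Integral

/-! ### Decomposition of `V` into layers of geometrically growing radius -/

section Dyadic

variable {N : ℕ}

/-- The integers of absolute value less than `b`. -/
def intBall (b : ℝ) : Finset ℤ := (Finset.Icc (-⌈b⌉) ⌈b⌉).filter fun i => |(i : ℝ)| < b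

theorem mem_intBall {b : ℝ} {i : ℤ} : i ∈ intBall b ↔ |(i : ℝ)| < b := by
  rw [intBall, Finset.mem_filter, Finset.mem_Icc, and_iff_right_iff_imp]
  intro h
  rw [abs_lt] at h
  constructor
  · have h1 : (-(⌈b⌉ : ℝ)) ≤ i := by linarith [Int.le_ceil b]
    exact_mod_cast h1
  · have h1 : (i : ℝ) ≤ ⌈b⌉ := by linarith [Int.le_ceil b]
    exact_mod_cast h1

theorem intBall_mono {b b' : ℝ} (h : b ≤ b') : intBall b ⊆ intBall b' := fun _ hi =>
  mem_intBall.mpr ((mem_intBall.mp hi).trans_le h)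

/-- The radii of the blocks. -/
def radius (l : ℕ) : ℝ := (3 / 2) ^ l

theorem one_le_radius (l : ℕ) : 1 ≤ radius l := one_le_pow₀ (by norm_num)

theorem radius_succ (l : ℕ) : radius (l + 1) = 3 / 2 * radius l := by
  rw [radius, pow_succ, mul_comm]; rfl

theorem radius_mono : Monotone radius := pow_right_mono₀ (by norm_num)

/-- The truncation of `V` to `[-radius l, radius l]`. -/
def truncated (V : Seq N →L[ℂ] Seq N) (l : ℕ) : Seq N →L[ℂ] Seq N :=
  truncL (intBall (radius l)) * V * truncL (intBall (radius l))

/-- The differences of consecutive truncations. -/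
def layer (V : Seq N →L[ℂ] Seq N) : ℕ → Seq N →L[ℂ] Seq N
  | 0 => truncated V 1
  | l + 1 => truncated V (l + 2) - truncated V (l + 1)

theorem sum_layer (V : Seq N →L[ℂ] Seq N) (n : ℕ) :
    ∑ l ∈ Finset.range (n + 1), layer V l = truncated V (n + 1) := by
  induction n with
  | zero => simp [layer]
  | succ n ih => rw [Finset.sum_range_succ, ih, layer]; abel

theorem truncL_mul_truncL (S T : Finset ℤ) :
    (truncL S * truncL T : Seq N →L[ℂ] Seq N) = truncL (S ∩ T) := by
  ext1 ψ
  exact truncL_truncL S T ψ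

theorem truncL_mul_truncated_mul (V : Seq N →L[ℂ] Seq N) {l m : ℕ} (h : l ≤ m) :
    truncL (intBall (radius m)) * truncated V l * truncL (intBall (radius m)) = truncated V l := by
  have hs := intBall_mono (radius_mono h)
  have h1 : (truncL (intBall (radius m)) * truncL (intBall (radius l)) : Seq N →L[ℂ] Seq N) =
      truncL (intBall (radius l)) := by
    rw [truncL_mul_truncL, Finset.inter_eq_right.mpr hs]
  have h2 : (truncL (intBall (radius l)) * truncL (intBall (radius m)) : Seq N →L[ℂ] Seq N) =
      truncL (intBall (radius l)) := by
    rw [truncL_mul_truncL, Finset.inter_eq_left.mpr hs]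
  rw [truncated]
  simp only [mul_assoc]
  rw [h2, ← mul_assoc, h1]

theorem truncL_mul_layer_mul (V : Seq N →L[ℂ] Seq N) (l : ℕ) :
    truncL (intBall (radius (l + 1))) * layer V l * truncL (intBall (radius (l + 1))) =
      layer V l := by
  cases l with
  | zero => exact truncL_mul_truncated_mul V le_rfl
  | succ l =>
    rw [layer, mul_sub, sub_mul, truncL_mul_truncated_mul V le_rfl,
      truncL_mul_truncated_mul V (Nat.le_succ _)]

/-- The indices between two consecutive radii. -/
def shell (l : ℕ) : Finset ℤ := intBall (radius (l + 1)) \ intBall (radius l)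

theorem truncL_isSelfAdjoint (S : Finset ℤ) : IsSelfAdjoint (truncL S : Seq N →L[ℂ] Seq N) := by
  rw [ContinuousLinearMap.isSelfAdjoint_iff_isSymmetric]
  exact truncL_isSymmetric S

/-- For projections `P ≤ P'`, `P'VP' - PVP = (P' - P)VP' + PV(P' - P)`. Self-adjointness of `V`
reduces the columns in the second term to rows. -/
theorem norm_layer_succ_le {V : Seq N →L[ℂ] Seq N} (hV : IsSelfAdjoint V) (l : ℕ) :
    ‖layer V (l + 1)‖ ≤ 2 * ‖truncL (shell (l + 1)) * V‖ := by
  have h1 : (truncL (shell (l + 1)) : Seq N →L[ℂ] Seq N) =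
      truncL (intBall (radius (l + 2))) - truncL (intBall (radius (l + 1))) := by
    ext1 ψ
    ext1
    funext n
    have hs : n ∈ intBall (radius (l + 1)) → n ∈ intBall (radius (l + 2)) :=
      fun h => intBall_mono (radius_mono (Nat.le_succ _)) h
    change truncL _ ψ n = truncL _ ψ n - truncL _ ψ n
    simp only [truncL_apply, shell, Finset.mem_sdiff]
    by_cases h : n ∈ intBall (radius (l + 1))
    · simp [h, hs h]
    · simp [h]
  have h2 : layer V (l + 1) = truncL (shell (l + 1)) * V * truncL (intBall (radius (l + 2))) +
      truncL (intBall (radius (l + 1))) * (V * truncL (shell (l + 1))) := by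
    rw [layer, h1, truncated, truncated]
    noncomm_ring
  have h3 : ‖V * truncL (shell (l + 1))‖ = ‖truncL (shell (l + 1)) * V‖ := by
    rw [← norm_star, star_mul, hV.star_eq, (truncL_isSelfAdjoint _).star_eq]
  rw [h2]
  refine (norm_add_le _ _).trans ?_
  have h4 : ‖truncL (shell (l + 1)) * V * truncL (intBall (radius (l + 2)))‖ ≤
      ‖truncL (shell (l + 1)) * V‖ :=
    (norm_mul_le _ _).trans (mul_le_of_le_one_right (norm_nonneg _) (norm_truncL_le _))
  have h5 : ‖truncL (intBall (radius (l + 1))) * (V * truncL (shell (l + 1)))‖ ≤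
      ‖truncL (shell (l + 1)) * V‖ := by
    rw [← h3]
    exact (norm_mul_le _ _).trans (mul_le_of_le_one_left (norm_nonneg _) (norm_truncL_le _))
  linarith

theorem tendsto_truncL (ψ : Seq N) :
    Tendsto (fun l => truncL (intBall (radius l)) ψ) atTop (𝓝 ψ) := by
  have h1 := lp.hasSum_single (p := 2) (by simp) ψ
  have h2 : Tendsto (fun l => intBall (radius l)) atTop atTop := by
    refine tendsto_atTop_finset_of_monotone (fun l m h => intBall_mono (radius_mono h)) fun i => ?_
    obtain ⟨n, hn⟩ := pow_unbounded_of_one_lt |(i : ℝ)| (show (1 : ℝ) < 3 / 2 by norm_num)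
    exact ⟨n, mem_intBall.mpr hn⟩
  refine (h1.comp h2).congr fun l => ?_
  rw [truncL_eq_sum]; rfl

/-- The series converges in norm; its sum is identified through the strong convergence of the
truncations to `V`. -/
theorem hasSum_layer (V : Seq N →L[ℂ] Seq N) (hs : Summable fun l => ‖layer V l‖) :
    HasSum (layer V) V := by
  have h1 := hs.of_norm
  have h2 : ∑' l, layer V l = V := by
    ext1 ψ
    have h3 := (tendsto_add_atTop_iff_nat 1).mpr h1.hasSum.tendsto_sum_nat
    have h4 : Tendsto (fun n => (∑ l ∈ Finset.range (n + 1), layer V l) ψ) atTop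
        (𝓝 ((∑' l, layer V l) ψ)) :=
      ((ContinuousLinearMap.apply ℂ (Seq N) ψ).continuous.tendsto _).comp h3
    refine tendsto_nhds_unique h4 ?_
    simp only [sum_layer]
    have h5 : Tendsto (fun n => truncL (intBall (radius n)) (V (truncL (intBall (radius n)) ψ)))
        atTop (𝓝 (V ψ)) := by
      have h6 : Tendsto (fun n => truncL (intBall (radius n))
          (V (truncL (intBall (radius n)) ψ - ψ))) atTop (𝓝 0) := by
        have h7 : Tendsto (fun n => ‖V (truncL (intBall (radius n)) ψ - ψ)‖) atTop (𝓝 0) := by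
          have := (V.continuous.tendsto _).comp (tendsto_sub_nhds_zero_iff.mpr (tendsto_truncL ψ))
          rw [map_zero] at this
          exact tendsto_zero_iff_norm_tendsto_zero.mp this
        exact squeeze_zero_norm (fun n => norm_truncL_apply_le _ _) h7
      have h8 := h6.add (tendsto_truncL (V ψ))
      rw [zero_add] at h8
      refine h8.congr fun n => ?_
      rw [← map_add, ← map_add, sub_add_cancel]
    exact (tendsto_add_atTop_iff_nat 1).mpr h5
  have h3 := h1.hasSum
  rwa [h2] at h3

/-- The interval of the `r` whose window contains the shell `l`. -/
def shellInterval (l : ℕ) : Set ℝ := Ioc (3 / 4 * radius l) (radius l)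

/-- A shell has outer radius `3/2` times the inner one, whereas a window has ratio 2. This slack
leaves room for all `r` with `(3/4) radius l < r ≤ radius l`; shells of ratio 2 would leave a single
`r`. -/
theorem mem_window_of_mem_shell {l : ℕ} {r : ℝ} (hr : r ∈ shellInterval l) {i : ℤ}
    (hi : i ∈ shell l) : i ∈ window r := by
  rw [shell, Finset.mem_sdiff, mem_intBall, mem_intBall, not_lt, radius_succ] at hi
  exact ⟨hr.2.trans hi.2, by linarith [hr.1, hi.1]⟩

theorem summable_radius_mul_layer {V : Seq N →L[ℂ] Seq N} (hV : IsSelfAdjoint V) {q : ℝ → ℝ≥0∞}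
    (hq : ∀ r, ∀ S : Finset ℤ, (∀ i ∈ S, i ∈ window r) → ‖truncL S * V‖ₑ ≤ q r)
    (hfin : ∫⁻ r in Ioi (1 : ℝ), q r < ⊤) :
    Summable fun l => radius (l + 1) * ‖layer V l‖ := by
  -- The factor `radius (l + 1) / 4` is the length of the shell interval, on which `q` dominates a
  -- constant.
  have hint : ∀ l, ENNReal.ofReal (radius (l + 1) / 4 * ‖truncL (shell (l + 1)) * V‖) ≤
      ∫⁻ r in shellInterval (l + 1), q r := by
    intro l
    have hr := one_le_radius (l + 1)
    calc ENNReal.ofReal (radius (l + 1) / 4 * ‖truncL (shell (l + 1)) * V‖)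
        = ∫⁻ _ in shellInterval (l + 1), ‖truncL (shell (l + 1)) * V‖ₑ := by
          rw [setLIntegral_const, shellInterval, Real.volume_Ioc, mul_comm,
            ENNReal.ofReal_mul (norm_nonneg _), ofReal_norm]
          congr 2
          ring
      _ ≤ _ := setLIntegral_mono' measurableSet_Ioc fun r hr =>
          hq r _ fun i hi => mem_window_of_mem_shell hr hi
  have hdisj : Pairwise (Function.onFun Disjoint fun l => shellInterval (l + 1)) := by
    have aux : ∀ l m, l < m → Disjoint (shellInterval (l + 1)) (shellInterval (m + 1)) := by
      intro l m h
      rw [Set.disjoint_left]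
      intro r h1 h2
      have h3 := radius_mono (show l + 1 + 1 ≤ m + 1 by omega)
      rw [radius_succ] at h3
      have := one_le_radius (l + 1)
      linarith [h1.2, h2.1]
    intro l m h
    rcases lt_or_gt_of_ne h with h | h
    · exact aux l m h
    · exact (aux m l h).symm
  -- The first interval used starts at `3/4 · 3/2 = 9/8`; the one of index `0` would leave the range
  -- of integration, which is why layer `0` is the whole truncation at `radius 1`.
  have hsub : (⋃ l, shellInterval (l + 1)) ⊆ Ioi 1 := by
    refine iUnion_subset fun l r hr => ?_
    have h1 := one_le_radius l
    have h2 := radius_succ l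
    have h3 := hr.1
    rw [mem_Ioi]
    linarith
  have htot : ∑' l, ENNReal.ofReal (radius (l + 1) / 4 * ‖truncL (shell (l + 1)) * V‖) ≠ ⊤ := by
    refine ((ENNReal.tsum_le_tsum hint).trans ?_).trans_lt hfin |>.ne
    rw [← lintegral_iUnion (s := fun l => shellInterval (l + 1)) (fun l => measurableSet_Ioc) hdisj]
    exact lintegral_mono_set hsub
  have hs : Summable fun l => radius (l + 1) / 4 * ‖truncL (shell (l + 1)) * V‖ := by
    have h1 := ENNReal.summable_toReal htot
    refine h1.congr fun l => ENNReal.toReal_ofReal ?_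
    have := one_le_radius (l + 1)
    positivity
  refine (summable_nat_add_iff 1).mp ?_
  -- `12 = 3/2 · 2 · 4`: ratio of radii, rows and columns, inverse relative length of the interval.
  refine Summable.of_nonneg_of_le (fun l => ?_) (fun l => ?_) (hs.mul_left 12)
  · have := one_le_radius (l + 1 + 1)
    positivity
  · rw [radius_succ (l + 1)]
    have h1 := norm_layer_succ_le hV l
    have := one_le_radius (l + 1)
    nlinarith [mul_le_mul_of_nonneg_left h1 (show 0 ≤ radius (l + 1) by linarith)]

theorem lintegral_secondDiff_lt_top_of_window {Γ : Submodule ℂ (Seq N × Seq N)}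
    {U : ℝ → Seq N →L[ℂ] Seq N} (hU : IsUnitaryGroupOfGraph Γ U)
    (hdom : ∃ C : ℝ, 0 ≤ C ∧ ∀ b : ℝ, 1 ≤ b → ∀ S : Finset ℤ, (∀ n ∈ S, |(n : ℝ)| ≤ b) →
      ∀ ψ : Seq N, ∃ φ χ, (truncL S ψ, φ) ∈ Γ ∧ (φ, χ) ∈ Γ ∧
        ‖φ‖ ≤ C * b * ‖ψ‖ ∧ ‖χ‖ ≤ C * b ^ 2 * ‖ψ‖)
    {V : Seq N →L[ℂ] Seq N} (hV : IsSelfAdjoint V) {q : ℝ → ℝ≥0∞}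
    (hq : ∀ r, ∀ S : Finset ℤ, (∀ i ∈ S, i ∈ window r) → ‖truncL S * V‖ₑ ≤ q r)
    (hfin : ∫⁻ r in Ioi (1 : ℝ), q r < ⊤) :
    ∫⁻ ε in Ioo (0 : ℝ) 1, ENNReal.ofReal (‖secondDiff U V ε‖ / ε ^ 2) < ⊤ := by
  obtain ⟨C, hC, hdom⟩ := hdom
  have hsum := summable_radius_mul_layer hV hq hfin
  have hpos : ∀ l, 0 < radius (l + 1) := fun l => by linarith [one_le_radius (l + 1)]
  have hs : Summable fun l => ‖layer V l‖ := by
    refine Summable.of_nonneg_of_le (fun l => norm_nonneg _) (fun l => ?_) hsum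
    exact le_mul_of_one_le_left (norm_nonneg _) (one_le_radius _)
  -- `4` is the trivial bound. For `|ε| radius (l + 1) ≤ 1`, inserting `K₁ = C radius (l + 1)` and
  -- `K₂ = C radius (l + 1)²` in the quadratic bound gives `4C² + 4C`. The sum serves both regimes.
  refine lintegral_secondDiff_lt_top (hasSum_layer V hs) hpos hsum
    (D := 4 + (4 * C ^ 2 + 4 * C)) (by positivity) (fun l ε => ?_) fun l ε hε => ?_
  · refine (hU.norm_secondDiff_le (layer V l) ε).trans ?_
    refine mul_le_mul_of_nonneg_right ?_ (norm_nonneg _)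
    have : 0 ≤ 4 * C ^ 2 + 4 * C := by positivity
    linarith
  · have h1 := hU.norm_secondDiff_le_sq (truncL_isSelfAdjoint _) (norm_truncL_le _)
      (truncL_mul_layer_mul V l) (K₁ := C * radius (l + 1)) (K₂ := C * radius (l + 1) ^ 2)
      (mul_nonneg hC (hpos l).le) (mul_nonneg hC (sq_nonneg _))
      (hdom (radius (l + 1)) (one_le_radius _) _ fun n hn => (mem_intBall.mp hn).le) ε
    refine h1.trans (mul_le_mul_of_nonneg_right ?_ (norm_nonneg _))
    have h2 : |ε| * (C * radius (l + 1)) ≤ C := by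
      calc |ε| * (C * radius (l + 1)) = C * (|ε| * radius (l + 1)) := by ring
        _ ≤ C * 1 := mul_le_mul_of_nonneg_left hε hC
        _ = C := mul_one C
    have h3 : 0 ≤ ε ^ 2 * (2 * (C * radius (l + 1) ^ 2)) := by positivity
    nlinarith [mul_le_mul_of_nonneg_left h2 h3, mul_nonneg (sq_nonneg ε) (sq_nonneg (radius (l + 1)))]

end Dyadic

/-! ### Smoothness of the vector field and the jump at `±π` -/

section VectorField

theorem contDiff_of_periodic {B : Type*} [NormedAddCommGroup B] [NormedSpace ℝ B] {f : ℝ → B}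
    (hp : Function.Periodic f (2 * Real.pi))
    (h : ∀ x ∈ Ico (-Real.pi) Real.pi, ContDiffAt ℝ ∞ f x) : ContDiff ℝ ∞ f := by
  rw [contDiff_iff_contDiffAt]
  intro x
  have hmem := toIcoMod_mem_Ico Real.two_pi_pos (-Real.pi) x
  rw [neg_pi_add_two_pi, toIcoMod] at hmem
  set n := toIcoDiv Real.two_pi_pos (-Real.pi) x
  have h1 := h _ hmem
  have h2 : f = fun y => f (y - n • (2 * Real.pi)) := by
    funext y
    exact (hp.sub_zsmul_eq n).symm
  rw [h2]
  exact ContDiffAt.comp x h1 (contDiffAt_id.sub contDiffAt_const)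

theorem periodic_coe {B : Type*} (u : Torus → B) :
    Function.Periodic (fun x : ℝ => u (x : Torus)) (2 * Real.pi) := fun x => by
  dsimp only
  rw [AddCircle.coe_add_period]

theorem vectorField_periodic (ζ : ℝ → ℝ) (l : Torus → ℝ) :
    Function.Periodic (vectorField ζ l) (2 * Real.pi) := fun x => by
  have h1 := periodic_coe l x
  have h2 := periodic_deriv_real (periodic_coe l) x
  dsimp only at h1
  rw [vectorField, vectorField, h1, h2]

theorem eventuallyEq_of_piecewise {B : Type*} {u : Torus → B} {g : ℝ → B}
    (h : ∀ x ∈ Ico (-Real.pi) Real.pi, u (x : Torus) = g x) {x : ℝ}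
    (hx : x ∈ Ioo (-Real.pi) Real.pi) : (fun x : ℝ => u (x : Torus)) =ᶠ[𝓝 x] g := by
  filter_upwards [Ioo_mem_nhds hx.1 hx.2] with y hy
  exact h y (Ioo_subset_Ico_self hy)

variable {N : ℕ} {ζ : ℝ → ℝ} {a b : ℝ} {l : Torus → ℝ} {w : Torus → Fib N}

theorem vectorField_eventuallyEq_zero (hζ : Function.support ζ ⊆ Icc a b) {f : Filter ℝ}
    {c : ℝ} (hc : c ∉ Icc a b) (h : Tendsto (fun x : ℝ => l (x : Torus)) f (𝓝 c)) :
    ∀ᶠ x in f, vectorField ζ l x = 0 := by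
  filter_upwards [h (isClosed_Icc.isOpen_compl.mem_nhds hc)] with y hy
  have : ζ (l (y : Torus)) = 0 := by
    by_contra h0
    exact hy (hζ h0)
  rw [vectorField, this, zero_mul]

/-- The one-sided limits of `l` at `-π` are `g π`, by periodicity, and `g (-π)`. Both are singular
values, hence outside `[a, b]`, so `ζ ∘ l` vanishes on each side. -/
theorem vectorField_eventuallyEq_zero_of_singular (hζ : Function.support ζ ⊆ Icc a b)
    (hs : ∀ c ∈ Icc a b, c ∉ singularValues l w) {g : ℝ → ℝ} (hg : Continuous g)
    (hgl : ∀ x ∈ Ico (-Real.pi) Real.pi, l (x : Torus) = g x)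
    (hreg : ¬ RegularAt l w (-Real.pi)) : vectorField ζ l =ᶠ[𝓝 (-Real.pi)] 0 := by
  have hpi := Real.pi_pos
  have hleft : Tendsto (fun x : ℝ => l (x : Torus)) (𝓝[<] (-Real.pi)) (𝓝 (g Real.pi)) := by
    have h1 : Tendsto (fun x => g (x + 2 * Real.pi)) (𝓝[<] (-Real.pi)) (𝓝 (g Real.pi)) := by
      have h2 : Continuous fun x => g (x + 2 * Real.pi) := hg.comp (continuous_add_const _)
      have h3 := h2.tendsto (-Real.pi)
      rw [neg_pi_add_two_pi] at h3
      exact h3.mono_left nhdsWithin_le_nhds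
    refine h1.congr' ?_
    filter_upwards [Ioo_mem_nhdsLT (show -Real.pi - 1 < -Real.pi by linarith)] with x hx
    rw [← hgl _ ⟨by have := Real.pi_gt_three; linarith [hx.1], by linarith [hx.2]⟩]
    exact periodic_coe l x
  have hright : Tendsto (fun x : ℝ => l (x : Torus)) (𝓝[≥] (-Real.pi)) (𝓝 (g (-Real.pi))) := by
    refine ((hg.tendsto _).mono_left nhdsWithin_le_nhds).congr' ?_
    filter_upwards [Ico_mem_nhdsGE (show -Real.pi < Real.pi by linarith)] with x hx
    exact (hgl x hx).symm
  have h1 : g Real.pi ∉ Icc a b := fun h => hs _ h ⟨-Real.pi, hreg, Or.inl hleft⟩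
  have h2 : g (-Real.pi) ∉ Icc a b := fun h => hs _ h ⟨-Real.pi, hreg, Or.inr hright⟩
  rw [EventuallyEq, ← nhdsLT_sup_nhdsGE, eventually_sup]
  exact ⟨vectorField_eventuallyEq_zero hζ h1 hleft,
    vectorField_eventuallyEq_zero hζ h2 hright⟩

/-- Where `l ∈ [a, b]` the derivative `l'` is nonzero and the quotient is smooth; elsewhere the
field vanishes in a neighbourhood. -/
theorem contDiffAt_vectorField (hζ : Function.support ζ ⊆ Icc a b) (hζs : ContDiff ℝ ∞ ζ)
    {x : ℝ} (hl : ContDiffAt ℝ ∞ (fun x : ℝ => l (x : Torus)) x)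
    (hc : l (x : Torus) ∈ Icc a b → ¬ HasDerivAt (fun x : ℝ => l (x : Torus)) 0 x) :
    ContDiffAt ℝ ∞ (vectorField ζ l) x := by
  by_cases h : l (x : Torus) ∈ Icc a b
  · have hd : deriv (fun x : ℝ => l (x : Torus)) x ≠ 0 := fun h0 =>
      hc h (h0 ▸ (hl.differentiableAt (by simp)).hasDerivAt)
    have hd' : ContDiffAt ℝ ∞ (deriv fun x : ℝ => l (x : Torus)) x := by
      have h1 := hl.fderiv_right (m := ∞) (by simp)
      exact h1.clm_apply contDiffAt_const
    have e : vectorField ζ l = fun x : ℝ => ζ (l (x : Torus)) *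
        (deriv (fun y : ℝ => l (y : Torus)) x / deriv (fun y : ℝ => l (y : Torus)) x ^ 2) := by
      funext y
      rw [vectorField, sq_abs]
    rw [e]
    exact (hζs.contDiffAt.comp x hl).mul (hd'.div (hd'.pow 2) (pow_ne_zero 2 hd))
  · have h0 := vectorField_eventuallyEq_zero hζ h hl.continuousAt
    exact (contDiffAt_const (c := (0 : ℝ))).congr_of_eventuallyEq h0

/-- Only `-π` (mod `2π`) can be singular. If it is regular, `w` itself is smooth and periodic; if
not, the field vanishes there and the given smooth extension of `w` from `[-π, π)` serves. -/
theorem exists_admissible_extension (hζ : Function.support ζ ⊆ Icc a b) (hζs : ContDiff ℝ ∞ ζ)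
    (hs : ∀ c ∈ Icc a b, c ∉ singularValues l w)
    (hc : ∀ x : ℝ, l (x : Torus) ∈ Icc a b → ¬ HasDerivAt (fun x : ℝ => l (x : Torus)) 0 x)
    (hl : ∃ g : ℝ → ℝ, ContDiff ℝ ∞ g ∧ ∀ x ∈ Ico (-Real.pi) Real.pi, l (x : Torus) = g x)
    (hw : ∃ g : ℝ → Fib N, ContDiff ℝ ∞ g ∧
      ∀ x ∈ Ico (-Real.pi) Real.pi, w (x : Torus) = g x) :
    ContDiff ℝ ∞ (vectorField ζ l) ∧ ∃ g : ℝ → Fib N, ContDiff ℝ ∞ g ∧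
      (∀ x ∈ Ico (-Real.pi) Real.pi, w (x : Torus) = g x) ∧
      (vectorField ζ l Real.pi = 0 ∨ Function.Periodic g (2 * Real.pi)) := by
  obtain ⟨gl, hgl, hgle⟩ := hl
  obtain ⟨gw, hgw, hgwe⟩ := hw
  have hint : ∀ x ∈ Ioo (-Real.pi) Real.pi, RegularAt l w x := fun x hx =>
    ⟨hgl.contDiffAt.congr_of_eventuallyEq (eventuallyEq_of_piecewise hgle hx),
      hgw.contDiffAt.congr_of_eventuallyEq (eventuallyEq_of_piecewise hgwe hx)⟩
  by_cases hreg : RegularAt l w (-Real.pi)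
  · have hall : ∀ x ∈ Ico (-Real.pi) Real.pi, RegularAt l w x := by
      intro x hx
      rcases eq_or_lt_of_le hx.1 with h | h
      · exact h ▸ hreg
      · exact hint x ⟨h, hx.2⟩
    exact ⟨contDiff_of_periodic (vectorField_periodic ζ l) fun x hx =>
        contDiffAt_vectorField hζ hζs (hall x hx).1 (hc x),
      fun x => w (x : Torus), contDiff_of_periodic (periodic_coe w) fun x hx => (hall x hx).2,
      fun x _ => rfl, Or.inr (periodic_coe w)⟩
  · have h0 := vectorField_eventuallyEq_zero_of_singular hζ hs hgl.continuous hgle hreg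
    refine ⟨contDiff_of_periodic (vectorField_periodic ζ l) fun x hx => ?_, gw, hgw, hgwe,
      Or.inl ?_⟩
    · rcases eq_or_lt_of_le hx.1 with h | h
      · rw [← h]
        exact (contDiffAt_const (c := (0 : ℝ))).congr_of_eventuallyEq h0
      · exact contDiffAt_vectorField hζ hζs (hint x ⟨h, hx.2⟩).1 (hc x)
    · have h1 := vectorField_periodic ζ l (-Real.pi)
      rw [neg_pi_add_two_pi] at h1
      rw [h1]
      exact h0.self_of_nhds

theorem contDiff_conj_apply {g : ℝ → Fib N} (hg : ContDiff ℝ ∞ g) (k : Fin N) :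
    ContDiff ℝ ∞ fun x => (starRingEnd ℂ) (g x k) :=
  Complex.conjCLE.contDiff.comp
    (((EuclideanSpace.proj k : Fib N →L[ℂ] ℂ).restrictScalars ℝ).contDiff.comp hg)

theorem continuous_coord {g : ℝ → Fib N} (hg : ContDiff ℝ ∞ g) (k : Fin N) :
    Continuous fun x => g x k :=
  (EuclideanSpace.proj k : Fib N →L[ℂ] ℂ).continuous.comp hg.continuous

/-- Both criteria use only a function `q` that dominates the rows of `V` in each window and is
integrable on `(1, ∞)`. -/
theorem isOfClassC11_of_window {lam : Fin N → Torus → ℝ} {W : Fin N → Torus → Fib N}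
    {h : Torus → Matrix (Fin N) (Fin N) ℂ} (hlamW : IsEigenSystem h lam W)
    (hcrit : Disjoint (Icc a b) (criticalSet lam W))
    (hζs : ContDiff ℝ ∞ ζ) (hζ : Function.support ζ ⊆ Icc a b)
    {V : Seq N →L[ℂ] Seq N} (hV : V.IsSymmetric) {q : ℝ → ℝ≥0∞}
    (hq : ∀ r, ∀ S : Finset ℤ, (∀ i ∈ S, i ∈ window r) → ‖truncL S * V‖ₑ ≤ q r)
    (hfin : ∫⁻ r in Ioi (1 : ℝ), q r < ⊤) :
    IsOfClassC11 (conjugateOperator ζ lam W) V := by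
  have hext := fun j => exists_admissible_extension (l := lam j) (w := W j) hζ hζs
    (fun c hc hcs => Set.disjoint_left.mp hcrit hc (mem_iUnion.mpr ⟨j, Or.inl hcs⟩))
    (fun x hx hd => Set.disjoint_left.mp hcrit hx (mem_iUnion.mpr ⟨j, Or.inr ⟨x, hd, rfl⟩⟩))
    (hlamW.piecewise_lam j) (hlamW.piecewise_W j)
  choose hF g hg hge hgb using hext
  have hW : ∀ j, EssBounded (W j) := fun j k => by
    have e : (fun p => W j p k) = circleLift fun x => g j x k :=
      eq_circleLift fun x hx => by rw [hge j x hx]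
    rw [e]
    exact memLp_circleLift (continuous_coord (hg j) k)
  have hFp := fun j => vectorField_periodic ζ (lam j)
  obtain ⟨U, hU⟩ := exists_unitaryGroup_conjugateGraph (F := fun j => vectorField ζ (lam j)) hW
    hlamW.orthonormal fun j => (bandGraph_eq_and_exists_unitaryGroup (hF j) (hFp j)).1
  have hgraph : (conjugateOperator ζ lam W).graph =
      conjugateGraph W fun j => vectorField ζ (lam j) := by
    -- `toLinearPMap` recovers the relation once it is single valued, which follows from uniqueness
    -- of the derivative of `U t 0`.
    refine Submodule.toLinearPMap_graph_eq _ fun p hp h0 => ?_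
    refine hU.unique (u := 0) ?_ (Submodule.zero_mem _)
    rw [← h0]
    exact hp
  refine ⟨U, ⟨hU.zero, hU.add, hU.isometry, hU.continuous, fun ψ φ => ?_⟩, ?_⟩
  · rw [hgraph]
    exact hU.generator ψ φ
  · refine lintegral_secondDiff_lt_top_of_window hU ?_
      (ContinuousLinearMap.isSelfAdjoint_iff_isSymmetric.mpr hV) hq hfin
    refine exists_truncL_mem_conjugateGraph hlamW.orthonormal hF hFp hge (fun j k => ?_) hW
    refine ⟨contDiff_conj_apply (hg j) k, (hgb j).imp_right fun hp x => ?_⟩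
    exact congrArg (fun z : Fib N => (starRingEnd ℂ) (z k)) (hp x)

end VectorField

end BlockLaurent
end

theorem mainTheorem11 {N : ℕ} (hN : 1 ≤ N)
    (A : ℤ → Matrix (Fin N) (Fin N) ℂ)
    (hA_summable : ∀ k l, Summable fun j : ℤ => ‖A j k l‖)
    (hA_symm : ∀ j, A (-j) = (A j)ᴴ)
    (hA_hol : BlockLaurent.HasHolomorphicExtension (BlockLaurent.symbol A))
    (lam : Fin N → BlockLaurent.Torus → ℝ)
    (W : Fin N → BlockLaurent.Torus → BlockLaurent.Fib N)
    (hlamW : BlockLaurent.IsEigenSystem (BlockLaurent.symbol A) lam W)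
    -- the compact interval `Δ = [c, d]`, and the open interval `I = (a, b)` containing it
    (a b c d : ℝ) (hac : a < c) (hcd : c ≤ d) (hdb : d < b)
    (hcrit : Disjoint (Icc a b) (BlockLaurent.criticalSet lam W))
    -- the cut-off function
    (ζ : ℝ → ℝ) (hζ_smooth : ContDiff ℝ ∞ ζ)
    (hζ_supp : Function.support ζ ⊆ Icc a b) (hζ_one : ∀ x ∈ Icc c d, ζ x = 1)
    (V : BlockLaurent.Seq N →L[ℂ] BlockLaurent.Seq N) (hV : V.IsSymmetric) :
    (∫⁻ r in Ioi (1 : ℝ), (BlockLaurent.schurQuantity V r) ^ (1 / 2 : ℝ) < ⊤ →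
      BlockLaurent.IsOfClassC11 (BlockLaurent.conjugateOperator ζ lam W) V) ∧
    (∫⁻ r in Ioi (1 : ℝ), (BlockLaurent.hilbertSchmidtQuantity V r) ^ (1 / 2 : ℝ) < ⊤ →
      BlockLaurent.IsOfClassC11 (BlockLaurent.conjugateOperator ζ lam W) V) :=
  ⟨BlockLaurent.isOfClassC11_of_window hlamW hcrit hζ_smooth hζ_supp hV
      fun _ _ => BlockLaurent.enorm_truncL_mul_le_schur V,
    BlockLaurent.isOfClassC11_of_window hlamW hcrit hζ_smooth hζ_supp hV
      fun _ _ => BlockLaurent.enorm_truncL_mul_le_hilbertSchmidt V⟩
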